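/- **Setting.** Let $\mathrm{Bi}, A_0, \mathrm H, m_0, h_0, T$ be positive constants, $L\in\mathbb R$, $S_t:=(0,t)$ and $Q(T):=(0,T)\times(0,1)$. Assume: * $b\in W^{1,2}(0,T)$ with $0<b_*\le b\le b^*$ a.e. on $(0,T)$, for constants $b_*,b^*$; * $\sigma\in C^1(\mathbb R)\cap W^{1,\infty}(\mathbb R)$, and there is $r_\sigma$ with $0<h_0<r_\sigma$ such that $\sigma'>0$ on $(0,r_\sigma)$ and $\sigma=c_0$ on $[r_\sigma,\infty)$, where $0<c_0<b^*/\mathrm H$; * $u_0\in H^2(0,1)$. Let $(\cdot,\cdot)$ and $\|\cdot\|$ be the inner product and the norm of $L^2(0,1)$. For a front position $\eta(\tau)>0$ and a profile $v(\tau,y)$ put $$a(\tau;v,\eta;\varphi):=\Big(\tfrac{\partial v}{\partial\tau},\varphi\Big)-\tfrac{\eta'}{\eta}\Big(y\tfrac{\partial v}{\partial y},\varphi\Big)+\tfrac1{\eta^2}\Big(\tfrac{\partial v}{\partial y},\tfrac{\partial\varphi}{\partial y}\Big)-\tfrac{\mathrm{Bi}}{\eta}\Big(\tfrac{b(\tau)}{m_0}-\mathrm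 H\,v(\tau,0)\Big)\varphi(0)+\tfrac{\eta'}{\eta}v(\tau,1)\varphi(1).$$ **Problem (P).** A weak solution of $(P)$ on $S_T$ is a pair $(u,h)$ with $h\in W^{1,\infty}(S_T)$, $h>0$ on $[0,T]$, $h_0<h(T)\le L$, and $u\in W^{1,2}(Q(T))\cap L^\infty(S_T,H^1(0,1))\cap L^2(S_T,H^2(0,1))$ (with $u$, $h$ represented by continuous functions on $[0,T]\times[0,1]$ and $[0,T]$), such that for a.e. $\tau\in S_T$ $$a(\tau;u,h;\varphi)=0\ \text{ for all }\varphi\in H^1(0,1),\qquad h'(\tau)=A_0\Big(u(\tau,1)-\frac{\sigma(h(\tau))}{m_0}\Big),$$ and $u(0,\cdot)=u_0$ on $[0,1]$, $h(0)=h_0$. **Problem (P_d).** Let $0=y_0<y_1<\dots<y_n=1$ be a mesh of $[0,1]$, of mesh size $k:=\max_i(y_{i+1}-y_i)$, and let $V_k$ be the space of continuous functions on $[0,1]$ that are affine on each $[y_i,y_{i+1}]$. A weak solution of $(P_d)$ on $S_{T'}$ is a pair $(u_k,h_k)$ with $h_k\in W^{1,\infty}(S_{T'})$, $h_k>0$ on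 $[0,T']$, $h_0<h_k(T')\le L$, and $u_k\in H^1(S_{T'},V_k)\cap L^2(S_{T'},H^1(0,1))\cap L^\infty(S_{T'},L^2(0,1))$ (represented by continuous functions of $\tau\in[0,T']$), such that for a.e. $\tau\in S_{T'}$ $$a(\tau;u_k,h_k;\varphi_k)=0\ \text{ for all }\varphi_k\in V_k,\qquad h_k'(\tau)=A_0\Big(u_k(\tau,1)-\frac{\sigma(h_k(\tau))}{m_0}\Big),$$ and $u_k(0)=I_ku_0$, the Lagrange interpolant of $u_0$ in $V_k$, and $h_k(0)=h_0$. **Theorem (a priori error estimate).** There is a time $\hat T\in(0,T]$, depending only on the data above, such that for every weak solution $(u,h)$ of $(P)$ on $S_T$ there is a constant $c>0$ with the following property. For every mesh, of mesh size $k$, every $T'\in(0,T]$ and every weak solution $(u_k,h_k)$ of $(P_d)$ on $S_{T'}$, one has, with $t:=\min\{\hat T,T'\}$ (so $t=\hat T$ whenever the discrete solution exists on $S_{\hat T}$), $$\sup_{0\le\tau\le t}\|u(\tau)-u_k(\tau)\|^2+\int_0^{t}\|u(\tau)-u_k(\tau)\|_{H^1(0,1)}^2\,d\tau+\|h-h_k\|_{H^1(S_t)}^2\le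 c\,k^2 .$$ In particular $\hat T$ and $c$ do not depend on $k$ or on the mesh. -/

import Mathlib

open MeasureTheory Set
open scoped ENNReal NNReal ContDiff

namespace RubberFEM

noncomputable section

/-! ## Weak derivatives and Sobolev spaces -/

section Sobolev

variable {E : Type*} [NormedAddCommGroup E] [NormedSpace ℝ E] [MeasureSpace E]

/-- `g` is the weak derivative of `f` in the direction `v` on the open set `Ω`, tested against
`C_c^∞(Ω)`. -/
def HasWeakDeriv (Ω : Set E) (v : E) (f g : E → ℝ) : Prop :=
  LocallyIntegrableOn f Ω volume ∧ LocallyIntegrableOn g Ω volume ∧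
    ∀ φ : E → ℝ, ContDiff ℝ ∞ φ → HasCompactSupport φ → tsupport φ ⊆ Ω →
      ∫ x in Ω, f x * fderiv ℝ φ x v = - ∫ x in Ω, g x * φ x

open Classical in
/-- A representative of the weak derivative of `f` in the direction `v` on `Ω`
(unique almost everywhere), and `0` if there is none. -/
def weakDeriv (Ω : Set E) (v : E) (f : E → ℝ) : E → ℝ :=
  if h : ∃ g, HasWeakDeriv Ω v f g then h.choose else 0

/-- `f ∈ W^{1,p}(Ω)`: `f` and all its first weak derivatives are in `L^p(Ω)`. -/
def MemW1 (p : ℝ≥0∞) (Ω : Set E) (f : E → ℝ) : Prop :=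
  MemLp f p (volume.restrict Ω) ∧
    ∀ v : E, ∃ g : E → ℝ, MemLp g p (volume.restrict Ω) ∧ HasWeakDeriv Ω v f g

end Sobolev

/-- The weak derivative of a function of one variable on the interval `(a, b)`. -/
def wd (a b : ℝ) (f : ℝ → ℝ) : ℝ → ℝ := weakDeriv (Ioo a b) 1 f

/-- `f ∈ H²(a, b)`. -/
def MemH2 (a b : ℝ) (f : ℝ → ℝ) : Prop :=
  MemW1 2 (Ioo a b) f ∧ MemW1 2 (Ioo a b) (wd a b f)

/-- `‖f‖²` in `L²(a, b)`, with values in `[0, ∞]`. -/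
def l2NormSq (a b : ℝ) (f : ℝ → ℝ) : ℝ≥0∞ :=
  eLpNorm f 2 (volume.restrict (Ioo a b)) ^ 2

open Classical in
/-- `‖f‖²` in `H¹(a, b)`, equal to `∞` if `f ∉ H¹(a, b)`. -/
def h1NormSq (a b : ℝ) (f : ℝ → ℝ) : ℝ≥0∞ :=
  if MemW1 2 (Ioo a b) f then l2NormSq a b f + l2NormSq a b (wd a b f) else ⊤

open Classical in
/-- `‖f‖²` in `H²(a, b)`, equal to `∞` if `f ∉ H²(a, b)`. -/
def h2NormSq (a b : ℝ) (f : ℝ → ℝ) : ℝ≥0∞ :=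
  if MemH2 a b f then
    l2NormSq a b f + l2NormSq a b (wd a b f) + l2NormSq a b (wd a b (wd a b f))
  else ⊤

/-- The cylinder `Q(T) = (0, T) × (0, 1)`. -/
def cyl (T : ℝ) : Set (ℝ × ℝ) := Ioo 0 T ×ˢ Ioo 0 1

/-- The weak time derivative on `Q(T)` of a function `u (τ, y)`. -/
def timeDeriv (T : ℝ) (u : ℝ → ℝ → ℝ) (τ y : ℝ) : ℝ :=
  weakDeriv (cyl T) ((1, 0) : ℝ × ℝ) (Function.uncurry u) (τ, y)

/-- `u ∈ L²(S_T, X)`, where `N` is the (extended) squared norm of the space `X` of functions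
on `(0, 1)`. -/
def MemL2Time (N : (ℝ → ℝ) → ℝ≥0∞) (T : ℝ) (u : ℝ → ℝ → ℝ) : Prop :=
  AEStronglyMeasurable (Function.uncurry u) (volume.restrict (cyl T)) ∧
    (∀ᵐ τ ∂(volume.restrict (Ioo 0 T)), N (u τ) < ⊤) ∧
    ∫⁻ τ in Ioo 0 T, N (u τ) < ⊤

/-- `u ∈ L^∞(S_T, X)`, where `N` is the (extended) squared norm of the space `X` of functions
on `(0, 1)`. -/
def MemLinftyTime (N : (ℝ → ℝ) → ℝ≥0∞) (T : ℝ) (u : ℝ → ℝ → ℝ) : Prop :=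
  AEStronglyMeasurable (Function.uncurry u) (volume.restrict (cyl T)) ∧
    ∃ C : ℝ≥0, ∀ᵐ τ ∂(volume.restrict (Ioo 0 T)), N (u τ) ≤ C

/-! ## The data -/

/-- The data of the dimensionless problem: Biot number `Bi`, Thiele modulus `A₀`, Henry constant
`H`, reference concentration `m₀`, initial front position `h₀`, initial concentration `u₀`,
boundary concentration `b` with its bounds, and the swelling function `σ` with its plateau value
`c₀` reached at `rσ`. -/
structure Data where
  (Bi A₀ H m₀ h₀ : ℝ)
  (bLow bHigh rσ c₀ : ℝ)
  (b σ u₀ : ℝ → ℝ)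

/-- The assumptions on the data, on the time horizon `T`. -/
structure Data.Admissible (d : Data) (T : ℝ) : Prop where
  T_pos : 0 < T
  Bi_pos : 0 < d.Bi
  A₀_pos : 0 < d.A₀
  H_pos : 0 < d.H
  m₀_pos : 0 < d.m₀
  h₀_pos : 0 < d.h₀
  b_mem : MemW1 2 (Ioo 0 T) d.b
  bLow_pos : 0 < d.bLow
  b_bounds : ∀ᵐ τ ∂(volume.restrict (Ioo 0 T)), d.bLow ≤ d.b τ ∧ d.b τ ≤ d.bHigh
  σ_contDiff : ContDiff ℝ 1 d.σ
  σ_mem : MemW1 ⊤ univ d.σ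
  σ_deriv_pos : ∀ x ∈ Ioo 0 d.rσ, 0 < deriv d.σ x
  σ_eq : ∀ x, d.rσ ≤ x → d.σ x = d.c₀
  c₀_pos : 0 < d.c₀
  c₀_lt : d.c₀ < d.bHigh / d.H
  h₀_lt : d.h₀ < d.rσ
  /-- `u₀ ∈ H²(0, 1)`, given by its continuous representative. -/
  u₀_cont : ContinuousOn d.u₀ (Icc 0 1)
  u₀_mem : MemH2 0 1 d.u₀

/-! ## The continuous problem -/

/-- The left-hand side of the weak formulation at one instant: `β` is the value of `b`, `η` and
`η'` are the position and speed of the front, `v` is the concentration profile, `v'` its time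
derivative, and `φ` the test function. -/
def weakForm (d : Data) (β η η' : ℝ) (v v' φ : ℝ → ℝ) : ℝ :=
  (∫ y in Ioo (0 : ℝ) 1, v' y * φ y)
    - η' / η * (∫ y in Ioo (0 : ℝ) 1, y * wd 0 1 v y * φ y)
    + 1 / η ^ 2 * (∫ y in Ioo (0 : ℝ) 1, wd 0 1 v y * wd 0 1 φ y)
    - 1 / η * d.Bi * (β / d.m₀ - d.H * v 0) * φ 0
    + η' / η * v 1 * φ 1

/-- `(u, h)` is a weak solution of the continuous problem on `S_T = (0, T)`. As boundary and
initial values enter, `u` and `h` stand for their continuous representatives. -/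
structure IsWeakSolution (d : Data) (L T : ℝ) (u : ℝ → ℝ → ℝ) (h : ℝ → ℝ) : Prop where
  h_cont : ContinuousOn h (Icc 0 T)
  h_mem : MemW1 ⊤ (Ioo 0 T) h
  h_pos : ∀ τ ∈ Icc 0 T, 0 < h τ
  h_end : d.h₀ < h T ∧ h T ≤ L
  u_cont : ContinuousOn (Function.uncurry u) (Icc 0 T ×ˢ Icc 0 1)
  u_mem : MemW1 2 (cyl T) (Function.uncurry u)
  u_mem_Linfty_H1 : MemLinftyTime (h1NormSq 0 1) T u
  u_mem_L2_H2 : MemL2Time (h2NormSq 0 1) T u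
  weak_eq : ∀ᵐ τ ∂(volume.restrict (Ioo 0 T)),
    ∀ φ : ℝ → ℝ, ContinuousOn φ (Icc 0 1) → MemW1 2 (Ioo 0 1) φ →
      weakForm d (d.b τ) (h τ) (wd 0 T h τ) (u τ) (timeDeriv T u τ) φ = 0
  front_eq : ∀ᵐ τ ∂(volume.restrict (Ioo 0 T)),
    wd 0 T h τ = d.A₀ * (u τ 1 - d.σ (h τ) / d.m₀)
  u_init : ∀ y ∈ Icc (0 : ℝ) 1, u 0 y = d.u₀ y
  h_init : h 0 = d.h₀

/-! ## The semi-discrete problem -/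

/-- A mesh `0 = y_0 < y_1 < ⋯ < y_n = 1` of `[0, 1]` (the two endpoint conditions force
`n ≥ 1`). -/
structure Mesh where
  n : ℕ
  node : Fin (n + 1) → ℝ
  strictMono : StrictMono node
  node_zero : node 0 = 0
  node_last : node (Fin.last n) = 1

/-- The mesh size: the largest length of an element. -/
def Mesh.size (M : Mesh) : ℝ := ⨆ i : Fin M.n, (M.node i.succ - M.node i.castSucc)

/-- The space of continuous piecewise affine functions (only the values on `[0, 1]` matter). -/
def Mesh.V (M : Mesh) : Set (ℝ → ℝ) :=
  {v | ContinuousOn v (Icc 0 1) ∧ ∀ i : Fin M.n, ∃ p q : ℝ,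
    ∀ y ∈ Icc (M.node i.castSucc) (M.node i.succ), v y = p * y + q}

/-- On `[0, 1]`, `w` is the Lagrange interpolant of `f` of degree one. -/
def Mesh.IsInterpolant (M : Mesh) (f w : ℝ → ℝ) : Prop :=
  w ∈ M.V ∧ ∀ i, w (M.node i) = f (M.node i)

/-- `(u, h)` is a weak solution of the semi-discrete problem on the mesh `M` and the interval
`S_T = (0, T)`. The fields `uk_cont` and `uk_mem` say that `u ∈ H¹(S_T, V_k)`, where `V_k` is
finite dimensional. -/
structure IsDiscreteSolution (d : Data) (M : Mesh) (L T : ℝ) (u : ℝ → ℝ → ℝ) (h : ℝ → ℝ) :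
    Prop where
  h_cont : ContinuousOn h (Icc 0 T)
  h_mem : MemW1 ⊤ (Ioo 0 T) h
  h_pos : ∀ τ ∈ Icc 0 T, 0 < h τ
  h_end : d.h₀ < h T ∧ h T ≤ L
  uk_V : ∀ τ ∈ Icc 0 T, u τ ∈ M.V
  uk_cont : ∀ y ∈ Icc (0 : ℝ) 1, ContinuousOn (fun τ => u τ y) (Icc 0 T)
  uk_mem : ∀ y ∈ Icc (0 : ℝ) 1, MemW1 2 (Ioo 0 T) (fun τ => u τ y)
  uk_mem_L2_H1 : MemL2Time (h1NormSq 0 1) T u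
  uk_mem_Linfty_L2 : MemLinftyTime (l2NormSq 0 1) T u
  weak_eq : ∀ᵐ τ ∂(volume.restrict (Ioo 0 T)), ∀ φ ∈ M.V,
    weakForm d (d.b τ) (h τ) (wd 0 T h τ) (u τ) (timeDeriv T u τ) φ = 0
  front_eq : ∀ᵐ τ ∂(volume.restrict (Ioo 0 T)),
    wd 0 T h τ = d.A₀ * (u τ 1 - d.σ (h τ) / d.m₀)
  u_init : M.IsInterpolant d.u₀ (u 0)
  h_init : h 0 = d.h₀

/-- The squared norm of `e` in `L^∞(S_T, L²(0,1)) ∩ L²(S_T, H¹(0,1))`; the `L^∞` part is the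
supremum over all of `[0, T]`. -/
def energyNormSq (T : ℝ) (e : ℝ → ℝ → ℝ) : ℝ≥0∞ :=
  (⨆ τ ∈ Icc 0 T, l2NormSq 0 1 (e τ)) + ∫⁻ τ in Ioo 0 T, h1NormSq 0 1 (e τ)

end

end RubberFEM

open RubberFEM

/-!
The estimate has two ingredients: bounds for the semi-discrete solutions that are uniform in the
mesh, and an error inequality for the difference of the two solutions, closed by Gronwall's lemma.

*Uniform bounds* (`exists_discreteBounds`). Write `(v, g)` for a semi-discrete solution. Tested with
`∂v/∂τ` and multiplied by `g`, the semi-discrete problem becomes an energy balance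
(`IsDiscreteSolution.energyDeriv_add`): the speed of the front is `A₀ (v(1) - σ(g)/m₀)`, so all
boundary terms containing `∂v/∂τ` are time derivatives of functions of `b`, `g` and the boundary
values of `v`, up to terms without `∂v/∂τ`. As long as the boundary values and the front stay near
their initial values, the energy bounds `∂v/∂y` in `L²(0,1)` and `∂v/∂τ` in `L²` of the cylinder.
The second bound makes the displacement of `v` in `L²(0,1)` small for short times, and with the first bound and the trace
inequality the displacement of the boundary values is small too. By continuity the solution never
leaves the neighbourhood during a time that depends on the data only
(`IsDiscreteSolution.improve_bounds`, `lt_zero_of_bootstrap`). This time is the `T̂` of the theorem.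

*Error inequality* (`error_inequality`). Write `I_k` for the interpolation operator,
`e = u - u_k` and `θ = I_k u - u_k`. The two weak formulations are subtracted and tested with `θ`.
In one space dimension, `∂(u - I_k u)/∂y` is orthogonal to the derivatives of the finite element
functions, and `u - I_k u` vanishes at the two end points. So the diffusion term yields
`‖∂θ/∂y‖²` exactly, and no interpolation error enters the boundary terms. The term with the time
derivative is `(∂e/∂τ, θ) = (∂e/∂τ, e) - (∂e/∂τ, u - I_k u)`. The last product is of order `k²`,
because `u - I_k u` is of order `k²` in `L²(0,1)` and both time derivatives are bounded in `L²` of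
the cylinder. The second space derivative of `u` that enters here is expressed by the equation in
terms of `∂u/∂τ` and `∂u/∂y` (`IsWeakSolution.ae_hasWeakDeriv_wd`). The remaining terms are absorbed
by `‖∂θ/∂y‖²` or are multiples of `‖e‖² + (h - h_k)²`.

Weak derivatives are handled throughout by way of absolutely continuous functions
(`IsPrimitiveOn`). In particular a continuous function on the cylinder with an integrable weak time
derivative is, for almost every `y`, an absolutely continuous function of time
(`HasWeakDeriv.ae_isPrimitiveOn`), which gives the derivative of `‖e‖²`
(`isPrimitiveOn_l2Norm_sq`).
-/

namespace RubberFEM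

/-! ### Primitives of integrable functions and weak derivatives on an interval -/

/-- `f` is a primitive of the integrable function `g` on `[a, b]`: for `a ≤ b` this says that `f`
is absolutely continuous on `[a, b]` with derivative `g`. Only the values of `f` on `[a, b]`
matter, and `g` may be changed on a null set. -/
def IsPrimitiveOn (a b : ℝ) (f g : ℝ → ℝ) : Prop :=
  IntervalIntegrable g volume a b ∧ ∀ t ∈ Icc a b, f t = f a + ∫ s in a..t, g s

namespace IsPrimitiveOn

variable {a b : ℝ} {f g f₁ g₁ f₂ g₂ : ℝ → ℝ}

theorem congr (h : IsPrimitiveOn a b f g) (hab : a ≤ b) (hf : EqOn f f₁ (Icc a b))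
    (hg : g =ᵐ[volume.restrict (Ioo a b)] g₁) : IsPrimitiveOn a b f₁ g₁ := by
  have hg' : g =ᵐ[volume.restrict (Ioc a b)] g₁ := by
    rwa [← Measure.restrict_congr_set Ioo_ae_eq_Ioc]
  refine ⟨(intervalIntegrable_congr_ae (by rwa [uIoc_of_le hab])).mp h.1, fun t ht => ?_⟩
  rw [← hf ht, ← hf (left_mem_Icc.mpr hab), h.2 t ht]
  congr 1
  apply intervalIntegral.integral_congr_ae_restrict
  rw [uIoc_of_le ht.1]
  exact ae_restrict_of_ae_restrict_of_subset (Ioc_subset_Ioc_right ht.2) hg'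

theorem mono (h : IsPrimitiveOn a b f g) {c d : ℝ} (hac : a ≤ c) (hcd : c ≤ d) (hdb : d ≤ b) :
    IsPrimitiveOn c d f g := by
  have hi : ∀ t ∈ Icc a b, IntervalIntegrable g volume a t := fun t ht =>
    h.1.mono_set (by
      rw [uIcc_of_le ht.1, uIcc_of_le (ht.1.trans ht.2)]
      exact Icc_subset_Icc_right ht.2)
  refine ⟨(hi c ⟨hac, hcd.trans hdb⟩).symm.trans (hi d ⟨hac.trans hcd, hdb⟩), fun t ht => ?_⟩
  rw [h.2 t ⟨hac.trans ht.1, ht.2.trans hdb⟩, h.2 c ⟨hac, hcd.trans hdb⟩,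
    ← intervalIntegral.integral_add_adjacent_intervals (hi c ⟨hac, hcd.trans hdb⟩)
      ((hi c ⟨hac, hcd.trans hdb⟩).symm.trans (hi t ⟨hac.trans ht.1, ht.2.trans hdb⟩))]
  ring

theorem integral_eq (h : IsPrimitiveOn a b f g) (hab : a ≤ b) :
    ∫ s in a..b, g s = f b - f a := by
  rw [h.2 b (right_mem_Icc.mpr hab)]; ring

theorem integrableOn (h : IsPrimitiveOn a b f g) (hab : a ≤ b) : IntegrableOn g (Ioo a b) := by
  have := h.1
  rw [intervalIntegrable_iff_integrableOn_Ioo_of_le hab] at this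
  exact this

theorem continuousOn (h : IsPrimitiveOn a b f g) (hab : a ≤ b) : ContinuousOn f (Icc a b) := by
  have h1 : ContinuousOn (fun t => f a + ∫ s in a..t, g s) (Icc a b) := by
    refine continuousOn_const.add ?_
    have := intervalIntegral.continuousOn_primitive_interval
      ((intervalIntegrable_iff_integrableOn_Icc_of_le hab).mp h.1 |>.mono_set
        (by rw [uIcc_of_le hab]))
    rwa [uIcc_of_le hab] at this
  exact h1.congr (fun t ht => h.2 t ht)

theorem absolutelyContinuousOnInterval (h : IsPrimitiveOn a b f g) (hab : a ≤ b) :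
    AbsolutelyContinuousOnInterval f a b := by
  have h1 := h.1.absolutelyContinuousOnInterval_intervalIntegral (c := a) (by simp)
  rw [absolutelyContinuousOnInterval_iff] at h1 ⊢
  intro ε hε
  obtain ⟨δ, hδ, H⟩ := h1 ε hε
  refine ⟨δ, hδ, fun E hE hs => ?_⟩
  refine lt_of_eq_of_lt (Finset.sum_congr rfl fun i hi => ?_) (H E hE hs)
  have h2 := hE.1 i hi
  rw [uIcc_of_le hab] at h2
  rw [h.2 _ h2.1, h.2 _ h2.2, dist_add_left]

theorem ae_hasDerivAt (h : IsPrimitiveOn a b f g) (hab : a ≤ b) :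
    ∀ᵐ t ∂(volume.restrict (Ioo a b)), HasDerivAt f (g t) t := by
  rw [ae_restrict_iff' measurableSet_Ioo]
  filter_upwards [h.1.ae_hasDerivAt_integral] with t ht ht'
  have h1 := ht (by rw [uIcc_of_le hab]; exact Ioo_subset_Icc_self ht') a (by simp)
  have h2 : HasDerivAt (fun t => f a + ∫ s in a..t, g s) (g t) t := by
    simpa using h1.const_add (f a)
  refine h2.congr_of_eventuallyEq ?_
  filter_upwards [Icc_mem_nhds ht'.1 ht'.2] with s hs using h.2 s hs

theorem of_absolutelyContinuousOnInterval (hab : a ≤ b)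
    (hf : AbsolutelyContinuousOnInterval f a b)
    (h : ∀ᵐ t ∂(volume.restrict (Ioo a b)), HasDerivAt f (g t) t) : IsPrimitiveOn a b f g := by
  have hd : IsPrimitiveOn a b f (deriv f) := by
    refine ⟨hf.intervalIntegrable_deriv, fun t ht => ?_⟩
    have h1 : AbsolutelyContinuousOnInterval f a t :=
      hf.mono (by
        rw [uIcc_of_le ht.1, uIcc_of_le hab]
        exact Icc_subset_Icc_right ht.2)
    rw [h1.integral_deriv_eq_sub]; ring
  exact hd.congr hab (fun _ _ => rfl) (h.mono fun t ht => ht.deriv)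

/-- A continuous function that is differentiable off a countable set is a primitive of its
derivative, provided that the latter is integrable. -/
theorem of_hasDerivAt (hc : ContinuousOn f (Icc a b)) {s : Set ℝ} (hs : s.Countable)
    (hd : ∀ t ∈ Ioo a b \ s, HasDerivAt f (g t) t) (hg : IntervalIntegrable g volume a b) :
    IsPrimitiveOn a b f g := by
  refine ⟨hg, fun t ht => ?_⟩
  have := integral_eq_of_hasDerivAt_off_countable_of_le f g ht.1 hs
    (hc.mono (Icc_subset_Icc_right ht.2))
    (fun x hx => hd x ⟨⟨hx.1.1, hx.1.2.trans_le ht.2⟩, hx.2⟩)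
    (hg.mono_set (by
      rw [uIcc_of_le ht.1, uIcc_of_le (ht.1.trans ht.2)]
      exact Icc_subset_Icc_right ht.2))
  rw [this]; ring

theorem const (c : ℝ) : IsPrimitiveOn a b (fun _ => c) (fun _ => 0) :=
  ⟨by simp, by simp⟩

theorem add (h₁ : IsPrimitiveOn a b f₁ g₁) (h₂ : IsPrimitiveOn a b f₂ g₂) :
    IsPrimitiveOn a b (fun t => f₁ t + f₂ t) (fun t => g₁ t + g₂ t) := by
  refine ⟨h₁.1.add h₂.1, fun t ht => ?_⟩
  have hsub : uIcc a t ⊆ uIcc a b := by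
    rw [uIcc_of_le ht.1, uIcc_of_le (ht.1.trans ht.2)]
    exact Icc_subset_Icc_right ht.2
  rw [intervalIntegral.integral_add (h₁.1.mono_set hsub) (h₂.1.mono_set hsub)]
  linarith [h₁.2 t ht, h₂.2 t ht]

theorem const_mul (c : ℝ) (h : IsPrimitiveOn a b f g) :
    IsPrimitiveOn a b (fun t => c * f t) (fun t => c * g t) := by
  refine ⟨h.1.const_mul c, fun t ht => ?_⟩
  rw [intervalIntegral.integral_const_mul, ← mul_add, ← h.2 t ht]

theorem sub (h₁ : IsPrimitiveOn a b f₁ g₁) (h₂ : IsPrimitiveOn a b f₂ g₂) :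
    IsPrimitiveOn a b (fun t => f₁ t - f₂ t) (fun t => g₁ t - g₂ t) := by
  have := h₁.add (h₂.const_mul (-1))
  simpa [sub_eq_add_neg] using this

theorem sum {ι : Type*} (s : Finset ι) {F G : ι → ℝ → ℝ}
    (h : ∀ i ∈ s, IsPrimitiveOn a b (F i) (G i)) :
    IsPrimitiveOn a b (fun t => ∑ i ∈ s, F i t) (fun t => ∑ i ∈ s, G i t) := by
  classical
  induction s using Finset.induction_on with
  | empty => simpa using const 0
  | insert i s hi ih =>
    simp only [Finset.sum_insert hi]
    exact (h i (Finset.mem_insert_self i s)).add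
      (ih fun j hj => h j (Finset.mem_insert_of_mem hj))

theorem mul (hab : a ≤ b) (h₁ : IsPrimitiveOn a b f₁ g₁) (h₂ : IsPrimitiveOn a b f₂ g₂) :
    IsPrimitiveOn a b (fun t => f₁ t * f₂ t) (fun t => g₁ t * f₂ t + f₁ t * g₂ t) := by
  refine of_absolutelyContinuousOnInterval hab
    ((h₁.absolutelyContinuousOnInterval hab).fun_mul (h₂.absolutelyContinuousOnInterval hab)) ?_
  filter_upwards [h₁.ae_hasDerivAt hab, h₂.ae_hasDerivAt hab] with t ht₁ ht₂
  exact ht₁.mul ht₂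

theorem hasDerivAt (h : IsPrimitiveOn a b f g) (hg : ContinuousOn g (Icc a b)) {y : ℝ}
    (hy : y ∈ Ioo a b) : HasDerivAt f (g y) y := by
  have h1 : HasDerivAt (fun t => ∫ s in a..t, g s) (g y) y := by
    refine intervalIntegral.integral_hasDerivAt_right ?_ ?_
      (hg.continuousAt (Icc_mem_nhds hy.1 hy.2))
    · exact h.1.mono_set (by
        rw [uIcc_of_le hy.1.le, uIcc_of_le (hy.1.trans hy.2).le]
        exact Icc_subset_Icc_right hy.2.le)
    · exact ContinuousOn.stronglyMeasurableAtFilter isOpen_Ioo (hg.mono Ioo_subset_Icc_self) y hy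
  refine (h1.const_add (f a)).congr_of_eventuallyEq ?_
  filter_upwards [Icc_mem_nhds hy.1 hy.2] with t ht using h.2 t ht

/-- The chain rule for a continuously differentiable function of a continuously differentiable
function. -/
theorem comp (hab : a ≤ b) (h : IsPrimitiveOn a b f g) (hg : ContinuousOn g (Icc a b))
    {ψ ψ' : ℝ → ℝ} (hψ : ∀ t ∈ Icc a b, HasDerivAt ψ (ψ' (f t)) (f t))
    (hψ' : ContinuousOn (fun t => ψ' (f t)) (Icc a b)) :
    IsPrimitiveOn a b (fun t => ψ (f t)) (fun t => ψ' (f t) * g t) := by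
  have hfc := h.continuousOn hab
  refine of_hasDerivAt ?_ countable_empty (fun t ht => ?_) ?_
  · intro t ht
    exact (hψ t ht).continuousAt.comp_continuousWithinAt (hfc t ht)
  · exact (hψ t (Ioo_subset_Icc_self ht.1)).comp t (h.hasDerivAt hg ht.1)
  · apply ContinuousOn.intervalIntegrable
    rw [uIcc_of_le hab]
    exact hψ'.mul hg

/-- Integration by parts: a primitive of `g` has the weak derivative `g`. -/
theorem hasWeakDeriv (hab : a ≤ b) (h : IsPrimitiveOn a b f g) :
    HasWeakDeriv (Ioo a b) 1 f g := by
  have hfc := h.continuousOn hab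
  refine ⟨?_, (h.integrableOn hab).locallyIntegrableOn, fun φ hφ hφc hφs => ?_⟩
  · exact (hfc.mono Ioo_subset_Icc_self).locallyIntegrableOn measurableSet_Ioo
  have hφd : Continuous (deriv φ) := hφ.continuous_deriv (by simp)
  have h1 : IsPrimitiveOn a b φ (deriv φ) :=
    of_hasDerivAt hφ.continuous.continuousOn countable_empty
      (fun t _ => (hφ.differentiable (by simp) t).hasDerivAt) (hφd.intervalIntegrable _ _)
  have ha : φ a = 0 := image_eq_zero_of_notMem_tsupport fun hm => lt_irrefl a (hφs hm).1
  have hb : φ b = 0 := image_eq_zero_of_notMem_tsupport fun hm => lt_irrefl b (hφs hm).2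
  have h2 := (h.mul hab h1).integral_eq hab
  have hi1 : IntervalIntegrable (fun t => g t * φ t) volume a b :=
    h.1.mul_continuousOn hφ.continuous.continuousOn
  have hi2 : IntervalIntegrable (fun t => f t * deriv φ t) volume a b := by
    apply ContinuousOn.intervalIntegrable
    rw [uIcc_of_le hab]
    exact hfc.mul hφd.continuousOn
  rw [intervalIntegral.integral_add hi1 hi2, ha, hb, intervalIntegral.integral_of_le hab,
    intervalIntegral.integral_of_le hab, integral_Ioc_eq_integral_Ioo,
    integral_Ioc_eq_integral_Ioo] at h2
  simp only [fderiv_apply_one_eq_deriv]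
  linarith

end IsPrimitiveOn

/-- A locally integrable function is integrable against test functions. -/
theorem integrableOn_mul_of_tsupport_subset {E : Type*} [NormedAddCommGroup E]
    [MeasureSpace E] [BorelSpace E] {Ω : Set E} {f φ : E → ℝ} (hf : LocallyIntegrableOn f Ω)
    (hφ : Continuous φ) (hφc : HasCompactSupport φ) (hφs : tsupport φ ⊆ Ω) :
    IntegrableOn (fun x => f x * φ x) Ω := by
  have h3 : IntegrableOn (fun x => f x * φ x) (tsupport φ) :=
    (hf.integrableOn_compact_subset hφs hφc).mul_continuousOn hφ.continuousOn hφc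
  exact (integrableOn_iff_integrable_of_support_subset (by
    intro x hx
    exact subset_tsupport φ (right_ne_zero_of_mul hx))).mp h3 |>.integrableOn

theorem setIntegral_smul_eq_of_tsupport_subset {E : Type*} [NormedAddCommGroup E]
    [MeasureSpace E] {Ω : Set E} {f φ : E → ℝ} (hφs : tsupport φ ⊆ Ω) :
    ∫ x, φ x • f x = ∫ x in Ω, f x * φ x := by
  rw [← setIntegral_eq_integral_of_forall_compl_eq_zero (s := Ω)]
  · refine integral_congr_ae (Filter.Eventually.of_forall fun x => ?_)
    simp only [smul_eq_mul]; ring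
  · intro x hx
    rw [image_eq_zero_of_notMem_tsupport fun hm => hx (hφs hm), zero_smul]

/-- Weak derivatives are unique almost everywhere. -/
theorem HasWeakDeriv.ae_eq {E : Type*} [NormedAddCommGroup E] [NormedSpace ℝ E] [MeasureSpace E]
    [FiniteDimensional ℝ E] [BorelSpace E] {Ω : Set E} (hΩ : IsOpen Ω) {v : E}
    {f g₁ g₂ : E → ℝ} (h₁ : HasWeakDeriv Ω v f g₁) (h₂ : HasWeakDeriv Ω v f g₂) :
    g₁ =ᵐ[volume.restrict Ω] g₂ := by
  have h := hΩ.ae_eq_zero_of_integral_contDiff_smul_eq_zero (f := fun x => g₁ x - g₂ x)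
    (μ := volume) (h₁.2.1.sub h₂.2.1) (fun φ hφ hφc hφs => by
      have e1 := h₁.2.2 φ hφ hφc hφs
      have e2 := h₂.2.2 φ hφ hφc hφs
      rw [setIntegral_smul_eq_of_tsupport_subset hφs]
      simp only [sub_mul]
      rw [integral_sub (integrableOn_mul_of_tsupport_subset h₁.2.1 hφ.continuous hφc hφs)
        (integrableOn_mul_of_tsupport_subset h₂.2.1 hφ.continuous hφc hφs)]
      linarith)
  rw [Filter.EventuallyEq, ae_restrict_iff' hΩ.measurableSet]
  filter_upwards [h] with x hx hxΩ
  exact sub_eq_zero.mp (hx hxΩ)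

theorem HasWeakDeriv.weakDeriv {E : Type*} [NormedAddCommGroup E] [NormedSpace ℝ E]
    [MeasureSpace E] {Ω : Set E} {v : E} {f g : E → ℝ} (h : HasWeakDeriv Ω v f g) :
    HasWeakDeriv Ω v f (weakDeriv Ω v f) := by
  have h' : ∃ g, HasWeakDeriv Ω v f g := ⟨g, h⟩
  rw [RubberFEM.weakDeriv, dif_pos h']
  exact h'.choose_spec

theorem HasWeakDeriv.weakDeriv_ae_eq {E : Type*} [NormedAddCommGroup E] [NormedSpace ℝ E]
    [MeasureSpace E] [FiniteDimensional ℝ E] [BorelSpace E] {Ω : Set E} (hΩ : IsOpen Ω) {v : E}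
    {f g : E → ℝ} (h : HasWeakDeriv Ω v f g) :
    RubberFEM.weakDeriv Ω v f =ᵐ[volume.restrict Ω] g :=
  h.weakDeriv.ae_eq hΩ h

theorem MemW1.hasWeakDeriv {E : Type*} [NormedAddCommGroup E] [NormedSpace ℝ E]
    [MeasureSpace E] {Ω : Set E} {p : ℝ≥0∞} {f : E → ℝ} (h : MemW1 p Ω f) (v : E) :
    HasWeakDeriv Ω v f (weakDeriv Ω v f) :=
  (h.2 v).choose_spec.2.weakDeriv

theorem MemW1.memLp_weakDeriv {E : Type*} [NormedAddCommGroup E] [NormedSpace ℝ E]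
    [MeasureSpace E] [FiniteDimensional ℝ E] [BorelSpace E] {Ω : Set E} (hΩ : IsOpen Ω)
    {p : ℝ≥0∞} {f : E → ℝ} (h : MemW1 p Ω f) (v : E) :
    MemLp (weakDeriv Ω v f) p (volume.restrict Ω) := by
  obtain ⟨g, hg, hw⟩ := h.2 v
  exact (memLp_congr_ae (hw.weakDeriv_ae_eq hΩ)).mpr hg

/-- The du Bois-Reymond lemma: a function on an interval whose weak derivative vanishes is almost
everywhere constant. -/
theorem HasWeakDeriv.ae_eq_const {a b : ℝ} (hab : a < b) {f : ℝ → ℝ}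
    (h : HasWeakDeriv (Ioo a b) 1 f 0) :
    ∃ c, ∀ᵐ x ∂(volume.restrict (Ioo a b)), f x = c := by
  let B : ContDiffBump ((a + b) / 2) := ⟨(b - a) / 8, (b - a) / 4, by linarith, by linarith⟩
  set η := B.normed volume with hη
  have hηd : ContDiff ℝ ∞ η := B.contDiff_normed
  have hηc : HasCompactSupport η := B.hasCompactSupport_normed
  have hηs : tsupport η ⊆ Ioo a b := by
    rw [hη, B.tsupport_normed_eq, Real.closedBall_eq_Icc]
    intro x hx
    have h1 : B.rOut = (b - a) / 4 := rfl
    rw [h1] at hx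
    exact ⟨by linarith [hx.1], by linarith [hx.2]⟩
  have hη1 : ∫ x, η x = 1 := B.integral_normed
  refine ⟨∫ x in Ioo a b, f x * η x, ?_⟩
  set c := ∫ x in Ioo a b, f x * η x with hc
  have key := isOpen_Ioo.ae_eq_zero_of_integral_contDiff_smul_eq_zero (U := Ioo a b)
    (f := fun x => f x - c) (μ := volume)
    (h.1.sub ((locallyIntegrable_const c).locallyIntegrableOn _)) (fun ψ hψ hψc hψs => by
      have hψη : Continuous fun x => ψ x - (∫ y, ψ y) * η x :=
        hψ.continuous.sub (hηd.continuous.const_mul _)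
      set χ : ℝ → ℝ := fun x => ψ x - (∫ y, ψ y) * η x with hχ
      have hψi : Integrable ψ := hψ.continuous.integrable_of_hasCompactSupport hψc
      have hηi : Integrable η := hηd.continuous.integrable_of_hasCompactSupport hηc
      -- `χ` has mean zero, so its primitive is a test function
      have hχ0 : ∫ x, χ x = 0 := by
        rw [hχ, integral_sub hψi (hηi.const_mul _), integral_const_mul, hη1]; ring
      -- the support of `χ` is contained in a compact subinterval `[α, β]` of `(a, b)`
      have hK : IsCompact (tsupport ψ ∪ tsupport η) := hψc.isCompact.union hηc.isCompact
      have hne : (tsupport ψ ∪ tsupport η).Nonempty := by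
        by_contra hemp
        rw [not_nonempty_iff_eq_empty, union_empty_iff] at hemp
        have : ∀ x, η x = 0 := fun x => image_eq_zero_of_notMem_tsupport (by simp [hemp.2])
        simp [this] at hη1
      obtain ⟨α, hαK, hα⟩ := hK.exists_isLeast hne
      obtain ⟨β, hβK, hβ⟩ := hK.exists_isGreatest hne
      have hαab : α ∈ Ioo a b := union_subset hψs hηs hαK
      have hβab : β ∈ Ioo a b := union_subset hψs hηs hβK
      have hχs : ∀ x, x ∉ Icc α β → χ x = 0 := by
        intro x hx
        have hx1 : x ∉ tsupport ψ := fun hm => hx ⟨hα (Or.inl hm), hβ (Or.inl hm)⟩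
        have hx2 : x ∉ tsupport η := fun hm => hx ⟨hα (Or.inr hm), hβ (Or.inr hm)⟩
        simp [hχ, image_eq_zero_of_notMem_tsupport hx1, image_eq_zero_of_notMem_tsupport hx2]
      set φ : ℝ → ℝ := fun x => ∫ s in a..x, χ s with hφ
      have hφderiv : ∀ x, HasDerivAt φ (χ x) x := fun x =>
        intervalIntegral.integral_hasDerivAt_right (hψη.intervalIntegrable _ _)
          (hψη.stronglyMeasurableAtFilter _ _) hψη.continuousAt
      have hφd : deriv φ = χ := funext fun x => (hφderiv x).deriv
      have hφsm : ContDiff ℝ ∞ φ := by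
        rw [contDiff_infty_iff_deriv, hφd]
        exact ⟨fun x => (hφderiv x).differentiableAt, hψ.sub (contDiff_const.mul hηd)⟩
      have hφ0 : ∀ x, x ∉ Icc α β → φ x = 0 := by
        intro x hx
        by_cases hxα : x < α
        · refine intervalIntegral.integral_zero_ae (Filter.Eventually.of_forall fun s hs => ?_)
          apply hχs
          intro hs'
          have := (mem_uIoc.mp hs)
          rcases this with h1 | h1 <;> linarith [hs'.1, hαab.1]
        · have hxβ : β < x := by
            by_contra hcon
            exact hx ⟨not_lt.mp hxα, not_lt.mp hcon⟩
          rw [hφ, ← hχ0]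
          apply intervalIntegral.integral_eq_integral_of_support_subset
          intro s hs
          by_contra hcon
          refine hs (hχs s fun hs' => hcon ⟨?_, ?_⟩)
          · linarith [hαab.1, hs'.1]
          · linarith [hs'.2]
      have hφts : tsupport φ ⊆ Icc α β := by
        refine closure_minimal (fun x hx => ?_) isClosed_Icc
        by_contra hcon
        exact hx (hφ0 x hcon)
      have hφc : HasCompactSupport φ := HasCompactSupport.intro isCompact_Icc hφ0
      have e := h.2.2 φ hφsm hφc (hφts.trans (Icc_subset_Ioo hαab.1 hβab.2))
      simp only [fderiv_apply_one_eq_deriv, hφd, Pi.zero_apply, zero_mul, integral_zero,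
        neg_zero] at e
      have i1 := integrableOn_mul_of_tsupport_subset h.1 hψ.continuous hψc hψs
      have i2 := integrableOn_mul_of_tsupport_subset h.1 hηd.continuous hηc hηs
      have e2 : ∫ x in Ioo a b, f x * χ x
          = (∫ x in Ioo a b, f x * ψ x) - (∫ y, ψ y) * c := by
        rw [hc, ← integral_const_mul, ← integral_sub i1 (i2.const_mul _)]
        congr 1; funext x; simp only [hχ]; ring
      have e3 : ∫ x in Ioo a b, ψ x = ∫ x, ψ x := by
        apply setIntegral_eq_integral_of_forall_compl_eq_zero
        intro x hx
        exact image_eq_zero_of_notMem_tsupport fun hm => hx (hψs hm)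
      rw [setIntegral_smul_eq_of_tsupport_subset hψs]
      simp only [sub_mul]
      rw [integral_sub i1 (hψi.integrableOn.const_mul c), integral_const_mul, e3]
      linarith)
  rw [ae_restrict_iff' measurableSet_Ioo]
  filter_upwards [key] with x hx hxI
  exact sub_eq_zero.mp (hx hxI)

/-- A function with an integrable weak derivative agrees almost everywhere with a primitive. -/
theorem HasWeakDeriv.exists_ae_eq_primitive {a b : ℝ} (hab : a < b) {f g : ℝ → ℝ}
    (h : HasWeakDeriv (Ioo a b) 1 f g) (hg : IntegrableOn g (Ioo a b)) :
    ∃ F, IsPrimitiveOn a b F g ∧ f =ᵐ[volume.restrict (Ioo a b)] F := by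
  have hgi : IntervalIntegrable g volume a b :=
    (intervalIntegrable_iff_integrableOn_Ioo_of_le hab.le).mpr hg
  have hG : IsPrimitiveOn a b (fun t => ∫ s in a..t, g s) g := ⟨hgi, fun t _ => by simp⟩
  have hGw := hG.hasWeakDeriv hab.le
  have h0 : HasWeakDeriv (Ioo a b) 1 (fun t => f t - ∫ s in a..t, g s) 0 := by
    refine ⟨h.1.sub hGw.1, locallyIntegrableOn_const 0, fun φ hφ hφc hφs => ?_⟩
    have e1 := h.2.2 φ hφ hφc hφs
    have e2 := hGw.2.2 φ hφ hφc hφs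
    have hd : Continuous fun x => fderiv ℝ φ x 1 := by
      simp only [fderiv_apply_one_eq_deriv]; exact hφ.continuous_deriv (by simp)
    have hds : tsupport (fun x => fderiv ℝ φ x 1) ⊆ tsupport φ := tsupport_fderiv_apply_subset ℝ 1
    have hdc : HasCompactSupport fun x => fderiv ℝ φ x 1 := hφc.fderiv_apply ℝ 1
    simp only [sub_mul, Pi.zero_apply, zero_mul, integral_zero, neg_zero]
    rw [integral_sub (integrableOn_mul_of_tsupport_subset h.1 hd hdc (hds.trans hφs))
      (integrableOn_mul_of_tsupport_subset hGw.1 hd hdc (hds.trans hφs)), e1, e2]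
    ring
  obtain ⟨c, hc⟩ := h0.ae_eq_const hab
  refine ⟨fun t => c + ∫ s in a..t, g s, by simpa using (IsPrimitiveOn.const c).add hG, ?_⟩
  filter_upwards [hc] with t ht
  linarith

theorem HasWeakDeriv.isPrimitiveOn {a b : ℝ} (hab : a < b) {f g : ℝ → ℝ}
    (h : HasWeakDeriv (Ioo a b) 1 f g) (hf : ContinuousOn f (Icc a b))
    (hg : IntegrableOn g (Ioo a b)) : IsPrimitiveOn a b f g := by
  obtain ⟨F, hF, hfF⟩ := h.exists_ae_eq_primitive hab hg
  have hFc := hF.continuousOn hab.le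
  have h1 : EqOn f F (Ioo a b) :=
    Measure.eqOn_open_of_ae_eq hfF isOpen_Ioo (hf.mono Ioo_subset_Icc_self)
      (hFc.mono Ioo_subset_Icc_self)
  have h2 : EqOn f F (Icc a b) := by
    refine h1.of_subset_closure hf hFc Ioo_subset_Icc_self ?_
    rw [closure_Ioo hab.ne]
  exact hF.congr hab.le h2.symm Filter.EventuallyEq.rfl

/-- A continuous function in `W^{1,p}` of an interval, `p ≥ 1`, is a primitive of its weak
derivative. -/
theorem MemW1.isPrimitiveOn {a b : ℝ} (hab : a < b) {p : ℝ≥0∞} (hp : 1 ≤ p) {f : ℝ → ℝ}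
    (h : MemW1 p (Ioo a b) f) (hf : ContinuousOn f (Icc a b)) :
    IsPrimitiveOn a b f (wd a b f) :=
  (h.hasWeakDeriv 1).isPrimitiveOn hab hf ((h.memLp_weakDeriv isOpen_Ioo 1).integrable hp)

theorem IsPrimitiveOn.wd_ae_eq {a b : ℝ} (hab : a ≤ b) {f g : ℝ → ℝ}
    (h : IsPrimitiveOn a b f g) : wd a b f =ᵐ[volume.restrict (Ioo a b)] g :=
  (h.hasWeakDeriv hab).weakDeriv_ae_eq isOpen_Ioo

theorem HasWeakDeriv.const_smul {E : Type*} [NormedAddCommGroup E] [NormedSpace ℝ E]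
    [MeasureSpace E] {Ω : Set E} {v : E} {f g : E → ℝ} (h : HasWeakDeriv Ω v f g) (c : ℝ) :
    HasWeakDeriv Ω (c • v) f (fun x => c * g x) := by
  refine ⟨h.1, h.2.1.smul c, fun φ hφ hφc hφs => ?_⟩
  have := h.2.2 φ hφ hφc hφs
  simp only [map_smul, smul_eq_mul, mul_left_comm _ c, mul_assoc c, integral_const_mul, this]
  ring

theorem memLp_of_continuousOn_Icc {a b : ℝ} {p : ℝ≥0∞} {f : ℝ → ℝ}
    (hf : ContinuousOn f (Icc a b)) : MemLp f p (volume.restrict (Ioo a b)) := by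
  obtain ⟨C, hC⟩ := isCompact_Icc.exists_bound_of_continuousOn hf
  exact MemLp.of_bound ((hf.mono Ioo_subset_Icc_self).aestronglyMeasurable measurableSet_Ioo) C
    (ae_restrict_of_forall_mem measurableSet_Ioo fun x hx => hC x (Ioo_subset_Icc_self hx))

/-- Primitives of functions in `L^p` belong to `W^{1,p}`. -/
theorem IsPrimitiveOn.memW1 {a b : ℝ} (hab : a ≤ b) {p : ℝ≥0∞} {f g : ℝ → ℝ}
    (h : IsPrimitiveOn a b f g) (hg : MemLp g p (volume.restrict (Ioo a b))) :
    MemW1 p (Ioo a b) f := by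
  refine ⟨memLp_of_continuousOn_Icc (h.continuousOn hab),
    fun v => ⟨fun x => v * g x, hg.const_mul v, ?_⟩⟩
  simpa using (h.hasWeakDeriv hab).const_smul v

/-! ### Square-integrable functions -/

section CauchySchwarz

variable {α : Type*} [MeasurableSpace α] {μ : Measure α} {f g : α → ℝ}

/-- The Cauchy-Schwarz inequality. -/
theorem sq_integral_mul_le (hf : MemLp f 2 μ) (hg : MemLp g 2 μ) :
    (∫ x, f x * g x ∂μ) ^ 2 ≤ (∫ x, f x ^ 2 ∂μ) * ∫ x, g x ^ 2 ∂μ := by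
  have hfg : Integrable (fun x => f x * g x) μ := hf.integrable_mul hg
  have key : ∀ t : ℝ, 0 ≤ (∫ x, f x ^ 2 ∂μ) * (t * t) + (2 * ∫ x, f x * g x ∂μ) * t
      + ∫ x, g x ^ 2 ∂μ := by
    intro t
    have h1 : 0 ≤ ∫ x, (t * f x + g x) ^ 2 ∂μ := integral_nonneg fun x => sq_nonneg _
    have h2 : ∀ x, (t * f x + g x) ^ 2
        = (t * t) * f x ^ 2 + (2 * t) * (f x * g x) + g x ^ 2 := fun x => by ring
    simp only [h2] at h1
    rw [integral_add ((hf.integrable_sq.const_mul _).fun_add (hfg.const_mul _)) hg.integrable_sq,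
      integral_add (hf.integrable_sq.const_mul _) (hfg.const_mul _), integral_const_mul,
      integral_const_mul] at h1
    linarith
  have := discrim_le_zero key
  rw [discrim] at this
  nlinarith

theorem sq_integral_le [IsFiniteMeasure μ] (hf : MemLp f 2 μ) :
    (∫ x, f x ∂μ) ^ 2 ≤ μ.real univ * ∫ x, f x ^ 2 ∂μ := by
  have h1 : MemLp (fun _ : α => (1 : ℝ)) 2 μ := memLp_const 1
  have := sq_integral_mul_le h1 hf
  simpa using this

theorem eLpNorm_two_sq_eq (hf : MemLp f 2 μ) :
    eLpNorm f 2 μ ^ 2 = ENNReal.ofReal (∫ x, f x ^ 2 ∂μ) := by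
  rw [hf.eLpNorm_eq_integral_rpow_norm (by norm_num) (by norm_num),
    ← ENNReal.ofReal_pow (by positivity)]
  congr 1
  have h0 : 0 ≤ ∫ x, f x ^ 2 ∂μ := integral_nonneg fun x => sq_nonneg _
  simp only [ENNReal.toReal_ofNat, Real.rpow_two, Real.norm_eq_abs, sq_abs]
  rw [← Real.rpow_natCast, ← Real.rpow_mul h0]
  norm_num

end CauchySchwarz

theorem l2NormSq_eq {a b : ℝ} {f : ℝ → ℝ} (hf : MemLp f 2 (volume.restrict (Ioo a b))) :
    l2NormSq a b f = ENNReal.ofReal (∫ y in Ioo a b, f y ^ 2) :=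
  eLpNorm_two_sq_eq hf

/-- The norm of `L²(0, 1)`. -/
noncomputable def l2Norm (f : ℝ → ℝ) : ℝ := Real.sqrt (∫ y in Ioo (0 : ℝ) 1, f y ^ 2)

/-- `f ∈ L²(0, 1)`. -/
abbrev IsL2 (f : ℝ → ℝ) : Prop := MemLp f 2 (volume.restrict (Ioo (0 : ℝ) 1))

section L2

variable {f g : ℝ → ℝ}

theorem l2Norm_nonneg (f : ℝ → ℝ) : 0 ≤ l2Norm f := Real.sqrt_nonneg _

theorem l2Norm_sq (f : ℝ → ℝ) : l2Norm f ^ 2 = ∫ y in Ioo (0 : ℝ) 1, f y ^ 2 :=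
  Real.sq_sqrt (integral_nonneg fun _ => sq_nonneg _)

theorem l2Norm_congr (h : f =ᵐ[volume.restrict (Ioo (0 : ℝ) 1)] g) : l2Norm f = l2Norm g := by
  rw [l2Norm, l2Norm]
  congr 1
  exact integral_congr_ae (h.mono fun x hx => by simp only [hx])

theorem abs_integral_mul_le (hf : IsL2 f) (hg : IsL2 g) :
    |∫ y in Ioo (0 : ℝ) 1, f y * g y| ≤ l2Norm f * l2Norm g := by
  refine abs_le_of_sq_le_sq ?_ (mul_nonneg (l2Norm_nonneg _) (l2Norm_nonneg _))
  rw [mul_pow, l2Norm_sq, l2Norm_sq]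
  exact sq_integral_mul_le hf hg

theorem integral_abs_mul_le (hf : IsL2 f) (hg : IsL2 g) :
    ∫ y in Ioo (0 : ℝ) 1, |f y * g y| ≤ l2Norm f * l2Norm g := by
  have h := (le_abs_self _).trans (abs_integral_mul_le hf.abs hg.abs)
  simpa only [l2Norm, Pi.abs_apply, sq_abs, abs_mul] using h

theorem l2Norm_add_le (hf : IsL2 f) (hg : IsL2 g) :
    l2Norm (fun y => f y + g y) ≤ l2Norm f + l2Norm g := by
  refine le_of_sq_le_sq ?_ (add_nonneg (l2Norm_nonneg _) (l2Norm_nonneg _))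
  have h1 := (le_abs_self _).trans (abs_integral_mul_le hf hg)
  have hfg : Integrable (fun x => f x * g x) (volume.restrict (Ioo (0 : ℝ) 1)) :=
    hf.integrable_mul hg
  have h2 : ∀ x, (f x + g x) ^ 2 = f x ^ 2 + 2 * (f x * g x) + g x ^ 2 := fun x => by ring
  have e : l2Norm (fun y => f y + g y) ^ 2
      = l2Norm f ^ 2 + 2 * (∫ y in Ioo (0 : ℝ) 1, f y * g y) + l2Norm g ^ 2 := by
    simp only [l2Norm_sq, h2]
    rw [integral_add (hf.integrable_sq.fun_add (hfg.const_mul _)) hg.integrable_sq,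
      integral_add hf.integrable_sq (hfg.const_mul _), integral_const_mul]
  rw [e]
  nlinarith

theorem l2Norm_const_mul (c : ℝ) (f : ℝ → ℝ) : l2Norm (fun y => c * f y) = |c| * l2Norm f := by
  rw [l2Norm, l2Norm, ← Real.sqrt_sq_eq_abs, ← Real.sqrt_mul (sq_nonneg c), ← integral_const_mul]
  simp only [mul_pow]

theorem l2Norm_sub_le (hf : IsL2 f) (hg : IsL2 g) :
    l2Norm (fun y => f y - g y) ≤ l2Norm f + l2Norm g := by
  have := l2Norm_add_le hf hg.neg
  simpa only [Pi.neg_apply, l2Norm, neg_sq, sub_eq_add_neg] using this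

theorem l2Norm_le_of_abs_le (hg : IsL2 g)
    (h : ∀ᵐ y ∂(volume.restrict (Ioo (0 : ℝ) 1)), |f y| ≤ |g y|) : l2Norm f ≤ l2Norm g := by
  refine Real.sqrt_le_sqrt ?_
  exact integral_mono_of_nonneg (Filter.Eventually.of_forall fun _ => sq_nonneg _)
    hg.integrable_sq (h.mono fun y hy => sq_le_sq.mpr hy)

theorem isL2_id_mul (hf : IsL2 f) : IsL2 (fun y => y * f y) := by
  refine hf.of_le (aestronglyMeasurable_id.mul hf.1) ?_
  refine ae_restrict_of_forall_mem measurableSet_Ioo fun y hy => ?_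
  rw [norm_mul]
  refine mul_le_of_le_one_left (norm_nonneg _) ?_
  rw [Real.norm_eq_abs, abs_le]
  exact ⟨by linarith [hy.1], hy.2.le⟩

theorem l2Norm_id_mul_le (hf : IsL2 f) : l2Norm (fun y => y * f y) ≤ l2Norm f := by
  refine l2Norm_le_of_abs_le hf (ae_restrict_of_forall_mem measurableSet_Ioo fun y hy => ?_)
  rw [abs_mul]
  refine mul_le_of_le_one_left (abs_nonneg _) ?_
  rw [abs_le]
  exact ⟨by linarith [hy.1], hy.2.le⟩

theorem isL2_of_continuousOn (hf : ContinuousOn f (Icc 0 1)) : IsL2 f :=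
  memLp_of_continuousOn_Icc hf

/-- The trace inequality on `(0, 1)`. -/
theorem IsPrimitiveOn.sq_le (h : IsPrimitiveOn 0 1 f g) (hg : IsL2 g) {x : ℝ}
    (hx : x ∈ Icc (0 : ℝ) 1) : f x ^ 2 ≤ l2Norm f ^ 2 + 2 * (l2Norm f * l2Norm g) := by
  have hf : IsL2 f := isL2_of_continuousOn (h.continuousOn zero_le_one)
  have hm := h.mul zero_le_one h
  have hfg : Integrable (fun x => f x * g x) (volume.restrict (Ioo (0 : ℝ) 1)) :=
    hf.integrable_mul hg
  have key : ∀ y ∈ Ioo (0 : ℝ) 1, f x ^ 2 - 2 * (l2Norm f * l2Norm g) ≤ f y ^ 2 := by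
    intro y hy
    have hyI := Ioo_subset_Icc_self hy
    have e1 := hm.2 x hx
    have e2 := hm.2 y hyI
    have hi : ∀ t ∈ Icc (0 : ℝ) 1,
        IntervalIntegrable (fun t => g t * f t + f t * g t) volume 0 t := fun t ht =>
      hm.1.mono_set (by
        rw [uIcc_of_le ht.1, uIcc_of_le zero_le_one]
        exact Icc_subset_Icc_right ht.2)
    have e3 := intervalIntegral.integral_interval_sub_left (hi x hx) (hi y hyI)
    simp only at e1 e2
    have hsub : uIoc y x ⊆ Ioc 0 1 := by
      intro s hs
      rcases mem_uIoc.mp hs with h1 | h1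
      · exact ⟨by linarith [hy.1], h1.2.trans hx.2⟩
      · exact ⟨by linarith [hx.1], h1.2.trans hy.2.le⟩
    have e4 : |∫ t in y..x, (g t * f t + f t * g t)| ≤ 2 * (l2Norm f * l2Norm g) := by
      have h1 : ∀ t, g t * f t + f t * g t = 2 * (f t * g t) := fun t => by ring
      simp only [h1, intervalIntegral.integral_const_mul]
      rw [abs_mul, abs_two]
      refine mul_le_mul_of_nonneg_left ?_ zero_le_two
      refine (intervalIntegral.norm_integral_le_integral_norm_uIoc
        (f := fun t => f t * g t)).trans ?_
      refine le_trans ?_ (integral_abs_mul_le hf hg)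
      rw [← integral_Ioc_eq_integral_Ioo]
      refine setIntegral_mono_set ?_ (Filter.Eventually.of_forall fun t => abs_nonneg _)
        (LE.le.eventuallyLE hsub)
      have : IntegrableOn (fun x => f x * g x) (Ioc 0 1) :=
        by rwa [integrableOn_Ioc_iff_integrableOn_Ioo]
      exact this.abs
    have := (abs_le.mp e4).2
    nlinarith
  have h1 : ∫ _y in Ioo (0 : ℝ) 1, (f x ^ 2 - 2 * (l2Norm f * l2Norm g))
      ≤ ∫ y in Ioo (0 : ℝ) 1, f y ^ 2 :=
    setIntegral_mono_on (integrable_const _) hf.integrable_sq measurableSet_Ioo key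
  rw [← l2Norm_sq f] at h1
  simp at h1
  linarith

/-- The Hölder continuity of functions in `H¹` of an interval. -/
theorem IsPrimitiveOn.sq_sub_le {a b : ℝ} {f g : ℝ → ℝ} (h : IsPrimitiveOn a b f g)
    (hg : MemLp g 2 (volume.restrict (Ioo a b))) {x y : ℝ} (hx : x ∈ Icc a b)
    (hy : y ∈ Icc a b) : (f x - f y) ^ 2 ≤ (b - a) * ∫ t in Ioo a b, g t ^ 2 := by
  wlog hyx : y ≤ x generalizing x y
  · rw [← neg_sub, neg_sq]
    exact this hy hx (le_of_not_ge hyx)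
  have h1 := (h.mono hy.1 hyx hx.2).integral_eq hyx
  rw [intervalIntegral.integral_of_le hyx, integral_Ioc_eq_integral_Ioo] at h1
  rw [← h1]
  have hsub : Ioo y x ⊆ Ioo a b := Ioo_subset_Ioo hy.1 hx.2
  have h2 := sq_integral_le (hg.mono_measure (Measure.restrict_mono_set volume hsub))
  refine h2.trans ?_
  have h3 : (volume.restrict (Ioo y x)).real univ = x - y := by simp [hyx]
  rw [h3]
  refine mul_le_mul (by linarith [hx.2, hy.1]) ?_ (integral_nonneg fun _ => sq_nonneg _)
    (by linarith [hx.2, hy.1])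
  exact setIntegral_mono_set hg.integrable_sq (Filter.Eventually.of_forall fun _ => sq_nonneg _)
    (LE.le.eventuallyLE hsub)

end L2

/-! ### Piecewise affine functions on a mesh -/

theorem sum_integral_adjacent (f : ℝ → ℝ) :
    ∀ (n : ℕ) (a : Fin (n + 1) → ℝ),
      (∀ i : Fin n, IntervalIntegrable f volume (a i.castSucc) (a i.succ)) →
      IntervalIntegrable f volume (a 0) (a (Fin.last n)) ∧
        ∑ i : Fin n, ∫ y in (a i.castSucc)..(a i.succ), f y = ∫ y in (a 0)..(a (Fin.last n)), f y
  | 0, a, _ => by simp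
  | n + 1, a, h => by
    obtain ⟨h1, h2⟩ := sum_integral_adjacent f n (fun i => a i.castSucc) fun i => h i.castSucc
    have h3 := h (Fin.last n)
    refine ⟨h1.trans h3, ?_⟩
    rw [Fin.sum_univ_castSucc, ← Fin.succ_last]
    refine Eq.trans ?_ (intervalIntegral.integral_add_adjacent_intervals h1 h3)
    exact congrArg (· + _) h2

namespace Mesh

variable (M : Mesh)

/-- The length of an element of the mesh. -/
def len (i : Fin M.n) : ℝ := M.node i.succ - M.node i.castSucc

theorem node_lt (i : Fin M.n) : M.node i.castSucc < M.node i.succ :=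
  M.strictMono i.castSucc_lt_succ

theorem len_pos (i : Fin M.n) : 0 < M.len i := sub_pos.mpr (M.node_lt i)

theorem node_mem (j : Fin (M.n + 1)) : M.node j ∈ Icc (0 : ℝ) 1 :=
  ⟨M.node_zero ▸ M.strictMono.monotone (Fin.zero_le j),
    M.node_last ▸ M.strictMono.monotone (Fin.le_last j)⟩

theorem len_le_size (i : Fin M.n) : M.len i ≤ M.size :=
  le_ciSup (f := fun i : Fin M.n => M.node i.succ - M.node i.castSucc)
    (Set.finite_range _).bddAbove i

theorem n_pos : 0 < M.n := by
  rcases Nat.eq_zero_or_pos M.n with h | h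
  · exfalso
    have h1 : Fin.last M.n = 0 := Fin.ext (by simp [h])
    have := M.node_last
    rw [h1, M.node_zero] at this
    exact zero_ne_one this
  · exact h

theorem size_pos : 0 < M.size := (M.len_pos ⟨0, M.n_pos⟩).trans_le (M.len_le_size _)

theorem size_le_one : M.size ≤ 1 := by
  have : Nonempty (Fin M.n) := ⟨⟨0, M.n_pos⟩⟩
  exact ciSup_le fun i => by linarith [(M.node_mem i.succ).2, (M.node_mem i.castSucc).1]

theorem exists_mem_Icc {y : ℝ} (hy : y ∈ Icc (0 : ℝ) 1) :
    ∃ i : Fin M.n, y ∈ Icc (M.node i.castSucc) (M.node i.succ) := by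
  have key : ∀ j : Fin (M.n + 1), y ≤ M.node j →
      (∃ i : Fin M.n, y ∈ Icc (M.node i.castSucc) (M.node i.succ)) ∨ y ≤ M.node 0 := by
    intro j
    induction j using Fin.induction with
    | zero => exact fun h => Or.inr h
    | succ i ih =>
      intro h
      rcases le_total y (M.node i.castSucc) with h1 | h1
      · exact ih h1
      · exact Or.inl ⟨i, h1, h⟩
  rcases key (Fin.last M.n) (by rw [M.node_last]; exact hy.2) with h | h
  · exact h
  · have h0 : (⟨0, M.n_pos⟩ : Fin M.n).castSucc = 0 := rfl
    rw [M.node_zero] at h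
    refine ⟨⟨0, M.n_pos⟩, ?_, ?_⟩
    · rw [h0, M.node_zero]; exact hy.1
    · exact h.trans (M.node_mem _).1

theorem Icc_subset (i : Fin M.n) : Icc (M.node i.castSucc) (M.node i.succ) ⊆ Icc 0 1 :=
  Icc_subset_Icc (M.node_mem _).1 (M.node_mem _).2

theorem Ioo_subset (i : Fin M.n) : Ioo (M.node i.castSucc) (M.node i.succ) ⊆ Ioo 0 1 :=
  Ioo_subset_Ioo (M.node_mem _).1 (M.node_mem _).2

/-- The function that vanishes to the left of an element of the mesh, equals `1` to the right of
it, and is affine on it. -/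
noncomputable def ramp (i : Fin M.n) (y : ℝ) : ℝ :=
  (max (M.node i.castSucc) (min y (M.node i.succ)) - M.node i.castSucc) / M.len i

/-- The Lagrange interpolant of `f` of degree one, written in the basis of ramp functions. -/
noncomputable def interp (f : ℝ → ℝ) (y : ℝ) : ℝ :=
  f 0 + ∑ i : Fin M.n, (f (M.node i.succ) - f (M.node i.castSucc)) * M.ramp i y

/-- The derivative of the Lagrange interpolant of `f`, set to zero at the nodes. -/
noncomputable def slope (f : ℝ → ℝ) (y : ℝ) : ℝ :=
  ∑ i : Fin M.n, (f (M.node i.succ) - f (M.node i.castSucc)) *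
    (Ioo (M.node i.castSucc) (M.node i.succ)).indicator (fun _ => 1 / M.len i) y

/-- The Dirichlet form of the Lagrange interpolants of `f` and `g`. -/
noncomputable def dirichlet (f g : ℝ → ℝ) : ℝ :=
  ∑ i : Fin M.n, (f (M.node i.succ) - f (M.node i.castSucc)) *
    (g (M.node i.succ) - g (M.node i.castSucc)) / M.len i

theorem sum_ite_castSucc_lt {n : ℕ} (F : Fin (n + 1) → ℝ) (j : Fin (n + 1)) :
    ∑ i : Fin n, (if i.castSucc < j then F i.succ - F i.castSucc else 0) = F j - F 0 := by
  induction j using Fin.induction with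
  | zero => simp
  | succ k ih =>
    have h : ∀ i : Fin n, (if i.castSucc < k.succ then F i.succ - F i.castSucc else 0)
        = (if i.castSucc < k.castSucc then F i.succ - F i.castSucc else 0)
          + if i = k then F i.succ - F i.castSucc else 0 := by
      intro i
      rcases lt_trichotomy i k with hik | rfl | hik
      · have h1 : i.castSucc < k.succ := Fin.castSucc_lt_succ_iff.mpr hik.le
        simp [h1, hik, hik.ne]
      · simp
      · have h1 : ¬ i.castSucc < k.succ := by
          rw [Fin.castSucc_lt_succ_iff]; exact not_le.mpr hik
        simp [h1, hik.ne', not_lt.mpr hik.le]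
    simp only [h, Finset.sum_add_distrib, ih, Finset.sum_ite_eq', Finset.mem_univ, if_true]
    ring

variable {M}

theorem interp_eq (f : ℝ → ℝ) {j : Fin M.n} {y : ℝ}
    (hy : y ∈ Icc (M.node j.castSucc) (M.node j.succ)) :
    M.interp f y = f (M.node j.castSucc)
      + (f (M.node j.succ) - f (M.node j.castSucc)) / M.len j * (y - M.node j.castSucc) := by
  have h : ∀ i : Fin M.n, (f (M.node i.succ) - f (M.node i.castSucc)) * M.ramp i y
      = (if i.castSucc < j.castSucc then f (M.node i.succ) - f (M.node i.castSucc) else 0)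
        + if i = j then (f (M.node i.succ) - f (M.node i.castSucc)) / M.len i
            * (y - M.node i.castSucc) else 0 := by
    intro i
    have hl := (M.len_pos i).ne'
    rcases lt_trichotomy i j with hij | rfl | hij
    · have h1 : M.node i.succ ≤ M.node j.castSucc :=
        M.strictMono.monotone (Fin.succ_le_castSucc_iff.mpr hij)
      have h2 : M.ramp i y = 1 := by
        rw [ramp, min_eq_right (h1.trans hy.1), max_eq_right (M.node_lt i).le]
        exact div_self hl
      simp [h2, hij, hij.ne]
    · have h2 : M.ramp i y = (y - M.node i.castSucc) / M.len i := by
        rw [ramp, min_eq_left hy.2, max_eq_right hy.1]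
      simp only [h2, lt_irrefl, if_false, if_true]
      ring
    · have h1 : M.node j.succ ≤ M.node i.castSucc :=
        M.strictMono.monotone (Fin.succ_le_castSucc_iff.mpr hij)
      have h2 : M.ramp i y = 0 := by
        rw [ramp, max_eq_left ((min_le_left _ _).trans (hy.2.trans h1))]
        simp
      simp [h2, hij.ne', not_lt.mpr hij.le]
  rw [interp]
  simp only [h, Finset.sum_add_distrib, Finset.sum_ite_eq', Finset.mem_univ, if_true]
  rw [sum_ite_castSucc_lt (fun i => f (M.node i)), M.node_zero]
  ring

theorem continuous_ramp (i : Fin M.n) : Continuous (M.ramp i) := by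
  unfold ramp; fun_prop

theorem continuous_interp (f : ℝ → ℝ) : Continuous (M.interp f) := by
  unfold interp
  exact continuous_const.add (continuous_finsetSum _ fun i _ =>
    continuous_const.mul (continuous_ramp i))

theorem interp_node (f : ℝ → ℝ) (j : Fin (M.n + 1)) : M.interp f (M.node j) = f (M.node j) := by
  rcases Fin.eq_zero_or_eq_succ j with rfl | ⟨i, rfl⟩
  · have h0 : (⟨0, M.n_pos⟩ : Fin M.n).castSucc = 0 := rfl
    have := interp_eq (M := M) f (j := ⟨0, M.n_pos⟩) (y := M.node 0)
      ⟨by rw [h0], by rw [← h0]; exact (M.node_lt _).le⟩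
    rw [this, h0]; ring
  · rw [interp_eq f (j := i) ⟨(M.node_lt i).le, le_rfl⟩]
    have := (M.len_pos i).ne'
    change _ + _ / M.len i * M.len i = _
    field_simp
    ring

theorem interp_zero (f : ℝ → ℝ) : M.interp f 0 = f 0 := by
  have := interp_node (M := M) f 0
  rwa [M.node_zero] at this

theorem interp_one (f : ℝ → ℝ) : M.interp f 1 = f 1 := by
  have := interp_node (M := M) f (Fin.last M.n)
  rwa [M.node_last] at this

theorem interp_mem_V (f : ℝ → ℝ) : M.interp f ∈ M.V := by
  refine ⟨(continuous_interp f).continuousOn, fun i => ⟨(f (M.node i.succ)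
    - f (M.node i.castSucc)) / M.len i, f (M.node i.castSucc) - (f (M.node i.succ)
    - f (M.node i.castSucc)) / M.len i * M.node i.castSucc, fun y hy => ?_⟩⟩
  rw [interp_eq f hy]; ring

theorem interp_eq_of_mem_V {v : ℝ → ℝ} (hv : v ∈ M.V) : EqOn (M.interp v) v (Icc 0 1) := by
  intro y hy
  obtain ⟨i, hi⟩ := M.exists_mem_Icc hy
  obtain ⟨p, q, hpq⟩ := hv.2 i
  have hl := (M.len_pos i).ne'
  rw [interp_eq v hi, hpq y hi, hpq _ (left_mem_Icc.mpr (M.node_lt i).le),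
    hpq _ (right_mem_Icc.mpr (M.node_lt i).le)]
  have : p * M.node i.succ + q - (p * M.node i.castSucc + q) = p * M.len i := by
    rw [len]; ring
  rw [this, mul_div_assoc, div_self hl]
  ring

theorem sub_mem_V {v w : ℝ → ℝ} (hv : v ∈ M.V) (hw : w ∈ M.V) : (fun y => v y - w y) ∈ M.V := by
  refine ⟨hv.1.sub hw.1, fun i => ?_⟩
  obtain ⟨p, q, h1⟩ := hv.2 i
  obtain ⟨p', q', h2⟩ := hw.2 i
  refine ⟨p - p', q - q', fun y hy => ?_⟩
  simp only [h1 y hy, h2 y hy]; ring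

theorem isPrimitiveOn_ramp (i : Fin M.n) : IsPrimitiveOn 0 1 (M.ramp i)
    ((Ioo (M.node i.castSucc) (M.node i.succ)).indicator fun _ => 1 / M.len i) := by
  refine IsPrimitiveOn.of_hasDerivAt (continuous_ramp i).continuousOn
    (s := {M.node i.castSucc, M.node i.succ}) (Set.toFinite _).countable ?_ ?_
  · rintro y ⟨-, hy⟩
    simp only [mem_insert_iff, mem_singleton_iff, not_or] at hy
    rcases lt_or_gt_of_ne hy.1 with h1 | h1
    · rw [indicator_of_notMem fun h => not_lt.mpr h1.le h.1]
      refine (hasDerivAt_const y 0).congr_of_eventuallyEq ?_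
      filter_upwards [Iio_mem_nhds h1] with z hz
      rw [ramp, max_eq_left ((min_le_left _ _).trans hz.le)]
      simp
    · rcases lt_or_gt_of_ne hy.2 with h2 | h2
      · rw [indicator_of_mem (show y ∈ Ioo _ _ from ⟨h1, h2⟩)]
        refine HasDerivAt.congr_of_eventuallyEq
          (((hasDerivAt_id y).sub_const (M.node i.castSucc)).div_const (M.len i)) ?_
        filter_upwards [Ioo_mem_nhds h1 h2] with z hz
        rw [ramp, min_eq_left hz.2.le, max_eq_right hz.1.le]
        rfl
      · rw [indicator_of_notMem fun h => not_lt.mpr h2.le h.2]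
        refine (hasDerivAt_const y 1).congr_of_eventuallyEq ?_
        filter_upwards [Ioi_mem_nhds h2] with z hz
        rw [ramp, min_eq_right (le_of_lt hz), max_eq_right (M.node_lt i).le]
        exact div_self (M.len_pos i).ne'
  · exact ((integrable_indicator_iff measurableSet_Ioo).mpr
      (integrableOn_const (by simp))).intervalIntegrable

theorem isPrimitiveOn_interp (f : ℝ → ℝ) : IsPrimitiveOn 0 1 (M.interp f) (M.slope f) := by
  have := (IsPrimitiveOn.const (a := 0) (b := 1) (f 0)).add
    (IsPrimitiveOn.sum Finset.univ fun i _ => (isPrimitiveOn_ramp i).const_mul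
      (f (M.node i.succ) - f (M.node i.castSucc)))
  simp only [zero_add] at this
  exact this

theorem isPrimitiveOn_of_mem_V {v : ℝ → ℝ} (hv : v ∈ M.V) : IsPrimitiveOn 0 1 v (M.slope v) :=
  (isPrimitiveOn_interp v).congr zero_le_one (interp_eq_of_mem_V hv) Filter.EventuallyEq.rfl

theorem isL2_slope (f : ℝ → ℝ) : IsL2 (M.slope f) := by
  refine memLp_finsetSum _ fun i _ => MemLp.const_mul ?_ _
  exact (memLp_const _).indicator measurableSet_Ioo

theorem memW1_of_mem_V {v : ℝ → ℝ} (hv : v ∈ M.V) : MemW1 2 (Ioo 0 1) v :=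
  (isPrimitiveOn_of_mem_V hv).memW1 zero_le_one (isL2_slope v)

/-- The derivative of the interpolant only sees the nodal values of a primitive of the function
it is integrated against. -/
theorem integral_mul_slope {G g : ℝ → ℝ} (h : IsPrimitiveOn 0 1 G g) (f : ℝ → ℝ) :
    ∫ y in Ioo (0 : ℝ) 1, g y * M.slope f y = M.dirichlet G f := by
  have hi : ∀ i : Fin M.n, IntegrableOn
      ((Ioo (M.node i.castSucc) (M.node i.succ)).indicator g) (Ioo 0 1) := fun i =>
    (h.integrableOn zero_le_one).indicator measurableSet_Ioo
  have e : ∀ y, g y * M.slope f y = ∑ i : Fin M.n,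
      (f (M.node i.succ) - f (M.node i.castSucc)) / M.len i *
        (Ioo (M.node i.castSucc) (M.node i.succ)).indicator g y := by
    intro y
    rw [slope, Finset.mul_sum]
    refine Finset.sum_congr rfl fun i _ => ?_
    by_cases hy : y ∈ Ioo (M.node i.castSucc) (M.node i.succ)
    · rw [indicator_of_mem hy, indicator_of_mem hy]; ring
    · rw [indicator_of_notMem hy, indicator_of_notMem hy]; ring
  simp only [e]
  rw [integral_finsetSum _ fun i _ => (hi i).const_mul _]
  refine Finset.sum_congr rfl fun i _ => ?_
  rw [integral_const_mul, setIntegral_indicator measurableSet_Ioo,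
    inter_eq_self_of_subset_right (M.Ioo_subset i)]
  have h1 := (h.mono (M.node_mem i.castSucc).1 (M.node_lt i).le (M.node_mem i.succ).2).integral_eq
    (M.node_lt i).le
  rw [intervalIntegral.integral_of_le (M.node_lt i).le, integral_Ioc_eq_integral_Ioo] at h1
  rw [h1]; ring

theorem dirichlet_congr {f f' g g' : ℝ → ℝ} (hf : ∀ j, f (M.node j) = f' (M.node j))
    (hg : ∀ j, g (M.node j) = g' (M.node j)) : M.dirichlet f g = M.dirichlet f' g' := by
  simp only [dirichlet, hf, hg]

theorem slope_congr {f f' : ℝ → ℝ} (hf : ∀ j, f (M.node j) = f' (M.node j)) :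
    M.slope f = M.slope f' := by
  funext y; simp only [slope, hf]

theorem slope_sub (f g : ℝ → ℝ) :
    M.slope (fun y => f y - g y) = fun y => M.slope f y - M.slope g y := by
  funext y
  simp only [slope, ← Finset.sum_sub_distrib]
  exact Finset.sum_congr rfl fun i _ => by ring

theorem interp_congr {f f' : ℝ → ℝ} (hf : ∀ j, f (M.node j) = f' (M.node j)) :
    M.interp f = M.interp f' := by
  have h0 : f 0 = f' 0 := by simpa [M.node_zero] using hf 0
  funext y; simp only [interp, hf, h0]

theorem integral_slope_mul_slope (f g : ℝ → ℝ) :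
    ∫ y in Ioo (0 : ℝ) 1, M.slope f y * M.slope g y = M.dirichlet f g := by
  rw [integral_mul_slope (isPrimitiveOn_interp f)]
  exact dirichlet_congr (interp_node f) fun _ => rfl

theorem l2Norm_slope_sq (f : ℝ → ℝ) : l2Norm (M.slope f) ^ 2 = M.dirichlet f f := by
  rw [l2Norm_sq, ← integral_slope_mul_slope]
  simp only [sq]

theorem dirichlet_self_nonneg (f : ℝ → ℝ) : 0 ≤ M.dirichlet f f := by
  rw [← l2Norm_slope_sq]; positivity

/-- Interpolation is stable in the `H¹` seminorm. -/
theorem l2Norm_slope_le {f g : ℝ → ℝ} (h : IsPrimitiveOn 0 1 f g) (hg : IsL2 g) :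
    l2Norm (M.slope f) ≤ l2Norm g := by
  have h1 := (le_abs_self _).trans (abs_integral_mul_le hg (isL2_slope (M := M) f))
  rw [integral_mul_slope h, ← l2Norm_slope_sq, sq] at h1
  rcases (l2Norm_nonneg (M.slope f)).eq_or_lt with h0 | h0
  · rw [← h0]; exact l2Norm_nonneg g
  · exact le_of_mul_le_mul_right h1 h0

theorem slope_eq (f : ℝ → ℝ) {j : Fin M.n} {y : ℝ}
    (hy : y ∈ Ioo (M.node j.castSucc) (M.node j.succ)) :
    M.slope f y = (f (M.node j.succ) - f (M.node j.castSucc)) / M.len j := by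
  rw [slope, Finset.sum_eq_single j]
  · rw [indicator_of_mem hy]; ring
  · intro i _ hij
    rw [indicator_of_notMem, mul_zero]
    intro hy'
    rcases lt_or_gt_of_ne hij with h | h
    · have h1 : M.node i.succ ≤ M.node j.castSucc :=
        M.strictMono.monotone (Fin.succ_le_castSucc_iff.mpr h)
      linarith [hy'.2, hy.1]
    · have h1 : M.node j.succ ≤ M.node i.castSucc :=
        M.strictMono.monotone (Fin.succ_le_castSucc_iff.mpr h)
      linarith [hy'.1, hy.2]
  · simp

/-- An elementwise Poincaré inequality: if on each element `F` is the difference of `G` and one of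
its values there, then `‖F‖ ≤ k ‖G'‖`. -/
theorem l2Norm_le_size_mul {F G g : ℝ → ℝ} (hG : IsPrimitiveOn 0 1 G g) (hg : IsL2 g)
    (hF2 : IsL2 F)
    (hF : ∀ i : Fin M.n, ∃ z ∈ Icc (M.node i.castSucc) (M.node i.succ),
      ∀ y ∈ Ioo (M.node i.castSucc) (M.node i.succ), F y = G y - G z) :
    l2Norm F ≤ M.size * l2Norm g := by
  refine le_of_sq_le_sq ?_ (mul_nonneg M.size_pos.le (l2Norm_nonneg g))
  rw [mul_pow, l2Norm_sq, l2Norm_sq]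
  have split : ∀ f : ℝ → ℝ, IntegrableOn f (Ioo 0 1) → ∫ y in Ioo (0 : ℝ) 1, f y
      = ∑ i : Fin M.n, ∫ y in Ioo (M.node i.castSucc) (M.node i.succ), f y := by
    intro f hf
    have h1 := (sum_integral_adjacent f M.n M.node fun i =>
      (intervalIntegrable_iff_integrableOn_Ioo_of_le (M.node_lt i).le).mpr
        (hf.mono_set (M.Ioo_subset i))).2
    rw [M.node_zero, M.node_last, intervalIntegral.integral_of_le zero_le_one,
      integral_Ioc_eq_integral_Ioo] at h1
    rw [← h1]
    refine Finset.sum_congr rfl fun i _ => ?_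
    rw [intervalIntegral.integral_of_le (M.node_lt i).le, integral_Ioc_eq_integral_Ioo]
  rw [split _ hF2.integrable_sq, split _ hg.integrable_sq, Finset.mul_sum]
  refine Finset.sum_le_sum fun i _ => ?_
  obtain ⟨z, hz, hFz⟩ := hF i
  have hGi := hG.mono (M.node_mem i.castSucc).1 (M.node_lt i).le (M.node_mem i.succ).2
  have hgi : MemLp g 2 (volume.restrict (Ioo (M.node i.castSucc) (M.node i.succ))) :=
    hg.mono_measure (Measure.restrict_mono_set volume (M.Ioo_subset i))
  set I := ∫ y in Ioo (M.node i.castSucc) (M.node i.succ), g y ^ 2 with hI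
  have hI0 : 0 ≤ I := integral_nonneg fun _ => sq_nonneg _
  have h2 : ∫ y in Ioo (M.node i.castSucc) (M.node i.succ), F y ^ 2
      ≤ ∫ _y in Ioo (M.node i.castSucc) (M.node i.succ), M.len i * I := by
    refine setIntegral_mono_on (hF2.integrable_sq.mono_measure
      (Measure.restrict_mono_set volume (M.Ioo_subset i))) (integrable_const _)
      measurableSet_Ioo fun y hy => ?_
    rw [hFz y hy]
    exact hGi.sq_sub_le hgi (Ioo_subset_Icc_self hy) hz
  refine h2.trans ?_
  have h3 : (volume.restrict (Ioo (M.node i.castSucc) (M.node i.succ))).real univ = M.len i := by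
    simp [(M.node_lt i).le, len]
  rw [integral_const, h3, smul_eq_mul, ← mul_assoc, sq]
  have h4 := M.len_le_size i
  have h5 := M.len_pos i
  have h6 := M.size_pos
  gcongr

/-- The interpolation error in the `H¹` seminorm, where `p` and `q` are the first and second
derivative of `f`. -/
theorem l2Norm_sub_slope_le {f p q : ℝ → ℝ} (hf : IsPrimitiveOn 0 1 f p)
    (hp : IsPrimitiveOn 0 1 p q) (hq : IsL2 q) :
    l2Norm (fun y => p y - M.slope f y) ≤ M.size * l2Norm q := by
  have hpc := hp.continuousOn zero_le_one
  refine l2Norm_le_size_mul hp hq ((isL2_of_continuousOn hpc).sub (isL2_slope f)) fun i => ?_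
  have hsub := M.Icc_subset i
  have hd : ∀ y ∈ Ioo (M.node i.castSucc) (M.node i.succ), HasDerivAt f (p y) y :=
    fun y hy => hf.hasDerivAt hpc (M.Ioo_subset i hy)
  -- by the mean value theorem the slope of the interpolant is a value of `p` on the element
  obtain ⟨z, hz, hz'⟩ := exists_hasDerivAt_eq_slope f p (M.node_lt i)
    ((hf.continuousOn zero_le_one).mono hsub) hd
  refine ⟨z, Ioo_subset_Icc_self hz, fun y hy => ?_⟩
  rw [slope_eq f hy, hz', len]

/-- The interpolation error in `L²` in terms of the error in the `H¹` seminorm. -/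
theorem l2Norm_sub_interp_le {f p : ℝ → ℝ} (hf : IsPrimitiveOn 0 1 f p) (hp : IsL2 p) :
    l2Norm (fun y => f y - M.interp f y)
      ≤ M.size * l2Norm (fun y => p y - M.slope f y) := by
  have h := hf.sub (isPrimitiveOn_interp (M := M) f)
  refine l2Norm_le_size_mul h (hp.sub (isL2_slope f))
    (isL2_of_continuousOn (h.continuousOn zero_le_one)) fun i => ?_
  refine ⟨M.node i.castSucc, left_mem_Icc.mpr (M.node_lt i).le, fun y _ => ?_⟩
  rw [interp_node]; ring

end Mesh

/-! ### Functions of time and space -/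

theorem volume_restrict_cyl (T : ℝ) : (volume : Measure (ℝ × ℝ)).restrict (cyl T)
    = (volume.restrict (Ioo 0 T)).prod (volume.restrict (Ioo (0 : ℝ) 1)) := by
  rw [cyl, Measure.volume_eq_prod, Measure.prod_restrict]

theorem isOpen_cyl (T : ℝ) : IsOpen (cyl T) := isOpen_Ioo.prod isOpen_Ioo

section Cylinder

variable {T : ℝ}

theorem setIntegral_cyl {f : ℝ × ℝ → ℝ} (hf : IntegrableOn f (cyl T)) :
    ∫ z in cyl T, f z = ∫ τ in Ioo 0 T, ∫ y in Ioo (0 : ℝ) 1, f (τ, y) := by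
  rw [IntegrableOn, volume_restrict_cyl] at hf
  rw [volume_restrict_cyl, integral_prod _ hf]

theorem setIntegral_cyl_symm {f : ℝ × ℝ → ℝ} (hf : IntegrableOn f (cyl T)) :
    ∫ z in cyl T, f z = ∫ y in Ioo (0 : ℝ) 1, ∫ τ in Ioo 0 T, f (τ, y) := by
  rw [IntegrableOn, volume_restrict_cyl] at hf
  rw [volume_restrict_cyl, integral_prod_symm _ hf]

theorem IntegrableOn.integral_cyl {f : ℝ × ℝ → ℝ} (hf : IntegrableOn f (cyl T)) :
    IntegrableOn (fun τ => ∫ y in Ioo (0 : ℝ) 1, f (τ, y)) (Ioo 0 T) := by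
  rw [IntegrableOn, volume_restrict_cyl] at hf
  exact hf.integral_prod_left

theorem IntegrableOn.integral_cyl_symm {f : ℝ × ℝ → ℝ} (hf : IntegrableOn f (cyl T)) :
    IntegrableOn (fun y => ∫ τ in Ioo 0 T, f (τ, y)) (Ioo 0 1) := by
  rw [IntegrableOn, volume_restrict_cyl] at hf
  exact hf.integral_prod_right

theorem cyl_mono {t : ℝ} (ht : t ≤ T) : cyl t ⊆ cyl T :=
  prod_mono (Ioo_subset_Ioo_right ht) Subset.rfl

theorem ContinuousOn.bound_cyl {e : ℝ → ℝ → ℝ}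
    (he : ContinuousOn (Function.uncurry e) (Icc 0 T ×ˢ Icc 0 1)) :
    ∃ C, ∀ τ ∈ Icc 0 T, ∀ y ∈ Icc (0 : ℝ) 1, |e τ y| ≤ C := by
  obtain ⟨C, hC⟩ := (isCompact_Icc.prod isCompact_Icc).exists_bound_of_continuousOn he
  exact ⟨C, fun τ hτ y hy => hC (τ, y) ⟨hτ, hy⟩⟩

theorem cyl_subset (T : ℝ) : cyl T ⊆ Icc 0 T ×ˢ Icc 0 1 :=
  prod_mono Ioo_subset_Icc_self Ioo_subset_Icc_self

theorem IntegrableOn.mul_continuousOn_cyl {f e : ℝ × ℝ → ℝ} (hf : IntegrableOn f (cyl T))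
    (he : ContinuousOn e (Icc 0 T ×ˢ Icc 0 1)) : IntegrableOn (fun z => f z * e z) (cyl T) := by
  obtain ⟨C, hC⟩ := (isCompact_Icc.prod isCompact_Icc).exists_bound_of_continuousOn he
  refine Integrable.mul_bdd (c := C) hf
    ((he.mono (cyl_subset T)).aestronglyMeasurable (isOpen_cyl T).measurableSet) ?_
  exact ae_restrict_of_forall_mem (isOpen_cyl T).measurableSet fun z hz => hC z (cyl_subset T hz)

theorem ContinuousOn.integrableOn_cyl {e : ℝ × ℝ → ℝ}
    (he : ContinuousOn e (Icc 0 T ×ˢ Icc 0 1)) : IntegrableOn e (cyl T) :=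
  (he.integrableOn_compact (isCompact_Icc.prod isCompact_Icc)).mono_set (cyl_subset T)

theorem ContinuousOn.slice {e : ℝ → ℝ → ℝ}
    (he : ContinuousOn (Function.uncurry e) (Icc 0 T ×ˢ Icc 0 1)) {τ : ℝ} (hτ : τ ∈ Icc 0 T) :
    ContinuousOn (e τ) (Icc 0 1) :=
  he.comp (f := fun y => (τ, y)) (by fun_prop) fun _ hy => ⟨hτ, hy⟩

theorem ContinuousOn.slice_time {e : ℝ → ℝ → ℝ}
    (he : ContinuousOn (Function.uncurry e) (Icc 0 T ×ˢ Icc 0 1)) {y : ℝ}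
    (hy : y ∈ Icc (0 : ℝ) 1) : ContinuousOn (fun τ => e τ y) (Icc 0 T) :=
  he.comp (f := fun τ => (τ, y)) (by fun_prop) fun _ hτ => ⟨hτ, hy⟩

/-- Integration in space commutes with taking primitives in time. -/
theorem isPrimitiveOn_integral {f g : ℝ → ℝ → ℝ} (hT : 0 ≤ T)
    (h : ∀ᵐ y ∂(volume.restrict (Ioo (0 : ℝ) 1)),
      IsPrimitiveOn 0 T (fun τ => f τ y) (fun τ => g τ y))
    (hf : ∀ t ∈ Icc 0 T, IntegrableOn (f t) (Ioo 0 1))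
    (hg : IntegrableOn (Function.uncurry g) (cyl T)) :
    IsPrimitiveOn 0 T (fun τ => ∫ y in Ioo (0 : ℝ) 1, f τ y)
      (fun τ => ∫ y in Ioo (0 : ℝ) 1, g τ y) := by
  have h0 : (0 : ℝ) ∈ Icc 0 T := left_mem_Icc.mpr hT
  refine ⟨(intervalIntegrable_iff_integrableOn_Ioo_of_le hT).mpr (IntegrableOn.integral_cyl hg),
    fun t ht => ?_⟩
  have hgt : IntegrableOn (Function.uncurry g) (cyl t) := hg.mono_set (cyl_mono ht.2)
  rw [intervalIntegral.integral_of_le ht.1, integral_Ioc_eq_integral_Ioo]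
  have e := (setIntegral_cyl hgt).symm.trans (setIntegral_cyl_symm hgt)
  simp only [Function.uncurry_apply_pair] at e
  have hi := IntegrableOn.integral_cyl_symm hgt
  simp only [Function.uncurry_apply_pair] at hi
  rw [e, ← integral_add (hf 0 h0) hi]
  refine integral_congr_ae ?_
  filter_upwards [h] with y hy
  have := hy.2 t ht
  rwa [intervalIntegral.integral_of_le ht.1, integral_Ioc_eq_integral_Ioo] at this

/-- The derivative of the squared norm of `L²(0, 1)` along a function of time. -/
theorem isPrimitiveOn_l2Norm_sq {e w : ℝ → ℝ → ℝ} (hT : 0 ≤ T)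
    (h : ∀ᵐ y ∂(volume.restrict (Ioo (0 : ℝ) 1)),
      IsPrimitiveOn 0 T (fun τ => e τ y) (fun τ => w τ y))
    (he : ContinuousOn (Function.uncurry e) (Icc 0 T ×ˢ Icc 0 1))
    (hw : IntegrableOn (Function.uncurry w) (cyl T)) :
    IsPrimitiveOn 0 T (fun τ => l2Norm (e τ) ^ 2)
      (fun τ => 2 * ∫ y in Ioo (0 : ℝ) 1, w τ y * e τ y) := by
  have h1 : ∀ᵐ y ∂(volume.restrict (Ioo (0 : ℝ) 1)),
      IsPrimitiveOn 0 T (fun τ => e τ y ^ 2) (fun τ => 2 * (w τ y * e τ y)) := by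
    filter_upwards [h] with y hy
    refine (hy.mul hT hy).congr hT (fun τ _ => (sq (e τ y)).symm) ?_
    exact Filter.Eventually.of_forall fun τ => by ring
  have h2 := isPrimitiveOn_integral hT h1
    (fun t ht => (isL2_of_continuousOn (ContinuousOn.slice he ht)).integrable_sq)
    ((IntegrableOn.mul_continuousOn_cyl hw he).const_mul 2)
  simpa only [l2Norm_sq, integral_const_mul] using h2

/-- Primitives in time have weak time derivatives. -/
theorem hasWeakDeriv_cyl {f g : ℝ → ℝ → ℝ} (hT : 0 ≤ T)
    (h : ∀ᵐ y ∂(volume.restrict (Ioo (0 : ℝ) 1)),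
      IsPrimitiveOn 0 T (fun τ => f τ y) (fun τ => g τ y))
    (hf : ContinuousOn (Function.uncurry f) (Icc 0 T ×ˢ Icc 0 1))
    (hg : IntegrableOn (Function.uncurry g) (cyl T)) :
    HasWeakDeriv (cyl T) (1, 0) (Function.uncurry f) (Function.uncurry g) := by
  have hfi := ContinuousOn.integrableOn_cyl hf
  refine ⟨hfi.locallyIntegrableOn, hg.locallyIntegrableOn, fun φ hφ hφc hφs => ?_⟩
  have hφd : Continuous fun z => fderiv ℝ φ z (1, 0) :=
    (hφ.continuous_fderiv (by simp)).clm_apply continuous_const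
  rw [setIntegral_cyl_symm (IntegrableOn.mul_continuousOn_cyl hfi hφd.continuousOn),
    setIntegral_cyl_symm (IntegrableOn.mul_continuousOn_cyl hg hφ.continuous.continuousOn),
    ← integral_neg]
  refine integral_congr_ae ?_
  filter_upwards [h] with y hy
  have hc : Continuous fun τ : ℝ => (τ, y) := by fun_prop
  have hsupp : tsupport (fun τ => φ (τ, y)) ⊆ (fun τ => (τ, y)) ⁻¹' tsupport φ :=
    closure_minimal (fun τ hτ => subset_tsupport φ hτ) ((isClosed_tsupport φ).preimage hc)
  have hcs : HasCompactSupport fun τ => φ (τ, y) := by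
    refine HasCompactSupport.intro (hφc.isCompact.image continuous_fst) fun τ hτ => ?_
    exact image_eq_zero_of_notMem_tsupport fun hm => hτ ⟨(τ, y), hm, rfl⟩
  have := (hy.hasWeakDeriv hT).2.2 (fun τ => φ (τ, y)) (hφ.comp (by fun_prop)) hcs
    fun τ hτ => (hφs (hsupp hτ)).1
  have hder : ∀ τ, fderiv ℝ (fun τ => φ (τ, y)) τ 1 = fderiv ℝ φ (τ, y) (1, 0) := by
    intro τ
    have h1 : HasDerivAt (fun τ : ℝ => (τ, y)) (1, 0) τ :=
      (hasDerivAt_id τ).prodMk (hasDerivAt_const τ y)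
    rw [fderiv_apply_one_eq_deriv]
    exact ((hφ.differentiable (by simp) (τ, y)).hasFDerivAt.comp_hasDerivAt τ h1).deriv
  simp only [hder] at this
  simpa only [Function.uncurry_apply_pair] using this

/-- Pairing a function on the cylinder with a test function in space gives a function of time
whose derivative is the pairing of the weak time derivative. -/
theorem HasWeakDeriv.isPrimitiveOn_pairing {u w : ℝ → ℝ → ℝ} (hT : 0 < T)
    (hu : ContinuousOn (Function.uncurry u) (Icc 0 T ×ˢ Icc 0 1))
    (h : HasWeakDeriv (cyl T) (1, 0) (Function.uncurry u) (Function.uncurry w))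
    (hw : IntegrableOn (Function.uncurry w) (cyl T)) {β : ℝ → ℝ} (hβ : ContDiff ℝ ∞ β)
    (hβc : HasCompactSupport β) (hβs : tsupport β ⊆ Ioo 0 1) :
    IsPrimitiveOn 0 T (fun τ => ∫ y in Ioo (0 : ℝ) 1, u τ y * β y)
      (fun τ => ∫ y in Ioo (0 : ℝ) 1, w τ y * β y) := by
  have hβ2 : ContinuousOn (fun z : ℝ × ℝ => β z.2) (Icc 0 T ×ˢ Icc 0 1) :=
    (hβ.continuous.comp continuous_snd).continuousOn
  have hui := ContinuousOn.integrableOn_cyl hu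
  have huβ := IntegrableOn.mul_continuousOn_cyl hui hβ2
  have hwβ := IntegrableOn.mul_continuousOn_cyl hw hβ2
  have hf := IntegrableOn.integral_cyl huβ
  have hg := IntegrableOn.integral_cyl hwβ
  simp only [Function.uncurry_apply_pair] at hf hg
  refine HasWeakDeriv.isPrimitiveOn hT ⟨hf.locallyIntegrableOn, hg.locallyIntegrableOn,
    fun α hα hαc hαs => ?_⟩ ?_ hg
  · have hprod : ContDiff ℝ ∞ fun z : ℝ × ℝ => α z.1 * β z.2 :=
      (hα.comp contDiff_fst).mul (hβ.comp contDiff_snd)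
    have hzero : ∀ z : ℝ × ℝ, z ∉ tsupport α ×ˢ tsupport β → α z.1 * β z.2 = 0 := by
      intro z hz
      by_contra hne
      exact hz ⟨subset_tsupport α (left_ne_zero_of_mul hne),
        subset_tsupport β (right_ne_zero_of_mul hne)⟩
    have hder : ∀ z : ℝ × ℝ,
        fderiv ℝ (fun z : ℝ × ℝ => α z.1 * β z.2) z (1, 0) = fderiv ℝ α z.1 1 * β z.2 := by
      rintro ⟨τ, y⟩
      have h1 : HasDerivAt (fun τ : ℝ => (τ, y)) (1, 0) τ :=
        (hasDerivAt_id τ).prodMk (hasDerivAt_const τ y)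
      have h2 := ((hprod.differentiable (by simp) (τ, y)).hasFDerivAt.comp_hasDerivAt τ h1)
      have h3 : HasDerivAt (fun τ => α τ * β y) (deriv α τ * β y) τ :=
        ((hα.differentiable (by simp) τ).hasDerivAt).mul_const _
      rw [fderiv_apply_one_eq_deriv]
      exact h2.unique h3
    have key := h.2.2 (fun z => α z.1 * β z.2) hprod
      (HasCompactSupport.intro (hαc.isCompact.prod hβc.isCompact) hzero)
      ((closure_minimal (fun z hz => by
        by_contra hcon
        exact hz (hzero z hcon)) ((isClosed_tsupport α).prod (isClosed_tsupport β))).trans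
        (prod_mono hαs hβs))
    simp only [hder] at key
    have hαd : Continuous fun τ => fderiv ℝ α τ 1 := by
      simp only [fderiv_apply_one_eq_deriv]; exact hα.continuous_deriv (by simp)
    rw [setIntegral_cyl, setIntegral_cyl] at key
    · simp only [Function.uncurry_apply_pair] at key
      simp only [← integral_mul_const]
      refine Eq.trans ?_ (key.trans ?_)
      · congr 1; funext τ; congr 1; funext y; ring
      · congr 2; funext τ; congr 1; funext y; ring
    · exact IntegrableOn.mul_continuousOn_cyl hw hprod.continuous.continuousOn
    · exact IntegrableOn.mul_continuousOn_cyl hui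
        ((hαd.comp continuous_fst).mul (hβ.continuous.comp continuous_snd)).continuousOn
  · obtain ⟨C, hC⟩ := ContinuousOn.bound_cyl hu
    refine continuousOn_of_dominated (bound := fun y => C * |β y|) ?_ ?_ ?_ ?_
    · intro τ hτ
      exact (((ContinuousOn.slice hu hτ).mono Ioo_subset_Icc_self).mul
        hβ.continuous.continuousOn).aestronglyMeasurable measurableSet_Ioo
    · intro τ hτ
      refine ae_restrict_of_forall_mem measurableSet_Ioo fun y hy => ?_
      rw [Real.norm_eq_abs, abs_mul]
      exact mul_le_mul_of_nonneg_right (hC τ hτ y (Ioo_subset_Icc_self hy)) (abs_nonneg _)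
    · exact ((hβ.continuous.integrable_of_hasCompactSupport hβc).abs.const_mul C).integrableOn
    · refine ae_restrict_of_forall_mem measurableSet_Ioo fun y hy => ?_
      exact (ContinuousOn.slice_time hu (Ioo_subset_Icc_self hy)).mul continuousOn_const

/-- A continuous function on the cylinder is, for almost every `y`, a primitive in time of its weak
time derivative. -/
theorem HasWeakDeriv.ae_isPrimitiveOn {u w : ℝ → ℝ → ℝ} (hT : 0 < T)
    (hu : ContinuousOn (Function.uncurry u) (Icc 0 T ×ˢ Icc 0 1))
    (h : HasWeakDeriv (cyl T) (1, 0) (Function.uncurry u) (Function.uncurry w))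
    (hw : IntegrableOn (Function.uncurry w) (cyl T)) :
    ∀ᵐ y ∂(volume.restrict (Ioo (0 : ℝ) 1)),
      IsPrimitiveOn 0 T (fun τ => u τ y) (fun τ => w τ y) := by
  have h0 : (0 : ℝ) ∈ Icc 0 T := left_mem_Icc.mpr hT.le
  -- at each time the identity holds for almost every `y`
  have step : ∀ t ∈ Icc 0 T, ∀ᵐ y ∂(volume.restrict (Ioo (0 : ℝ) 1)),
      u t y = u 0 y + ∫ s in (0 : ℝ)..t, w s y := by
    intro t ht
    have hwt : IntegrableOn (Function.uncurry w) (cyl t) := hw.mono_set (cyl_mono ht.2)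
    have hW := IntegrableOn.integral_cyl_symm hwt
    simp only [Function.uncurry_apply_pair] at hW
    have hut := (isL2_of_continuousOn (ContinuousOn.slice hu ht)).integrable (by norm_num)
    have hu0 := (isL2_of_continuousOn (ContinuousOn.slice hu h0)).integrable (by norm_num)
    have key := isOpen_Ioo.ae_eq_zero_of_integral_contDiff_smul_eq_zero (U := Ioo (0 : ℝ) 1)
      (f := fun y => u t y - u 0 y - ∫ s in Ioo 0 t, w s y) (μ := volume)
      (IntegrableOn.locallyIntegrableOn ((hut.sub hu0).sub hW)) (fun β hβ hβc hβs => by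
        have e := (h.isPrimitiveOn_pairing hT hu hw hβ hβc hβs).2 t ht
        have hβ2 : ContinuousOn (fun z : ℝ × ℝ => β z.2) (Icc 0 t ×ˢ Icc 0 1) :=
          (hβ.continuous.comp continuous_snd).continuousOn
        have hwβ := IntegrableOn.mul_continuousOn_cyl hwt hβ2
        have e2 := (setIntegral_cyl hwβ).symm.trans (setIntegral_cyl_symm hwβ)
        simp only [Function.uncurry_apply_pair, integral_mul_const] at e2
        simp only [intervalIntegral.integral_of_le ht.1, integral_Ioc_eq_integral_Ioo] at e
        rw [e2] at e
        have hi : ∀ f : ℝ → ℝ, IntegrableOn f (Ioo 0 1) →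
            IntegrableOn (fun y => f y * β y) (Ioo 0 1) := fun f hf =>
          integrableOn_mul_of_tsupport_subset hf.locallyIntegrableOn hβ.continuous hβc hβs
        rw [setIntegral_smul_eq_of_tsupport_subset hβs]
        simp only [sub_mul]
        have hi2 : IntegrableOn (fun y => u t y * β y - u 0 y * β y) (Ioo 0 1) :=
          (hi _ hut).sub (hi _ hu0)
        rw [integral_sub hi2 (hi _ hW),
          integral_sub (hi _ hut) (hi _ hu0), e]
        ring)
    rw [ae_restrict_iff' measurableSet_Ioo]
    filter_upwards [key] with y hy hyI
    rw [intervalIntegral.integral_of_le ht.1, integral_Ioc_eq_integral_Ioo]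
    linarith [hy hyI]
  -- almost every `y` serves a countable dense set of times, hence all times by continuity
  have : Nonempty (Icc 0 T) := ⟨⟨0, h0⟩⟩
  have hd := TopologicalSpace.denseRange_denseSeq (Icc 0 T)
  have hall : ∀ᵐ y ∂(volume.restrict (Ioo (0 : ℝ) 1)), ∀ n : ℕ,
      u (TopologicalSpace.denseSeq (Icc 0 T) n) y = u 0 y
        + ∫ s in (0 : ℝ)..(TopologicalSpace.denseSeq (Icc 0 T) n), w s y :=
    ae_all_iff.mpr fun n => step _ (TopologicalSpace.denseSeq (Icc 0 T) n).2
  have hint : ∀ᵐ y ∂(volume.restrict (Ioo (0 : ℝ) 1)),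
      IntegrableOn (fun τ => w τ y) (Ioo 0 T) := by
    rw [IntegrableOn, volume_restrict_cyl] at hw
    exact hw.prod_left_ae
  filter_upwards [hall, hint, ae_restrict_mem measurableSet_Ioo] with y hy hyi hyI
  have hii : IntervalIntegrable (fun τ => w τ y) volume 0 T :=
    (intervalIntegrable_iff_integrableOn_Ioo_of_le hT.le).mpr hyi
  have hP : IsPrimitiveOn 0 T (fun t => u 0 y + ∫ s in (0 : ℝ)..t, w s y) (fun τ => w τ y) :=
    ⟨hii, fun t _ => by simp⟩
  have hc1 := ContinuousOn.slice_time hu (Ioo_subset_Icc_self hyI)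
  have hc2 := hP.continuousOn hT.le
  rw [continuousOn_iff_continuous_domRestrict] at hc1 hc2
  have heq := hd.equalizer hc1 hc2 (funext fun n => hy n)
  refine ⟨hii, fun t ht => ?_⟩
  exact congrFun heq ⟨t, ht⟩

end Cylinder

/-! ### The semi-discrete solution as a function of time -/

namespace Mesh

variable {M : Mesh}

theorem isPrimitiveOn_interp_time {T : ℝ} {v w : ℝ → ℝ → ℝ}
    (h : ∀ z ∈ Icc (0 : ℝ) 1, IsPrimitiveOn 0 T (fun τ => v τ z) (fun τ => w τ z)) (y : ℝ) :
    IsPrimitiveOn 0 T (fun τ => M.interp (v τ) y) (fun τ => M.interp (w τ) y) := by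
  refine (h 0 (left_mem_Icc.mpr zero_le_one)).add (IsPrimitiveOn.sum _ fun i _ => ?_)
  have := ((h _ (M.node_mem i.succ)).sub (h _ (M.node_mem i.castSucc))).const_mul (M.ramp i y)
  simpa only [mul_comm (M.ramp i y)] using this

theorem isPrimitiveOn_dirichlet {T : ℝ} (hT : 0 ≤ T) {v w : ℝ → ℝ → ℝ}
    (h : ∀ z ∈ Icc (0 : ℝ) 1, IsPrimitiveOn 0 T (fun τ => v τ z) (fun τ => w τ z)) :
    IsPrimitiveOn 0 T (fun τ => M.dirichlet (v τ) (v τ))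
      (fun τ => 2 * M.dirichlet (v τ) (w τ)) := by
  have h1 : ∀ i : Fin M.n, i ∈ Finset.univ → IsPrimitiveOn 0 T
      (fun τ => (M.len i)⁻¹ * ((v τ (M.node i.succ) - v τ (M.node i.castSucc))
        * (v τ (M.node i.succ) - v τ (M.node i.castSucc)))) _ := fun i _ =>
    have h2 := (h _ (M.node_mem i.succ)).sub (h _ (M.node_mem i.castSucc))
    (h2.mul hT h2).const_mul (M.len i)⁻¹
  have h3 := IsPrimitiveOn.sum Finset.univ h1
  refine h3.congr hT (fun τ _ => ?_) (Filter.Eventually.of_forall fun τ => ?_)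
  · refine Finset.sum_congr rfl fun i _ => ?_
    rw [div_eq_inv_mul]
  · simp only [dirichlet, Finset.mul_sum]
    refine Finset.sum_congr rfl fun i _ => ?_
    ring

theorem continuousOn_dirichlet {s : Set ℝ} {e : ℝ → ℝ → ℝ}
    (h : ∀ y ∈ Icc (0 : ℝ) 1, ContinuousOn (fun τ => e τ y) s) :
    ContinuousOn (fun τ => M.dirichlet (e τ) (e τ)) s := by
  refine continuousOn_finsetSum _ fun i _ => ?_
  have h1 := (h _ (M.node_mem i.succ)).sub (h _ (M.node_mem i.castSucc))
  exact (h1.mul h1).div_const _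

theorem ramp_mem (i : Fin M.n) (y : ℝ) : |M.ramp i y| ≤ 1 := by
  have hl := M.len_pos i
  have h1 : 0 ≤ max (M.node i.castSucc) (min y (M.node i.succ)) - M.node i.castSucc :=
    sub_nonneg.mpr (le_max_left _ _)
  rw [ramp, abs_of_nonneg (div_nonneg h1 hl.le), div_le_one hl, len]
  exact sub_le_sub_right (max_le (M.node_lt i).le (min_le_right _ _)) _

theorem memLp_interp_cyl {T : ℝ} {w : ℝ → ℝ → ℝ}
    (h : ∀ z ∈ Icc (0 : ℝ) 1, MemLp (fun τ => w τ z) 2 (volume.restrict (Ioo 0 T))) :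
    MemLp (Function.uncurry fun τ => M.interp (w τ)) 2 (volume.restrict (cyl T)) := by
  have hfst : ∀ z ∈ Icc (0 : ℝ) 1,
      MemLp (fun p : ℝ × ℝ => w p.1 z) 2 (volume.restrict (cyl T)) := by
    intro z hz
    rw [volume_restrict_cyl]
    exact (h z hz).comp_fst _
  refine MemLp.add (f := fun p : ℝ × ℝ => w p.1 0) (hfst 0 (left_mem_Icc.mpr zero_le_one))
    (memLp_finsetSum _ fun i _ => ?_)
  have h1 : MemLp (fun p : ℝ × ℝ => w p.1 (M.node i.succ) - w p.1 (M.node i.castSucc)) 2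
      (volume.restrict (cyl T)) := (hfst _ (M.node_mem _)).sub (hfst _ (M.node_mem _))
  refine h1.of_le (h1.1.mul ((continuous_ramp i).comp continuous_snd).aestronglyMeasurable)
    (Filter.Eventually.of_forall fun p => ?_)
  rw [norm_mul]
  exact mul_le_of_le_one_right (norm_nonneg _) (ramp_mem i p.2)

theorem memLp_interp_time {T : ℝ} {w : ℝ → ℝ → ℝ}
    (h : ∀ z ∈ Icc (0 : ℝ) 1, MemLp (fun τ => w τ z) 2 (volume.restrict (Ioo 0 T))) (y : ℝ) :
    MemLp (fun τ => M.interp (w τ) y) 2 (volume.restrict (Ioo 0 T)) := by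
  refine MemLp.add (f := fun τ => w τ 0) (h 0 (left_mem_Icc.mpr zero_le_one))
    (memLp_finsetSum _ fun i _ => ?_)
  have h1 : MemLp (fun τ => M.ramp i y * (w τ (M.node i.succ) - w τ (M.node i.castSucc))) 2
      (volume.restrict (Ioo 0 T)) := ((h _ (M.node_mem _)).sub (h _ (M.node_mem _))).const_mul _
  simpa only [mul_comm (M.ramp i y)] using h1

theorem continuousOn_interp_cyl {T : ℝ} {v : ℝ → ℝ → ℝ}
    (h : ∀ z ∈ Icc (0 : ℝ) 1, ContinuousOn (fun τ => v τ z) (Icc 0 T)) :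
    ContinuousOn (Function.uncurry fun τ => M.interp (v τ)) (Icc 0 T ×ˢ Icc 0 1) := by
  have hfst : ∀ z ∈ Icc (0 : ℝ) 1,
      ContinuousOn (fun p : ℝ × ℝ => v p.1 z) (Icc 0 T ×ˢ Icc 0 1) := fun z hz =>
    (h z hz).comp continuousOn_fst fun p hp => hp.1
  refine (hfst 0 (left_mem_Icc.mpr zero_le_one)).add (continuousOn_finsetSum _ fun i _ => ?_)
  exact ((hfst _ (M.node_mem _)).sub (hfst _ (M.node_mem _))).mul
    ((continuous_ramp i).comp continuous_snd).continuousOn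

end Mesh

/-- The time derivative of a function with values in the finite element space, as the element of
that space whose nodal values are the weak derivatives of the nodal values. -/
noncomputable def discreteDeriv (M : Mesh) (T : ℝ) (v : ℝ → ℝ → ℝ) (τ : ℝ) : ℝ → ℝ :=
  M.interp fun z => wd 0 T (fun s => v s z) τ

/-- The speed of the front. -/
noncomputable def Data.speed (d : Data) (v : ℝ → ℝ → ℝ) (g : ℝ → ℝ) (τ : ℝ) : ℝ :=
  d.A₀ * (v τ 1 - d.σ (g τ) / d.m₀)

theorem continuousOn_speed {d : Data} (hσ : ContDiff ℝ 1 d.σ) {T : ℝ} {v : ℝ → ℝ → ℝ} {g : ℝ → ℝ}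
    (hv : ContinuousOn (fun τ => v τ 1) (Icc 0 T)) (hg : ContinuousOn g (Icc 0 T)) :
    ContinuousOn (d.speed v g) (Icc 0 T) :=
  continuousOn_const.mul (hv.sub ((hσ.continuous.comp_continuousOn hg).div_const _))

theorem isPrimitiveOn_front {d : Data} {T : ℝ} (hT : 0 < T) {v : ℝ → ℝ → ℝ} {g : ℝ → ℝ}
    (hgc : ContinuousOn g (Icc 0 T)) (hg : MemW1 ⊤ (Ioo 0 T) g)
    (h : ∀ᵐ τ ∂(volume.restrict (Ioo 0 T)),
      wd 0 T g τ = d.A₀ * (v τ 1 - d.σ (g τ) / d.m₀)) :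
    IsPrimitiveOn 0 T g (d.speed v g) :=
  (hg.isPrimitiveOn hT le_top hgc).congr hT.le (fun _ _ => rfl) h

namespace IsDiscreteSolution

variable {d : Data} {M : Mesh} {L T : ℝ} {v : ℝ → ℝ → ℝ} {g : ℝ → ℝ}

theorem isPrimitiveOn_wd (hs : IsDiscreteSolution d M L T v g) (hT : 0 < T) {z : ℝ}
    (hz : z ∈ Icc (0 : ℝ) 1) :
    IsPrimitiveOn 0 T (fun τ => v τ z) (wd 0 T fun s => v s z) :=
  (hs.uk_mem z hz).isPrimitiveOn hT (by norm_num) (hs.uk_cont z hz)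

theorem isPrimitiveOn_discreteDeriv (hs : IsDiscreteSolution d M L T v g) (hT : 0 < T) {y : ℝ}
    (hy : y ∈ Icc (0 : ℝ) 1) :
    IsPrimitiveOn 0 T (fun τ => v τ y) (fun τ => discreteDeriv M T v τ y) := by
  have h := Mesh.isPrimitiveOn_interp_time (M := M) (T := T) (v := v)
    (w := fun τ z => wd 0 T (fun s => v s z) τ) (fun z hz => hs.isPrimitiveOn_wd hT hz) y
  exact h.congr hT.le (fun τ hτ => Mesh.interp_eq_of_mem_V (hs.uk_V τ hτ) hy)
    Filter.EventuallyEq.rfl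

theorem memLp_discreteDeriv (hs : IsDiscreteSolution d M L T v g) :
    MemLp (Function.uncurry (discreteDeriv M T v)) 2 (volume.restrict (cyl T)) :=
  Mesh.memLp_interp_cyl fun z hz => (hs.uk_mem z hz).memLp_weakDeriv isOpen_Ioo 1

theorem integrableOn_discreteDeriv (hs : IsDiscreteSolution d M L T v g) :
    IntegrableOn (Function.uncurry (discreteDeriv M T v)) (cyl T) := by
  have hfin : IsFiniteMeasure ((volume : Measure (ℝ × ℝ)).restrict (cyl T)) := by
    rw [volume_restrict_cyl]; infer_instance
  exact hs.memLp_discreteDeriv.integrable (by norm_num)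

theorem continuousOn_uncurry (hs : IsDiscreteSolution d M L T v g) :
    ContinuousOn (Function.uncurry v) (Icc 0 T ×ˢ Icc 0 1) :=
  (Mesh.continuousOn_interp_cyl (M := M) hs.uk_cont).congr fun p hp =>
    (Mesh.interp_eq_of_mem_V (hs.uk_V p.1 hp.1) hp.2).symm

theorem timeDeriv_ae_eq (hs : IsDiscreteSolution d M L T v g) (hT : 0 < T) :
    ∀ᵐ τ ∂(volume.restrict (Ioo 0 T)),
      timeDeriv T v τ =ᵐ[volume.restrict (Ioo (0 : ℝ) 1)] discreteDeriv M T v τ := by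
  have h := (hasWeakDeriv_cyl hT.le (ae_restrict_of_forall_mem measurableSet_Ioo fun y hy =>
    hs.isPrimitiveOn_discreteDeriv hT (Ioo_subset_Icc_self hy)) hs.continuousOn_uncurry
    hs.integrableOn_discreteDeriv).weakDeriv_ae_eq (isOpen_cyl T)
  rw [volume_restrict_cyl] at h
  exact Measure.ae_ae_of_ae_prod h

theorem isPrimitiveOn_front (hs : IsDiscreteSolution d M L T v g) (hT : 0 < T) :
    IsPrimitiveOn 0 T g (d.speed v g) :=
  RubberFEM.isPrimitiveOn_front hT hs.h_cont hs.h_mem hs.front_eq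

/-- The semi-discrete problem in terms of nodal quantities. -/
theorem weak_form (hs : IsDiscreteSolution d M L T v g) (hT : 0 < T) :
    ∀ᵐ τ ∂(volume.restrict (Ioo 0 T)), ∀ φ ∈ M.V,
      (∫ y in Ioo (0 : ℝ) 1, discreteDeriv M T v τ y * φ y)
        - d.speed v g τ / g τ * (∫ y in Ioo (0 : ℝ) 1, y * M.slope (v τ) y * φ y)
        + 1 / g τ ^ 2 * M.dirichlet (v τ) φ
        - 1 / g τ * d.Bi * (d.b τ / d.m₀ - d.H * v τ 0) * φ 0
        + d.speed v g τ / g τ * v τ 1 * φ 1 = 0 := by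
  filter_upwards [hs.weak_eq, hs.timeDeriv_ae_eq hT, hs.front_eq,
    ae_restrict_mem measurableSet_Ioo] with τ h1 h2 h3 hτ φ hφ
  have h4 := h1 φ hφ
  have hv := (Mesh.isPrimitiveOn_of_mem_V (hs.uk_V τ (Ioo_subset_Icc_self hτ))).wd_ae_eq
    zero_le_one
  have hw := (Mesh.isPrimitiveOn_of_mem_V hφ).wd_ae_eq zero_le_one
  have e1 : ∫ y in Ioo (0 : ℝ) 1, timeDeriv T v τ y * φ y
      = ∫ y in Ioo (0 : ℝ) 1, discreteDeriv M T v τ y * φ y :=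
    integral_congr_ae (h2.mono fun y hy => by simp only [hy])
  have e2 : ∫ y in Ioo (0 : ℝ) 1, y * wd 0 1 (v τ) y * φ y
      = ∫ y in Ioo (0 : ℝ) 1, y * M.slope (v τ) y * φ y :=
    integral_congr_ae (hv.mono fun y hy => by simp only [hy])
  have e3 : ∫ y in Ioo (0 : ℝ) 1, wd 0 1 (v τ) y * wd 0 1 φ y = M.dirichlet (v τ) φ := by
    rw [← Mesh.integral_slope_mul_slope]
    refine integral_congr_ae ?_
    filter_upwards [hv, hw] with y hy1 hy2
    rw [hy1, hy2]
  rw [weakForm, e1, e2, e3, h3] at h4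
  exact h4

end IsDiscreteSolution

/-! ### Bounds for the semi-discrete solution that are uniform in the mesh -/

/-- The continuity argument: a continuous function that starts below zero, and is below zero at any
time up to which it has not been above zero, stays below zero. -/
theorem lt_zero_of_bootstrap {f : ℝ → ℝ} {T : ℝ} (hf : ContinuousOn f (Icc 0 T)) (h0 : f 0 < 0)
    (h : ∀ t ∈ Icc 0 T, (∀ s ∈ Icc 0 t, f s ≤ 0) → f t < 0) : ∀ t ∈ Icc 0 T, f t < 0 := by
  by_contra! hcon
  obtain ⟨t₁, ht₁, hft₁⟩ := hcon
  have hA : IsCompact (Icc 0 T ∩ f ⁻¹' Ici 0) :=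
    isCompact_Icc.of_isClosed_subset (hf.preimage_isClosed_of_isClosed isClosed_Icc isClosed_Ici)
      inter_subset_left
  obtain ⟨t₀, ⟨ht₀, hft₀⟩, hmin⟩ := hA.exists_isLeast ⟨t₁, ht₁, hft₁⟩
  have hle : ∀ s ∈ Icc 0 T, s < t₀ → f s < 0 := fun s hs hst => by
    by_contra hns
    exact absurd (hmin ⟨hs, not_lt.mp hns⟩) (not_le.mpr hst)
  obtain ⟨s, hs, hfs⟩ := intermediate_value_Icc ht₀.1 (hf.mono (Icc_subset_Icc_right ht₀.2))
    (show (0 : ℝ) ∈ Icc (f 0) (f t₀) from ⟨h0.le, hft₀⟩)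
  have hst : s = t₀ := le_antisymm hs.2 (hmin ⟨⟨hs.1, hs.2.trans ht₀.2⟩, hfs.ge⟩)
  have h1 : f t₀ < 0 := h t₀ ht₀ fun r hr => by
    rcases hr.2.lt_or_eq with h2 | h2
    · exact (hle r ⟨hr.1, hr.2.trans ht₀.2⟩ h2).le
    · rw [h2, ← hst, hfs]
  exact absurd h1 (not_lt.mpr hft₀)

/-- The energy whose dissipation controls the time derivative of the semi-discrete solution. The
terms after the first are the time integrals of the boundary terms of the weak formulation tested
with the time derivative and multiplied by `g`; the cubic term comes from the front, whose speed is
itself affine in `v(1)`. The function `B` is the continuous representative of `b`. -/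
noncomputable def Data.energy (d : Data) (M : Mesh) (B : ℝ → ℝ) (v : ℝ → ℝ → ℝ) (g : ℝ → ℝ)
    (τ : ℝ) : ℝ :=
  M.dirichlet (v τ) (v τ) / (2 * g τ) - d.Bi / d.m₀ * (B τ * v τ 0)
    + d.Bi * d.H / 2 * v τ 0 ^ 2 + d.A₀ / 3 * v τ 1 ^ 3
    - d.A₀ / (2 * d.m₀) * (d.σ (g τ) * v τ 1 ^ 2)

/-- The time derivative of the energy, where `w` is the time derivative of `v` and `β` that of
`B`. -/
noncomputable def Data.energyDeriv (d : Data) (M : Mesh) (B β : ℝ → ℝ) (v w : ℝ → ℝ → ℝ)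
    (g : ℝ → ℝ) (τ : ℝ) : ℝ :=
  M.dirichlet (v τ) (w τ) / g τ - M.dirichlet (v τ) (v τ) * d.speed v g τ / (2 * g τ ^ 2)
    - d.Bi / d.m₀ * (β τ * v τ 0 + B τ * w τ 0) + d.Bi * d.H * (v τ 0 * w τ 0)
    + d.A₀ * (v τ 1 ^ 2 * w τ 1)
    - d.A₀ / (2 * d.m₀) * (deriv d.σ (g τ) * d.speed v g τ * v τ 1 ^ 2
      + 2 * d.σ (g τ) * v τ 1 * w τ 1)

namespace IsDiscreteSolution

variable {d : Data} {M : Mesh} {L T : ℝ} {v : ℝ → ℝ → ℝ} {g B β : ℝ → ℝ}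

theorem isPrimitiveOn_energy (hs : IsDiscreteSolution d M L T v g) (hT : 0 < T)
    (hσ : ContDiff ℝ 1 d.σ) (hB : IsPrimitiveOn 0 T B β) :
    IsPrimitiveOn 0 T (d.energy M B v g) (d.energyDeriv M B β v (discreteDeriv M T v) g) := by
  have hv : ∀ z ∈ Icc (0 : ℝ) 1, _ := fun z hz => hs.isPrimitiveOn_discreteDeriv hT (y := z) hz
  have h0 := hv 0 (left_mem_Icc.mpr zero_le_one)
  have h1 := hv 1 (right_mem_Icc.mpr zero_le_one)
  have hg := hs.isPrimitiveOn_front hT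
  have hgs := continuousOn_speed hσ (h1.continuousOn hT.le) hs.h_cont
  have hS := Mesh.isPrimitiveOn_dirichlet (M := M) hT.le hv
  have hinv : IsPrimitiveOn 0 T (fun t => (g t)⁻¹) _ :=
    hg.comp hT.le hgs (ψ := fun x => x⁻¹) (ψ' := fun x => -(x ^ 2)⁻¹)
      (fun t ht => hasDerivAt_inv (hs.h_pos t ht).ne')
      ((hs.h_cont.pow 2).inv₀ fun t ht => pow_ne_zero 2 (hs.h_pos t ht).ne').neg
  have hσg : IsPrimitiveOn 0 T (fun t => d.σ (g t)) _ :=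
    hg.comp hT.le hgs (ψ := d.σ) (ψ' := deriv d.σ)
      (fun t _ => (hσ.differentiable (by simp) _).hasDerivAt)
      ((hσ.continuous_deriv le_rfl).comp_continuousOn hs.h_cont)
  have h11 := h1.mul hT.le h1
  have key := (((((hS.mul hT.le hinv).const_mul (1 / 2)).sub
    ((hB.mul hT.le h0).const_mul (d.Bi / d.m₀))).add
    ((h0.mul hT.le h0).const_mul (d.Bi * d.H / 2))).add
    ((h1.mul hT.le h11).const_mul (d.A₀ / 3))).sub
    ((hσg.mul hT.le h11).const_mul (d.A₀ / (2 * d.m₀)))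
  refine key.congr hT.le (fun τ _ => ?_) (ae_restrict_of_forall_mem measurableSet_Ioo
    fun τ hτ => ?_)
  · simp only [Data.energy]
    ring
  · have hgp := (hs.h_pos τ (Ioo_subset_Icc_self hτ)).ne'
    simp only [Data.energyDeriv]
    field_simp
    ring

/-- The energy balance, from the test function `∂v/∂τ`. On the right-hand side only the convection
term still contains the time derivative. -/
theorem energyDeriv_add (hs : IsDiscreteSolution d M L T v g) (hT : 0 < T)
    (hb : d.b =ᵐ[volume.restrict (Ioo 0 T)] B) :
    ∀ᵐ τ ∂(volume.restrict (Ioo 0 T)),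
      d.energyDeriv M B β v (discreteDeriv M T v) g τ + g τ * l2Norm (discreteDeriv M T v τ) ^ 2
        = d.speed v g τ *
            (∫ y in Ioo (0 : ℝ) 1, y * M.slope (v τ) y * discreteDeriv M T v τ y)
          - M.dirichlet (v τ) (v τ) * d.speed v g τ / (2 * g τ ^ 2) - d.Bi / d.m₀ * (β τ * v τ 0)
          - d.A₀ / (2 * d.m₀) * (deriv d.σ (g τ) * d.speed v g τ * v τ 1 ^ 2) := by
  filter_upwards [hs.weak_form hT, hb, ae_restrict_mem measurableSet_Ioo] with τ h1 h2 hτ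
  have h3 := h1 (discreteDeriv M T v τ) (Mesh.interp_mem_V _)
  have hgp := (hs.h_pos τ (Ioo_subset_Icc_self hτ)).ne'
  rw [h2] at h3
  simp only [← sq, ← l2Norm_sq] at h3
  have h4 := congrArg (g τ * ·) h3
  simp only [mul_zero] at h4
  rw [Data.energyDeriv]
  have h5 : d.speed v g τ = d.A₀ * (v τ 1 - d.σ (g τ) / d.m₀) := rfl
  generalize (∫ y in Ioo (0 : ℝ) 1, y * M.slope (v τ) y * discreteDeriv M T v τ y) = b at *
  generalize l2Norm (discreteDeriv M T v τ) ^ 2 = a at *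
  generalize M.dirichlet (v τ) (discreteDeriv M T v τ) = s at *
  have h6 : g τ * a - d.speed v g τ * b + s / g τ
      - d.Bi * (B τ / d.m₀ - d.H * v τ 0) * discreteDeriv M T v τ 0
      + d.A₀ * (v τ 1 - d.σ (g τ) / d.m₀) * v τ 1 * discreteDeriv M T v τ 1 = 0 := by
    refine Eq.trans ?_ h4
    rw [← h5]
    field_simp
  linear_combination h6

end IsDiscreteSolution

/-- The growth constant of the energy, in terms of bounds for `σ'`, the speed of the front and the
boundary values. -/
noncomputable def Data.growthConst (d : Data) (S₁ G K : ℝ) : ℝ :=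
  G ^ 2 / d.h₀ + 2 * G / d.h₀ ^ 2 + d.Bi / d.m₀ * K + d.A₀ / (2 * d.m₀) * (S₁ * G * K ^ 2)

/-- A bound for the boundary terms of the energy, in terms of bounds for `b`, `σ` and the boundary
values. -/
noncomputable def Data.boundaryConst (d : Data) (Kb S₀ K : ℝ) : ℝ :=
  d.Bi / d.m₀ * (Kb * K) + d.Bi * d.H / 2 * K ^ 2 + d.A₀ / 3 * K ^ 3
    + d.A₀ / (2 * d.m₀) * (S₀ * K ^ 2)

theorem Data.growthConst_nonneg {d : Data} {T₀ : ℝ} (hd : d.Admissible T₀) {S₁ G K : ℝ}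
    (hS : 0 ≤ S₁) (hG : 0 ≤ G) (hK : 0 ≤ K) : 0 ≤ d.growthConst S₁ G K := by
  have hh := hd.h₀_pos
  have hBi := hd.Bi_pos
  have hm := hd.m₀_pos
  have hA := hd.A₀_pos
  unfold Data.growthConst
  positivity

/-- The right-hand side of the energy balance grows at most linearly in the energy, once half of the
dissipation has absorbed the convection term. -/
theorem Data.energyDeriv_add_le {d : Data} {T₀ : ℝ} (hd : d.Admissible T₀) {M : Mesh}
    {T : ℝ} {v : ℝ → ℝ → ℝ} {g B β : ℝ → ℝ} {G K S₁ τ : ℝ}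
    (hτ : d.energyDeriv M B β v (discreteDeriv M T v) g τ
        + g τ * l2Norm (discreteDeriv M T v τ) ^ 2
        = d.speed v g τ *
            (∫ y in Ioo (0 : ℝ) 1, y * M.slope (v τ) y * discreteDeriv M T v τ y)
          - M.dirichlet (v τ) (v τ) * d.speed v g τ / (2 * g τ ^ 2) - d.Bi / d.m₀ * (β τ * v τ 0)
          - d.A₀ / (2 * d.m₀) * (deriv d.σ (g τ) * d.speed v g τ * v τ 1 ^ 2))
    (hg : d.h₀ / 2 ≤ g τ) (hG : |d.speed v g τ| ≤ G) (h0 : |v τ 0| ≤ K) (h1 : |v τ 1| ≤ K)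
    (hS₁ : |deriv d.σ (g τ)| ≤ S₁) :
    d.energyDeriv M B β v (discreteDeriv M T v) g τ
        + d.h₀ / 4 * l2Norm (discreteDeriv M T v τ) ^ 2
      ≤ d.growthConst S₁ G K * (1 + M.dirichlet (v τ) (v τ) + |β τ|) := by
  have hh := hd.h₀_pos
  have hBi := hd.Bi_pos
  have hm := hd.m₀_pos
  have hA := hd.A₀_pos
  rw [Data.growthConst]
  have hw : IsL2 (discreteDeriv M T v τ) :=
    isL2_of_continuousOn (Mesh.continuous_interp _).continuousOn
  have hsl := Mesh.isL2_slope (M := M) (v τ)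
  have hI := abs_integral_mul_le (isL2_id_mul hsl) hw
  have hI' := l2Norm_id_mul_le hsl
  have hSq := Mesh.l2Norm_slope_sq (M := M) (v τ)
  generalize (∫ y in Ioo (0 : ℝ) 1, y * M.slope (v τ) y * discreteDeriv M T v τ y) = b at *
  have ha := l2Norm_nonneg (discreteDeriv M T v τ)
  have hs0 := l2Norm_nonneg (M.slope (v τ))
  rw [← hSq] at *
  generalize l2Norm (discreteDeriv M T v τ) = a at *
  generalize l2Norm (M.slope (v τ)) = s at *
  generalize d.speed v g τ = p at *
  have hgp : 0 < g τ := by linarith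
  have hG0 : 0 ≤ G := (abs_nonneg _).trans hG
  have hK0 : 0 ≤ K := (abs_nonneg _).trans h0
  have hS0 : 0 ≤ S₁ := (abs_nonneg _).trans hS₁
  have hb : |b| ≤ s * a := hI.trans (mul_le_mul_of_nonneg_right hI' ha)
  have e1 : p * b ≤ g τ / 2 * a ^ 2 + G ^ 2 / d.h₀ * s ^ 2 := by
    have i1 : p * b ≤ G * (s * a) := by
      refine (le_abs_self _).trans ?_
      rw [abs_mul]
      exact mul_le_mul hG hb (abs_nonneg _) hG0
    have i2 : G * (s * a) ≤ g τ / 2 * a ^ 2 + G ^ 2 / (2 * g τ) * s ^ 2 := by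
      have : g τ / 2 * a ^ 2 + G ^ 2 / (2 * g τ) * s ^ 2 - G * (s * a)
          = (g τ * a - G * s) ^ 2 / (2 * g τ) := by field_simp; ring
      have h2 : 0 ≤ (g τ * a - G * s) ^ 2 / (2 * g τ) := by positivity
      linarith
    have i3 : G ^ 2 / (2 * g τ) ≤ G ^ 2 / d.h₀ :=
      div_le_div_of_nonneg_left (sq_nonneg _) hh (by linarith)
    have i4 := mul_le_mul_of_nonneg_right i3 (sq_nonneg s)
    linarith
  have e2 : -(s ^ 2 * p / (2 * g τ ^ 2)) ≤ 2 * G / d.h₀ ^ 2 * s ^ 2 := by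
    have i1 : -(s ^ 2 * p / (2 * g τ ^ 2)) ≤ s ^ 2 * G / (2 * g τ ^ 2) := by
      rw [← neg_div, ← mul_neg]
      have := (abs_le.mp hG).1
      gcongr
      linarith
    have i2 : s ^ 2 * G / (2 * g τ ^ 2) ≤ s ^ 2 * G / (d.h₀ ^ 2 / 2) := by
      refine div_le_div_of_nonneg_left (by positivity) (by positivity) ?_
      nlinarith
    have i3 : s ^ 2 * G / (d.h₀ ^ 2 / 2) = 2 * G / d.h₀ ^ 2 * s ^ 2 := by field_simp
    linarith
  have e3 : -(d.Bi / d.m₀ * (β τ * v τ 0)) ≤ d.Bi / d.m₀ * K * |β τ| := by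
    rw [← mul_neg, mul_assoc]
    refine mul_le_mul_of_nonneg_left ?_ (by positivity)
    refine (neg_le_abs _).trans ?_
    rw [abs_mul, mul_comm]
    exact mul_le_mul_of_nonneg_right h0 (abs_nonneg _)
  have e4 : -(d.A₀ / (2 * d.m₀) * (deriv d.σ (g τ) * p * v τ 1 ^ 2))
      ≤ d.A₀ / (2 * d.m₀) * (S₁ * G * K ^ 2) := by
    rw [← mul_neg]
    refine mul_le_mul_of_nonneg_left ?_ (by positivity)
    refine (neg_le_abs _).trans ?_
    rw [abs_mul, abs_mul, abs_pow]
    gcongr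
  have e5 : (g τ / 2 - d.h₀ / 4) * a ^ 2 ≥ 0 := mul_nonneg (by linarith) (sq_nonneg _)
  have n1 : 0 ≤ G ^ 2 / d.h₀ := by positivity
  have n2 : 0 ≤ 2 * G / d.h₀ ^ 2 := by positivity
  have n3 : 0 ≤ d.Bi / d.m₀ * K := by positivity
  have n4 : 0 ≤ d.A₀ / (2 * d.m₀) * (S₁ * G * K ^ 2) := by positivity
  have hβ := abs_nonneg (β τ)
  have hs2 := sq_nonneg s
  generalize G ^ 2 / d.h₀ = c1 at *
  generalize 2 * G / d.h₀ ^ 2 = c2 at *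
  generalize d.Bi / d.m₀ * K = c3 at *
  generalize d.A₀ / (2 * d.m₀) * (S₁ * G * K ^ 2) = c4 at *
  have m1 := mul_nonneg n1 hβ
  have m2 := mul_nonneg n2 hβ
  have m3 := mul_nonneg n3 hs2
  have m4 := mul_nonneg n4 hs2
  have m5 := mul_nonneg n4 hβ
  linarith

namespace IsDiscreteSolution

variable {d : Data} {M : Mesh} {L T : ℝ} {v : ℝ → ℝ → ℝ} {g B β : ℝ → ℝ}

theorem integrableOn_l2Norm_sq (hs : IsDiscreteSolution d M L T v g) :
    IntegrableOn (fun τ => l2Norm (discreteDeriv M T v τ) ^ 2) (Ioo 0 T) := by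
  have := IntegrableOn.integral_cyl (T := T) hs.memLp_discreteDeriv.integrable_sq
  simp only [Function.uncurry_apply_pair] at this
  simpa only [l2Norm_sq] using this

/-- The energy estimate on an interval on which a priori bounds hold. -/
theorem energy_le (hs : IsDiscreteSolution d M L T v g) (hT : 0 < T) {T₀ : ℝ}
    (hd : d.Admissible T₀) (hB : IsPrimitiveOn 0 T B β)
    (hb : d.b =ᵐ[volume.restrict (Ioo 0 T)] B) {G K S₁ R t : ℝ} (ht : t ∈ Icc 0 T)
    (hg : ∀ τ ∈ Icc 0 t, d.h₀ / 2 ≤ g τ) (hG : ∀ τ ∈ Icc 0 t, |d.speed v g τ| ≤ G)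
    (h0 : ∀ τ ∈ Icc 0 t, |v τ 0| ≤ K) (h1 : ∀ τ ∈ Icc 0 t, |v τ 1| ≤ K)
    (hS₁ : ∀ τ ∈ Icc 0 t, |deriv d.σ (g τ)| ≤ S₁)
    (hR : ∀ τ ∈ Icc 0 t, M.dirichlet (v τ) (v τ) ≤ R) :
    d.energy M B v g t + d.h₀ / 4 * ∫ τ in Ioo 0 t, l2Norm (discreteDeriv M T v τ) ^ 2
      ≤ d.energy M B v g 0
        + d.growthConst S₁ G K * ((1 + R) * t + ∫ τ in Ioo 0 t, |β τ|) := by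
  have hE := (hs.isPrimitiveOn_energy hT hd.σ_contDiff hB).mono le_rfl ht.1 ht.2
  have hEi := hE.integrableOn ht.1
  have hEe := hE.integral_eq ht.1
  rw [intervalIntegral.integral_of_le ht.1, integral_Ioc_eq_integral_Ioo] at hEe
  have hsub : Ioo 0 t ⊆ Ioo 0 T := Ioo_subset_Ioo_right ht.2
  have hDi := hs.integrableOn_l2Norm_sq.mono_set hsub
  have hβi : IntegrableOn (fun τ => |β τ|) (Ioo 0 t) :=
    ((hB.integrableOn hT.le).mono_set hsub).abs
  set C := d.growthConst S₁ G K with hC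
  have hmem : (0 : ℝ) ∈ Icc 0 t := left_mem_Icc.mpr ht.1
  have hC0 : 0 ≤ C := Data.growthConst_nonneg hd ((abs_nonneg _).trans (hS₁ 0 hmem))
    ((abs_nonneg _).trans (hG 0 hmem)) ((abs_nonneg _).trans (h0 0 hmem))
  have hci : IntegrableOn (fun τ => C * ((1 + R) + |β τ|)) (Ioo 0 t) :=
    (Integrable.add (integrable_const (1 + R)) hβi).const_mul C
  have hle : ∫ τ in Ioo 0 t, (d.energyDeriv M B β v (discreteDeriv M T v) g τ
        + d.h₀ / 4 * l2Norm (discreteDeriv M T v τ) ^ 2)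
      ≤ ∫ τ in Ioo 0 t, C * ((1 + R) + |β τ|) := by
    refine integral_mono_ae (Integrable.add hEi (hDi.const_mul _)) hci ?_
    have h2 := ae_restrict_of_ae_restrict_of_subset hsub (hs.energyDeriv_add (β := β) hT hb)
    filter_upwards [h2, ae_restrict_mem measurableSet_Ioo] with τ hτ hτI
    have hτc := Ioo_subset_Icc_self hτI
    refine (Data.energyDeriv_add_le hd hτ (hg τ hτc) (hG τ hτc) (h0 τ hτc) (h1 τ hτc)
      (hS₁ τ hτc)).trans ?_
    refine mul_le_mul_of_nonneg_left ?_ hC0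
    linarith [hR τ hτc]
  rw [integral_add hEi (hDi.const_mul _), integral_const_mul, integral_const_mul,
    integral_add (integrable_const _) hβi, hEe] at hle
  have hvol : (volume.restrict (Ioo 0 t)).real univ = t := by simp [ht.1]
  rw [integral_const, hvol, smul_eq_mul, mul_comm t] at hle
  linarith

/-- The displacement of the solution from its initial value is controlled by its time
derivative. -/
theorem l2Norm_sub_sq_le (hs : IsDiscreteSolution d M L T v g) (hT : 0 < T) {t : ℝ}
    (ht : t ∈ Icc 0 T) :
    l2Norm (fun y => v t y - v 0 y) ^ 2
      ≤ t * ∫ τ in Ioo 0 t, l2Norm (discreteDeriv M T v τ) ^ 2 := by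
  have hsub : Ioo 0 t ⊆ Ioo 0 T := Ioo_subset_Ioo_right ht.2
  have hw2 : IntegrableOn (fun z => Function.uncurry (discreteDeriv M T v) z ^ 2) (cyl t) :=
    IntegrableOn.mono_set hs.memLp_discreteDeriv.integrable_sq (cyl_mono ht.2)
  have e := (setIntegral_cyl hw2).symm.trans (setIntegral_cyl_symm hw2)
  simp only [Function.uncurry_apply_pair] at e
  simp only [l2Norm_sq]
  rw [e, ← integral_const_mul]
  have hi := IntegrableOn.integral_cyl_symm hw2
  simp only [Function.uncurry_apply_pair] at hi
  have hc := hs.continuousOn_uncurry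
  have hL : IsL2 (fun y => v t y - v 0 y) := isL2_of_continuousOn
    ((ContinuousOn.slice hc ht).sub (ContinuousOn.slice hc (left_mem_Icc.mpr hT.le)))
  refine setIntegral_mono_on hL.integrable_sq (hi.const_mul t) measurableSet_Ioo fun y hy => ?_
  have hp := (hs.isPrimitiveOn_discreteDeriv hT (Ioo_subset_Icc_self hy)).mono le_rfl ht.1 ht.2
  have hm : MemLp (fun τ => discreteDeriv M T v τ y) 2 (volume.restrict (Ioo 0 T)) :=
    Mesh.memLp_interp_time (w := fun τ z => wd 0 T (fun s => v s z) τ)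
      (fun z hz => (hs.uk_mem z hz).memLp_weakDeriv isOpen_Ioo 1) y
  have := hp.sq_sub_le (hm.mono_measure (Measure.restrict_mono_set volume hsub))
    (right_mem_Icc.mpr ht.1) (left_mem_Icc.mpr ht.1)
  simpa only [sub_zero] using this

theorem abs_front_sub_le (hs : IsDiscreteSolution d M L T v g) (hT : 0 < T) {t G : ℝ}
    (ht : t ∈ Icc 0 T) (hG : ∀ τ ∈ Icc 0 t, |d.speed v g τ| ≤ G) : |g t - d.h₀| ≤ G * t := by
  have h := ((hs.isPrimitiveOn_front hT).mono le_rfl ht.1 ht.2).integral_eq ht.1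
  rw [hs.h_init] at h
  rw [← h]
  have := intervalIntegral.norm_integral_le_of_norm_le_const (a := 0) (b := t)
    (f := d.speed v g) (C := G) fun τ hτ => by
      rw [uIoc_of_le ht.1] at hτ
      exact hG τ (Ioc_subset_Icc_self hτ)
  simpa [abs_of_nonneg ht.1] using this

end IsDiscreteSolution

/-- Bounds for the semi-discrete solution at time `t`: `R` bounds the squared `H¹` seminorm, `G` the
speed of the front and `D` the dissipation up to time `t`. -/
structure DiscreteBounds (d : Data) (M : Mesh) (T : ℝ) (v : ℝ → ℝ → ℝ) (g : ℝ → ℝ)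
    (R G D t : ℝ) : Prop where
  dirichlet_le : M.dirichlet (v t) (v t) ≤ R
  front_ge : d.h₀ / 2 ≤ g t
  front_le : g t ≤ 2 * d.h₀
  speed_le : |d.speed v g t| ≤ G
  dissipation_le : ∫ τ in Ioo 0 t, l2Norm (discreteDeriv M T v τ) ^ 2 ≤ D

/-- The energy differs from its leading term at most by a constant, as long as the boundary values
are bounded. -/
theorem abs_energy_sub_le {d : Data} {T₀ : ℝ} (hd : d.Admissible T₀) {M : Mesh} {B : ℝ → ℝ}
    {v : ℝ → ℝ → ℝ} {g : ℝ → ℝ} {Kb K S₀ τ : ℝ} (hB : |B τ| ≤ Kb) (h0 : |v τ 0| ≤ K)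
    (h1 : |v τ 1| ≤ K) (hS : |d.σ (g τ)| ≤ S₀) :
    |d.energy M B v g τ - M.dirichlet (v τ) (v τ) / (2 * g τ)|
      ≤ d.boundaryConst Kb S₀ K := by
  have hBi := hd.Bi_pos
  have hm := hd.m₀_pos
  have hA := hd.A₀_pos
  have hH := hd.H_pos
  have i1 : |d.Bi / d.m₀ * (B τ * v τ 0)| ≤ d.Bi / d.m₀ * (Kb * K) := by
    rw [abs_mul, abs_mul, abs_of_pos (div_pos hBi hm)]
    gcongr
    exact (abs_nonneg _).trans hB
  have i2 : |d.Bi * d.H / 2 * v τ 0 ^ 2| ≤ d.Bi * d.H / 2 * K ^ 2 := by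
    rw [abs_mul, abs_pow, abs_of_pos (show 0 < d.Bi * d.H / 2 by positivity)]
    gcongr
  have i3 : |d.A₀ / 3 * v τ 1 ^ 3| ≤ d.A₀ / 3 * K ^ 3 := by
    rw [abs_mul, abs_pow, abs_of_pos (show 0 < d.A₀ / 3 by positivity)]
    gcongr
  have i4 : |d.A₀ / (2 * d.m₀) * (d.σ (g τ) * v τ 1 ^ 2)|
      ≤ d.A₀ / (2 * d.m₀) * (S₀ * K ^ 2) := by
    rw [abs_mul, abs_mul, abs_pow, abs_of_pos (show 0 < d.A₀ / (2 * d.m₀) by positivity)]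
    gcongr
    exact (abs_nonneg _).trans hS
  have e : d.energy M B v g τ - M.dirichlet (v τ) (v τ) / (2 * g τ)
      = -(d.Bi / d.m₀ * (B τ * v τ 0)) + d.Bi * d.H / 2 * v τ 0 ^ 2 + d.A₀ / 3 * v τ 1 ^ 3
        - d.A₀ / (2 * d.m₀) * (d.σ (g τ) * v τ 1 ^ 2) := by
    rw [Data.energy]; ring
  rw [e, Data.boundaryConst]
  rw [abs_le] at *
  constructor <;> linarith [i1.1, i1.2, i2.1, i2.2, i3.1, i3.2, i4.1, i4.2]

/-- As long as the semi-discrete solution stays in a fixed neighbourhood of the data, it satisfies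
better bounds, if the time is short. Here `Q` bounds the energy, `R` the squared `H¹` seminorm and
`D` the dissipation; a displacement of at most `η` in `L²(0, 1)` moves the boundary values by less
than `1`, by `hηR` and the trace inequality. -/
theorem IsDiscreteSolution.improve_bounds {d : Data} {T₀ : ℝ} (hd : d.Admissible T₀) {M : Mesh}
    {L T : ℝ} {v : ℝ → ℝ → ℝ} {g B β : ℝ → ℝ} (hs : IsDiscreteSolution d M L T v g) (hT : 0 < T)
    (hB : IsPrimitiveOn 0 T B β) (hb : d.b =ᵐ[volume.restrict (Ioo 0 T)] B)
    {Kb S₀ S₁ U s₀ N Q R D η G : ℝ} (hKb : ∀ τ ∈ Icc 0 T, |B τ| ≤ Kb)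
    (hS₀ : ∀ x ∈ Icc (d.h₀ / 2) (2 * d.h₀), |d.σ x| ≤ S₀)
    (hS₁ : ∀ x ∈ Icc (d.h₀ / 2) (2 * d.h₀), |deriv d.σ x| ≤ S₁)
    (hv00 : |v 0 0| ≤ U) (hv01 : |v 0 1| ≤ U) (hs₀ : M.dirichlet (v 0) (v 0) ≤ s₀)
    (hN : ∫ τ in Ioo 0 T, |β τ| ≤ N) (hG : G = d.A₀ * (U + 1 + S₀ / d.m₀))
    (hQ : s₀ / (2 * d.h₀) + 2 * d.boundaryConst Kb S₀ (U + 1)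
      + d.growthConst S₁ G (U + 1) * (1 + N) = Q)
    (hQR : 4 * d.h₀ * Q < R) (hQD : 4 * Q / d.h₀ ≤ D) (hη : 0 < η)
    (hηR : η ^ 2 + 4 * (η * Real.sqrt R) < 1) {t : ℝ} (ht : t ∈ Icc 0 T)
    (sm1 : (1 + R) * t ≤ 1) (sm2 : G * t ≤ d.h₀ / 4) (sm3 : t * D ≤ η ^ 2)
    (hyp : ∀ τ ∈ Icc 0 t, M.dirichlet (v τ) (v τ) ≤ R ∧
      |v τ 0 - v 0 0| ≤ 1 ∧ |v τ 1 - v 0 1| ≤ 1 ∧ |g τ - d.h₀| ≤ d.h₀ / 2) :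
    DiscreteBounds d M T v g R G D t ∧ M.dirichlet (v t) (v t) < R ∧
      |v t 0 - v 0 0| < 1 ∧ |v t 1 - v 0 1| < 1 ∧ |g t - d.h₀| < d.h₀ / 2 := by
  have hh := hd.h₀_pos
  have hm := hd.m₀_pos
  have hA := hd.A₀_pos
  have htt : t ∈ Icc 0 t := right_mem_Icc.mpr ht.1
  have h0t : (0 : ℝ) ∈ Icc 0 t := left_mem_Icc.mpr ht.1
  have b0 : ∀ τ ∈ Icc 0 t, |v τ 0| ≤ U + 1 := fun τ hτ => by
    have := abs_sub_abs_le_abs_sub (v τ 0) (v 0 0)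
    linarith only [(hyp τ hτ).2.1, this, hv00]
  have b1 : ∀ τ ∈ Icc 0 t, |v τ 1| ≤ U + 1 := fun τ hτ => by
    have := abs_sub_abs_le_abs_sub (v τ 1) (v 0 1)
    linarith only [(hyp τ hτ).2.2.1, this, hv01]
  have bg : ∀ τ ∈ Icc 0 t, g τ ∈ Icc (d.h₀ / 2) (2 * d.h₀) := fun τ hτ => by
    have := abs_le.mp (hyp τ hτ).2.2.2
    exact ⟨by linarith only [this.1], by linarith only [this.2, hh]⟩
  have bG : ∀ τ ∈ Icc 0 t, |d.speed v g τ| ≤ G := fun τ hτ => by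
    rw [Data.speed, abs_mul, abs_of_pos hA, hG]
    refine mul_le_mul_of_nonneg_left ((abs_sub _ _).trans (add_le_add (b1 τ hτ) ?_)) hA.le
    rw [abs_div, abs_of_pos hm]
    exact div_le_div_of_nonneg_right (hS₀ _ (bg τ hτ)) hm.le
  have hC0 : 0 ≤ d.growthConst S₁ G (U + 1) := Data.growthConst_nonneg hd
    ((abs_nonneg _).trans (hS₁ _ (bg 0 h0t))) ((abs_nonneg _).trans (bG 0 h0t))
    ((abs_nonneg _).trans (b0 0 h0t))
  have en := hs.energy_le hT hd hB hb ht
    (fun τ hτ => (bg τ hτ).1) bG b0 b1 (fun τ hτ => hS₁ _ (bg τ hτ)) fun τ hτ => (hyp τ hτ).1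
  have hNt : ∫ τ in Ioo 0 t, |β τ| ≤ N :=
    (setIntegral_mono_set (hB.integrableOn hT.le).abs
      (Filter.Eventually.of_forall fun _ => abs_nonneg _)
      (LE.le.eventuallyLE (Ioo_subset_Ioo_right ht.2))).trans hN
  have c0 := (abs_le.mp (abs_energy_sub_le hd (M := M) (hKb 0 (left_mem_Icc.mpr hT.le))
    (b0 0 h0t) (b1 0 h0t) (hS₀ _ (bg 0 h0t)))).2
  have ct := (abs_le.mp (abs_energy_sub_le hd (M := M) (hKb t ht)
    (b0 t htt) (b1 t htt) (hS₀ _ (bg t htt)))).1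
  set Dt := ∫ τ in Ioo 0 t, l2Norm (discreteDeriv M T v τ) ^ 2 with hDt
  have hDt0 : 0 ≤ Dt := integral_nonneg fun _ => sq_nonneg _
  have hSt0 : 0 ≤ M.dirichlet (v t) (v t) := by
    rw [← Mesh.l2Norm_slope_sq]; exact sq_nonneg _
  have hgt := bg t htt
  have hgpos : 0 < g t := lt_of_lt_of_le (half_pos hh) hgt.1
  have hCN : d.growthConst S₁ G (U + 1) * ((1 + R) * t + ∫ τ in Ioo 0 t, |β τ|)
      ≤ d.growthConst S₁ G (U + 1) * (1 + N) :=
    mul_le_mul_of_nonneg_left (add_le_add sm1 hNt) hC0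
  have hinit : M.dirichlet (v 0) (v 0) / (2 * g 0) ≤ s₀ / (2 * d.h₀) := by
    rw [hs.h_init]
    exact div_le_div_of_nonneg_right hs₀ (by positivity)
  have main : M.dirichlet (v t) (v t) / (2 * g t) + d.h₀ / 4 * Dt ≤ Q := by
    linarith only [c0, ct, en, hCN, hinit, hQ]
  have hS : M.dirichlet (v t) (v t) < R := by
    have h1 : M.dirichlet (v t) (v t) / (2 * g t) ≤ Q := by
      have : 0 ≤ d.h₀ / 4 * Dt := by positivity
      linarith only [this, main]
    have hQ0 : 0 ≤ Q := le_trans (by positivity) h1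
    rw [div_le_iff₀ (by positivity)] at h1
    have h2 : Q * (2 * g t) ≤ Q * (2 * (2 * d.h₀)) := by
      gcongr
      exact hgt.2
    linarith only [h1, h2, hQR]
  have hDD : Dt ≤ D := by
    have h1 : 0 ≤ M.dirichlet (v t) (v t) / (2 * g t) := by positivity
    refine le_trans ?_ hQD
    rw [le_div_iff₀ hh]
    linarith only [h1, main]
  -- the boundary values move little, since the solution moves little in `L²`
  set z := fun y => v t y - v 0 y with hz
  have hzp : IsPrimitiveOn 0 1 z (M.slope z) :=
    Mesh.isPrimitiveOn_of_mem_V (Mesh.sub_mem_V (hs.uk_V t ht)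
      (hs.uk_V 0 (left_mem_Icc.mpr hT.le)))
  have hzL : l2Norm z ≤ η := by
    refine le_of_sq_le_sq ?_ hη.le
    refine (hs.l2Norm_sub_sq_le hT ht).trans (le_trans ?_ sm3)
    exact mul_le_mul_of_nonneg_left hDD ht.1
  have hroot : ∀ τ ∈ Icc 0 t, l2Norm (M.slope (v τ)) ≤ Real.sqrt R := fun τ hτ => by
    apply Real.le_sqrt_of_sq_le
    rw [Mesh.l2Norm_slope_sq]
    exact (hyp τ hτ).1
  have hzs : l2Norm (M.slope z) ≤ 2 * Real.sqrt R := by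
    rw [hz, Mesh.slope_sub]
    refine (l2Norm_sub_le (Mesh.isL2_slope _) (Mesh.isL2_slope _)).trans ?_
    linarith only [hroot t htt, hroot 0 h0t]
  have hz1 : ∀ x ∈ Icc (0 : ℝ) 1, |z x| < 1 := by
    intro x hx
    have h1 := hzp.sq_le (Mesh.isL2_slope z) hx
    have h2 : l2Norm z * l2Norm (M.slope z) ≤ η * (2 * Real.sqrt R) :=
      mul_le_mul hzL hzs (l2Norm_nonneg _) hη.le
    have h3 : l2Norm z ^ 2 ≤ η ^ 2 := pow_le_pow_left₀ (l2Norm_nonneg _) hzL 2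
    rw [← sq_lt_one_iff_abs_lt_one]
    linarith only [h1, h2, h3, hηR]
  have hgs := hs.abs_front_sub_le hT ht bG
  refine ⟨⟨hS.le, hgt.1, hgt.2, bG t htt, hDD⟩, hS,
    hz1 0 (left_mem_Icc.mpr zero_le_one), hz1 1 (right_mem_Icc.mpr zero_le_one), ?_⟩
  linarith only [hgs, sm2, hh]

/-- Uniform bounds: on a time interval that depends on the data only, the semi-discrete solutions
on all meshes satisfy the same bounds. -/
theorem exists_discreteBounds {d : Data} {T : ℝ} (hd : d.Admissible T) :
    ∃ That R G D : ℝ, 0 < That ∧ That ≤ T ∧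
      ∀ (M : Mesh) (L T' : ℝ), 0 < T' → T' ≤ T → ∀ (v : ℝ → ℝ → ℝ) (g : ℝ → ℝ),
        IsDiscreteSolution d M L T' v g → ∀ t ∈ Icc 0 (min That T'),
          DiscreteBounds d M T' v g R G D t := by
  have hT := hd.T_pos
  have hh := hd.h₀_pos
  have hBi := hd.Bi_pos
  have hm := hd.m₀_pos
  have hA := hd.A₀_pos
  have hH := hd.H_pos
  obtain ⟨B, hB, hb⟩ := (hd.b_mem.hasWeakDeriv 1).exists_ae_eq_primitive hT
    ((hd.b_mem.memLp_weakDeriv isOpen_Ioo 1).integrable (by norm_num))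
  obtain ⟨Kb, hKb⟩ := isCompact_Icc.exists_bound_of_continuousOn (hB.continuousOn hT.le)
  obtain ⟨U, hU⟩ := isCompact_Icc.exists_bound_of_continuousOn hd.u₀_cont
  obtain ⟨S₀, hS₀⟩ := (isCompact_Icc (a := d.h₀ / 2) (b := 2 * d.h₀)).exists_bound_of_continuousOn
    hd.σ_contDiff.continuous.continuousOn
  obtain ⟨S₁, hS₁⟩ := (isCompact_Icc (a := d.h₀ / 2) (b := 2 * d.h₀)).exists_bound_of_continuousOn
    (hd.σ_contDiff.continuous_deriv le_rfl).continuousOn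
  simp only [Real.norm_eq_abs] at hKb hU hS₀ hS₁
  have hmid : d.h₀ ∈ Icc (d.h₀ / 2) (2 * d.h₀) := ⟨by linarith, by linarith⟩
  have hS₀0 : 0 ≤ S₀ := (abs_nonneg _).trans (hS₀ _ hmid)
  have hS₁0 : 0 ≤ S₁ := (abs_nonneg _).trans (hS₁ _ hmid)
  have hU0 : 0 ≤ U := (abs_nonneg _).trans (hU 0 (left_mem_Icc.mpr zero_le_one))
  have hKb0 : 0 ≤ Kb := (abs_nonneg _).trans (hKb 0 (left_mem_Icc.mpr hT.le))
  have hG0 : 0 < d.A₀ * (U + 1 + S₀ / d.m₀) := by positivity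
  obtain ⟨G, hG⟩ : ∃ G, G = d.A₀ * (U + 1 + S₀ / d.m₀) := ⟨_, rfl⟩
  rw [← hG] at hG0
  have hN0 : 0 ≤ ∫ τ in Ioo 0 T, |weakDeriv (Ioo 0 T) 1 d.b τ| :=
    integral_nonneg fun _ => abs_nonneg _
  obtain ⟨N, hN⟩ : ∃ N, ∫ τ in Ioo 0 T, |weakDeriv (Ioo 0 T) 1 d.b τ| = N := ⟨_, rfl⟩
  rw [hN] at hN0
  have hCF0 : 0 ≤ d.boundaryConst Kb S₀ (U + 1) := by
    unfold Data.boundaryConst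
    positivity
  have hC0 : 0 ≤ d.growthConst S₁ G (U + 1) :=
    Data.growthConst_nonneg hd hS₁0 hG0.le (by linarith)
  obtain ⟨s₀, hs₀⟩ : ∃ s₀, s₀ = l2Norm (wd 0 1 d.u₀) ^ 2 := ⟨_, rfl⟩
  have hs₀0 : 0 ≤ s₀ := hs₀ ▸ sq_nonneg _
  obtain ⟨Q, hQ⟩ : ∃ Q, s₀ / (2 * d.h₀) + 2 * d.boundaryConst Kb S₀ (U + 1)
      + d.growthConst S₁ G (U + 1) * (1 + N) = Q := ⟨_, rfl⟩
  have hCN : 0 ≤ d.growthConst S₁ G (U + 1) * (1 + N) := by positivity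
  have hsQ : s₀ / (2 * d.h₀) ≤ Q := by linarith only [hCN, hCF0, hQ]
  have hQ0 : 0 ≤ Q := le_trans (by positivity) hsQ
  -- `4 h₀ Q` bounds the squared `H¹` seminorm, since `g ≤ 2 h₀`; the bound `R` is strictly larger
  obtain ⟨R, hR⟩ : ∃ R, R = 4 * d.h₀ * Q + 1 := ⟨_, rfl⟩
  have hhQ : 0 ≤ d.h₀ * Q := by positivity
  have hR0 : 0 < R := by linarith only [hR, hhQ]
  have hs₀R : s₀ < R := by
    rw [div_le_iff₀ (by positivity)] at hsQ
    linarith only [hsQ, hR, hhQ]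
  obtain ⟨D, hD⟩ : ∃ D, 4 * Q / d.h₀ = D := ⟨_, rfl⟩
  have hD0 : 0 ≤ D := hD ▸ by positivity
  obtain ⟨η, hη⟩ : ∃ η, η = 1 / (2 + 4 * Real.sqrt R) := ⟨_, rfl⟩
  have hsR := Real.sqrt_nonneg R
  have hη0 : 0 < η := by rw [hη]; positivity
  have hηR : η ^ 2 + 4 * (η * Real.sqrt R) < 1 := by
    have h4 : η * (2 + 4 * Real.sqrt R) = 1 := by rw [hη]; field_simp
    have h5 : 0 ≤ η * Real.sqrt R := by positivity
    have h6 : η ^ 2 ≤ η * 1 := by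
      rw [sq]
      exact mul_le_mul_of_nonneg_left (by linarith only [h4, h5]) hη0.le
    linarith only [h4, h6, hη0]
  refine ⟨min T (min (1 / (1 + R)) (min (d.h₀ / (4 * G)) (η ^ 2 / (D + 1)))), R, G, D,
    ?_, min_le_left _ _, ?_⟩
  · refine lt_min hT (lt_min ?_ (lt_min ?_ ?_)) <;> positivity
  intro M L T' hT' hT'T v g hs
  set t₁ := min (min T (min (1 / (1 + R)) (min (d.h₀ / (4 * G)) (η ^ 2 / (D + 1))))) T' with ht₁
  have ht₁T' : t₁ ≤ T' := min_le_right _ _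
  have hB' := hB.mono le_rfl hT'.le hT'T
  have hb' : d.b =ᵐ[volume.restrict (Ioo 0 T')] B :=
    ae_restrict_of_ae_restrict_of_subset (Ioo_subset_Ioo_right hT'T) hb
  have hsmall : ∀ t ∈ Icc 0 t₁, (1 + R) * t ≤ 1 ∧ G * t ≤ d.h₀ / 4 ∧ t * D ≤ η ^ 2 := by
    intro t ht
    have h1 := ht.2.trans (min_le_left _ _)
    have h2 : t ≤ 1 / (1 + R) := h1.trans ((min_le_right _ _).trans (min_le_left _ _))
    have h3 : t ≤ d.h₀ / (4 * G) :=
      h1.trans ((min_le_right _ _).trans ((min_le_right _ _).trans (min_le_left _ _)))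
    have h4 : t ≤ η ^ 2 / (D + 1) :=
      h1.trans ((min_le_right _ _).trans ((min_le_right _ _).trans (min_le_right _ _)))
    rw [le_div_iff₀ (by positivity)] at h2 h3 h4
    exact ⟨by linarith only [h2], by linarith only [h3], by linarith only [h4, ht.1]⟩
  have hu0 : ∀ j, v 0 (M.node j) = d.u₀ (M.node j) := hs.u_init.2
  have hv00 : |v 0 0| ≤ U := by
    have := hu0 0
    rw [M.node_zero] at this
    rw [this]; exact hU 0 (left_mem_Icc.mpr zero_le_one)
  have hv01 : |v 0 1| ≤ U := by
    have := hu0 (Fin.last _)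
    rw [M.node_last] at this
    rw [this]; exact hU 1 (right_mem_Icc.mpr zero_le_one)
  have hS0 : M.dirichlet (v 0) (v 0) ≤ s₀ := by
    rw [Mesh.dirichlet_congr hu0 hu0, ← Mesh.l2Norm_slope_sq, hs₀]
    have hp := hd.u₀_mem.1.isPrimitiveOn zero_lt_one (by norm_num) hd.u₀_cont
    exact pow_le_pow_left₀ (l2Norm_nonneg _)
      (Mesh.l2Norm_slope_le hp (hd.u₀_mem.1.memLp_weakDeriv isOpen_Ioo 1)) 2
  have hNt : ∫ τ in Ioo 0 T', |weakDeriv (Ioo 0 T) 1 d.b τ| ≤ N :=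
    (setIntegral_mono_set (hB.integrableOn hT.le).abs
      (Filter.Eventually.of_forall fun _ => abs_nonneg _)
      (LE.le.eventuallyLE (Ioo_subset_Ioo_right hT'T))).trans hN.le
  have improve : ∀ t ∈ Icc 0 t₁, (∀ τ ∈ Icc 0 t, M.dirichlet (v τ) (v τ) ≤ R ∧
      |v τ 0 - v 0 0| ≤ 1 ∧ |v τ 1 - v 0 1| ≤ 1 ∧ |g τ - d.h₀| ≤ d.h₀ / 2) →
      DiscreteBounds d M T' v g R G D t ∧ M.dirichlet (v t) (v t) < R ∧
        |v t 0 - v 0 0| < 1 ∧ |v t 1 - v 0 1| < 1 ∧ |g t - d.h₀| < d.h₀ / 2 := by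
    intro t ht
    obtain ⟨sm1, sm2, sm3⟩ := hsmall t ht
    exact hs.improve_bounds hd hT' hB' hb' (fun τ hτ => hKb τ ⟨hτ.1, hτ.2.trans hT'T⟩) hS₀ hS₁
      hv00 hv01 hS0 hNt hG hQ (by linarith only [hR]) hD.le hη0 hηR ⟨ht.1, ht.2.trans ht₁T'⟩
      sm1 sm2 sm3
  have hI : Icc 0 t₁ ⊆ Icc 0 T' := Icc_subset_Icc_right ht₁T'
  have hdir : ContinuousOn (fun τ => M.dirichlet (v τ) (v τ)) (Icc 0 T') :=
    (Mesh.isPrimitiveOn_dirichlet hT'.le fun z hz =>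
      hs.isPrimitiveOn_discreteDeriv hT' hz).continuousOn hT'.le
  -- the solution is in the neighbourhood when the following maximum is negative
  have hcont : ContinuousOn (fun τ => max (max (M.dirichlet (v τ) (v τ) - R)
      (|v τ 0 - v 0 0| - 1)) (max (|v τ 1 - v 0 1| - 1) (|g τ - d.h₀| - d.h₀ / 2)))
      (Icc 0 t₁) := by
    refine ContinuousOn.mono ?_ hI
    have c0 := hs.uk_cont 0 (left_mem_Icc.mpr zero_le_one)
    have c1 := hs.uk_cont 1 (right_mem_Icc.mpr zero_le_one)
    have cg := hs.h_cont
    fun_prop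
  have hboot := lt_zero_of_bootstrap hcont (by
    simp only [max_lt_iff, sub_self, abs_zero, hs.h_init]
    exact ⟨⟨by linarith only [hS0, hs₀R], by norm_num⟩, by norm_num, by linarith only [hh]⟩)
    fun t ht hle => by
      simp only [max_le_iff, sub_nonpos] at hle
      have := (improve t ht fun τ hτ => ⟨(hle τ hτ).1.1, (hle τ hτ).1.2, (hle τ hτ).2.1,
        (hle τ hτ).2.2⟩).2
      simp only [max_lt_iff, sub_neg]
      exact ⟨⟨this.1, this.2.1⟩, this.2.2.1, this.2.2.2⟩
  simp only [max_lt_iff, sub_neg] at hboot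
  intro t ht
  refine (improve t ht fun τ hτ => ?_).1
  have := hboot τ ⟨hτ.1, hτ.2.trans ht.2⟩
  exact ⟨this.1.1.le, this.1.2.le, this.2.1.le, this.2.2.le⟩

/-! ### Regularity of the continuous solution -/

/-- The bounds on a weak solution at time `τ` that enter the error estimate. The bound `interp_le`
reflects that the second space derivative of `u` is controlled by its time derivative. -/
structure SolutionBounds (d : Data) (T : ℝ) (u : ℝ → ℝ → ℝ) (h : ℝ → ℝ) (K τ : ℝ) : Prop where
  isL2_timeDeriv : IsL2 (timeDeriv T u τ)
  isPrimitiveOn : IsPrimitiveOn 0 1 (u τ) (wd 0 1 (u τ))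
  isL2_wd : IsL2 (wd 0 1 (u τ))
  l2Norm_wd_le : l2Norm (wd 0 1 (u τ)) ≤ K
  interp_le : ∀ M : Mesh, l2Norm (fun y => wd 0 1 (u τ) y - M.slope (u τ) y)
    ≤ M.size * (K * (1 + l2Norm (timeDeriv T u τ)))
  abs_one_le : |u τ 1| ≤ K
  front_pos : 0 < h τ
  front_le : h τ ≤ K
  inv_front_le : (h τ)⁻¹ ≤ K
  speed_le : |d.speed u h τ| ≤ K

theorem SolutionBounds.mono {d : Data} {T : ℝ} {u : ℝ → ℝ → ℝ} {h : ℝ → ℝ} {K K' τ : ℝ}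
    (hb : SolutionBounds d T u h K τ) (hK : K ≤ K') : SolutionBounds d T u h K' τ := by
  refine ⟨hb.isL2_timeDeriv, hb.isPrimitiveOn, hb.isL2_wd, hb.l2Norm_wd_le.trans hK,
    fun M => (hb.interp_le M).trans ?_, hb.abs_one_le.trans hK, hb.front_pos,
    hb.front_le.trans hK, hb.inv_front_le.trans hK, hb.speed_le.trans hK⟩
  have h1 := l2Norm_nonneg (timeDeriv T u τ)
  have h2 := M.size_pos.le
  gcongr

namespace IsWeakSolution

variable {d : Data} {L T : ℝ} {u : ℝ → ℝ → ℝ} {h : ℝ → ℝ}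

theorem isPrimitiveOn_front (hs : IsWeakSolution d L T u h) (hT : 0 < T) :
    IsPrimitiveOn 0 T h (d.speed u h) :=
  RubberFEM.isPrimitiveOn_front hT hs.h_cont hs.h_mem hs.front_eq

theorem memLp_timeDeriv (hs : IsWeakSolution d L T u h) :
    MemLp (Function.uncurry (timeDeriv T u)) 2 (volume.restrict (cyl T)) :=
  hs.u_mem.memLp_weakDeriv (isOpen_cyl T) (1, 0)

theorem integrableOn_timeDeriv (hs : IsWeakSolution d L T u h) :
    IntegrableOn (Function.uncurry (timeDeriv T u)) (cyl T) := by
  have hfin : IsFiniteMeasure ((volume : Measure (ℝ × ℝ)).restrict (cyl T)) := by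
    rw [volume_restrict_cyl]; infer_instance
  exact hs.memLp_timeDeriv.integrable (by norm_num)

theorem ae_isPrimitiveOn_timeDeriv (hs : IsWeakSolution d L T u h) (hT : 0 < T) :
    ∀ᵐ y ∂(volume.restrict (Ioo (0 : ℝ) 1)),
      IsPrimitiveOn 0 T (fun τ => u τ y) (fun τ => timeDeriv T u τ y) :=
  HasWeakDeriv.ae_isPrimitiveOn hT hs.u_cont (hs.u_mem.hasWeakDeriv (1, 0))
    hs.integrableOn_timeDeriv

theorem ae_isL2_timeDeriv (hs : IsWeakSolution d L T u h) :
    ∀ᵐ τ ∂(volume.restrict (Ioo 0 T)), IsL2 (timeDeriv T u τ) := by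
  have h1 := hs.memLp_timeDeriv.integrable_sq
  have h2 := hs.memLp_timeDeriv.1
  rw [volume_restrict_cyl] at h1 h2
  filter_upwards [h1.prod_right_ae, h2.prodMk_left] with τ h3 h4
  exact (memLp_two_iff_integrable_sq h4).mpr h3

theorem integrableOn_l2Norm_sq (hs : IsWeakSolution d L T u h) :
    IntegrableOn (fun τ => l2Norm (timeDeriv T u τ) ^ 2) (Ioo 0 T) := by
  have := IntegrableOn.integral_cyl (T := T) hs.memLp_timeDeriv.integrable_sq
  simp only [Function.uncurry_apply_pair] at this
  simpa only [l2Norm_sq] using this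

theorem exists_wd_bound (hs : IsWeakSolution d L T u h) :
    ∃ P, ∀ᵐ τ ∂(volume.restrict (Ioo 0 T)), IsPrimitiveOn 0 1 (u τ) (wd 0 1 (u τ)) ∧
      IsL2 (wd 0 1 (u τ)) ∧ l2Norm (wd 0 1 (u τ)) ≤ P := by
  obtain ⟨-, C, hC⟩ := hs.u_mem_Linfty_H1
  refine ⟨Real.sqrt C, ?_⟩
  filter_upwards [hC, ae_restrict_mem measurableSet_Ioo] with τ hτ hτI
  have hm : MemW1 2 (Ioo 0 1) (u τ) := by
    by_contra hcon
    rw [h1NormSq, if_neg hcon] at hτ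
    exact absurd hτ (by simp)
  have h2 : IsL2 (wd 0 1 (u τ)) := hm.memLp_weakDeriv isOpen_Ioo 1
  refine ⟨hm.isPrimitiveOn zero_lt_one (by norm_num)
    (ContinuousOn.slice hs.u_cont (Ioo_subset_Icc_self hτI)), h2, ?_⟩
  rw [h1NormSq, if_pos hm] at hτ
  have h3 : l2NormSq 0 1 (wd 0 1 (u τ)) ≤ C := le_add_self.trans hτ
  rw [l2NormSq_eq h2] at h3
  exact Real.sqrt_le_sqrt (ENNReal.ofReal_le_coe.mp h3)

/-- By the equation, the second space derivative of the solution is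
`h² (∂u/∂τ - (h'/h) y ∂u/∂y)`. -/
theorem ae_hasWeakDeriv_wd (hs : IsWeakSolution d L T u h) :
    ∀ᵐ τ ∂(volume.restrict (Ioo 0 T)), HasWeakDeriv (Ioo 0 1) 1 (wd 0 1 (u τ))
      (fun y => h τ ^ 2 * (timeDeriv T u τ y
        - d.speed u h τ / h τ * (y * wd 0 1 (u τ) y))) := by
  obtain ⟨P, hP⟩ := hs.exists_wd_bound
  filter_upwards [hs.weak_eq, hs.front_eq, hP, hs.ae_isL2_timeDeriv,
    ae_restrict_mem measurableSet_Ioo] with τ h1 h2 h3 h4 hτ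
  have hpos := hs.h_pos τ (Ioo_subset_Icc_self hτ)
  have i1 := h4.integrable (by norm_num : (1 : ℝ≥0∞) ≤ 2)
  have i2 := (isL2_id_mul h3.2.1).integrable (by norm_num : (1 : ℝ≥0∞) ≤ 2)
  have i3 := h3.2.1.integrable (by norm_num : (1 : ℝ≥0∞) ≤ 2)
  have i4 : IntegrableOn (fun y => h τ ^ 2 * (timeDeriv T u τ y
        - d.speed u h τ / h τ * (y * wd 0 1 (u τ) y))) (Ioo 0 1) :=
    (i1.sub (i2.const_mul _)).const_mul _
  refine ⟨IntegrableOn.locallyIntegrableOn i3, i4.locallyIntegrableOn, fun φ hφ hφc hφs => ?_⟩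
  have hφp : IsPrimitiveOn 0 1 φ (deriv φ) :=
    IsPrimitiveOn.of_hasDerivAt hφ.continuous.continuousOn countable_empty
      (fun t _ => (hφ.differentiable (by simp) t).hasDerivAt)
      ((hφ.continuous_deriv (by simp)).intervalIntegrable _ _)
  have hφ2 : IsL2 (deriv φ) :=
    isL2_of_continuousOn (hφ.continuous_deriv (by simp)).continuousOn
  have e := h1 φ hφ.continuous.continuousOn (hφp.memW1 zero_le_one hφ2)
  have f0 : φ 0 = 0 := image_eq_zero_of_notMem_tsupport fun hm => lt_irrefl _ (hφs hm).1
  have f1 : φ 1 = 0 := image_eq_zero_of_notMem_tsupport fun hm => lt_irrefl _ (hφs hm).2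
  have e1 : ∫ y in Ioo (0 : ℝ) 1, wd 0 1 (u τ) y * wd 0 1 φ y
      = ∫ y in Ioo (0 : ℝ) 1, wd 0 1 (u τ) y * deriv φ y :=
    integral_congr_ae ((hφp.wd_ae_eq zero_le_one).mono fun y hy => by simp only [hy])
  rw [weakForm, f0, f1, e1, h2] at e
  have j1 : IntegrableOn (fun y => timeDeriv T u τ y * φ y) (Ioo 0 1) :=
    integrableOn_mul_of_tsupport_subset (IntegrableOn.locallyIntegrableOn i1) hφ.continuous hφc hφs
  have j2 : IntegrableOn (fun y => y * wd 0 1 (u τ) y * φ y) (Ioo 0 1) :=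
    integrableOn_mul_of_tsupport_subset (IntegrableOn.locallyIntegrableOn i2) hφ.continuous hφc hφs
  have e2 : ∫ y in Ioo (0 : ℝ) 1, h τ ^ 2 * (timeDeriv T u τ y
        - d.speed u h τ / h τ * (y * wd 0 1 (u τ) y)) * φ y
      = h τ ^ 2 * ((∫ y in Ioo (0 : ℝ) 1, timeDeriv T u τ y * φ y)
        - d.speed u h τ / h τ * ∫ y in Ioo (0 : ℝ) 1, y * wd 0 1 (u τ) y * φ y) := by
    rw [← integral_const_mul (d.speed u h τ / h τ), ← integral_sub j1 (j2.const_mul _),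
      ← integral_const_mul]
    congr 1; funext y; ring
  simp only [fderiv_apply_one_eq_deriv]
  rw [e2]
  have e3 : d.speed u h τ = d.A₀ * (u τ 1 - d.σ (h τ) / d.m₀) := rfl
  rw [← e3] at e
  simp only [mul_zero, sub_zero, add_zero] at e
  field_simp at e ⊢
  linarith

/-- The weak formulation tested with finite element functions. -/
theorem weak_form (hs : IsWeakSolution d L T u h) (M : Mesh) :
    ∀ᵐ τ ∂(volume.restrict (Ioo 0 T)), ∀ φ ∈ M.V,
      (∫ y in Ioo (0 : ℝ) 1, timeDeriv T u τ y * φ y)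
        - d.speed u h τ / h τ * (∫ y in Ioo (0 : ℝ) 1, y * wd 0 1 (u τ) y * φ y)
        + 1 / h τ ^ 2 * M.dirichlet (u τ) φ
        - 1 / h τ * d.Bi * (d.b τ / d.m₀ - d.H * u τ 0) * φ 0
        + d.speed u h τ / h τ * u τ 1 * φ 1 = 0 := by
  obtain ⟨P, hP⟩ := hs.exists_wd_bound
  filter_upwards [hs.weak_eq, hs.front_eq, hP] with τ h1 h2 h3 φ hφ
  have h4 := h1 φ hφ.1 (Mesh.memW1_of_mem_V hφ)
  have e : ∫ y in Ioo (0 : ℝ) 1, wd 0 1 (u τ) y * wd 0 1 φ y = M.dirichlet (u τ) φ := by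
    rw [← Mesh.integral_mul_slope h3.1]
    exact integral_congr_ae (((Mesh.isPrimitiveOn_of_mem_V hφ).wd_ae_eq zero_le_one).mono
      fun y hy => by simp only [hy])
  rw [weakForm, e, h2] at h4
  exact h4

theorem exists_solutionBounds (hs : IsWeakSolution d L T u h) (hT : 0 < T)
    (hσ : ContDiff ℝ 1 d.σ) :
    ∃ K, ∀ᵐ τ ∂(volume.restrict (Ioo 0 T)), SolutionBounds d T u h K τ := by
  obtain ⟨P, hP⟩ := hs.exists_wd_bound
  obtain ⟨U, hU⟩ := ContinuousOn.bound_cyl hs.u_cont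
  have h0 : (0 : ℝ) ∈ Icc (0 : ℝ) 1 := left_mem_Icc.mpr zero_le_one
  have h1 : (1 : ℝ) ∈ Icc (0 : ℝ) 1 := right_mem_Icc.mpr zero_le_one
  obtain ⟨H₁, hH₁⟩ := isCompact_Icc.exists_bound_of_continuousOn hs.h_cont
  obtain ⟨H₂, hH₂⟩ := isCompact_Icc.exists_bound_of_continuousOn
    (hs.h_cont.inv₀ fun t ht => (hs.h_pos t ht).ne')
  obtain ⟨G, hG⟩ := isCompact_Icc.exists_bound_of_continuousOn
    (continuousOn_speed hσ (ContinuousOn.slice_time hs.u_cont h1) hs.h_cont)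
  simp only [Real.norm_eq_abs] at hH₁ hH₂ hG
  have hz : (0 : ℝ) ∈ Icc 0 T := left_mem_Icc.mpr hT.le
  have nH₁ : 0 ≤ H₁ := (abs_nonneg _).trans (hH₁ 0 hz)
  have nH₂ : 0 ≤ H₂ := (abs_nonneg _).trans (hH₂ 0 hz)
  have nU : 0 ≤ U := (abs_nonneg _).trans (hU 0 hz 0 h0)
  have nG : 0 ≤ G := (abs_nonneg _).trans (hG 0 hz)
  refine ⟨max P 0 + U + H₁ + H₂ + G + H₁ ^ 2 * (1 + G * H₂ * max P 0), ?_⟩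
  have nP : 0 ≤ max P 0 := le_max_right _ _
  filter_upwards [hP, hs.ae_isL2_timeDeriv, hs.ae_hasWeakDeriv_wd,
    ae_restrict_mem measurableSet_Ioo] with τ ⟨p1, p2, p3⟩ h2 h3 hτ
  have hτI := Ioo_subset_Icc_self hτ
  have hpos := hs.h_pos τ hτI
  have p3' : l2Norm (wd 0 1 (u τ)) ≤ max P 0 := p3.trans (le_max_left _ _)
  have bh : h τ ≤ H₁ := (le_abs_self _).trans (hH₁ τ hτI)
  have bi : (h τ)⁻¹ ≤ H₂ := (le_abs_self _).trans (hH₂ τ hτI)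
  have n1 : 0 ≤ H₁ ^ 2 * (1 + G * H₂ * max P 0) := by positivity
  refine ⟨h2, p1, p2, by linarith, fun M => ?_, by linarith [hU τ hτI 1 h1], hpos, by linarith,
    by linarith, by linarith [hG τ hτI]⟩
  set q : ℝ → ℝ := fun y => h τ ^ 2 * (timeDeriv T u τ y
        - d.speed u h τ / h τ * (y * wd 0 1 (u τ) y)) with hq
  have hy := isL2_id_mul p2
  have hyc : IsL2 (fun y => d.speed u h τ / h τ * (y * wd 0 1 (u τ) y)) := hy.const_mul _
  have hq2 : IsL2 q := (h2.sub hyc).const_mul _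
  obtain ⟨p, hp, hpe⟩ := h3.exists_ae_eq_primitive zero_lt_one (hq2.integrable (by norm_num))
  have hup : IsPrimitiveOn 0 1 (u τ) p := p1.congr zero_le_one (fun _ _ => rfl) hpe
  have e1 : l2Norm (fun y => wd 0 1 (u τ) y - M.slope (u τ) y)
      = l2Norm (fun y => p y - M.slope (u τ) y) :=
    l2Norm_congr (hpe.mono fun y hy => by simp only [hy])
  rw [e1]
  refine (Mesh.l2Norm_sub_slope_le hup hp hq2).trans ?_
  refine mul_le_mul_of_nonneg_left ?_ M.size_pos.le
  have nw := l2Norm_nonneg (timeDeriv T u τ)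
  have np := l2Norm_nonneg (wd 0 1 (u τ))
  have e2 : l2Norm q ≤ H₁ ^ 2 * (l2Norm (timeDeriv T u τ) + G * H₂ * max P 0) := by
    rw [hq, l2Norm_const_mul, abs_of_nonneg (sq_nonneg _)]
    have e3 : |d.speed u h τ / h τ| ≤ G * H₂ := by
      rw [abs_div, abs_of_pos hpos, div_eq_mul_inv]
      have := hG τ hτI
      have := inv_nonneg.mpr hpos.le
      gcongr
    have e4 : l2Norm (fun y => timeDeriv T u τ y
        - d.speed u h τ / h τ * (y * wd 0 1 (u τ) y))
        ≤ l2Norm (timeDeriv T u τ) + G * H₂ * max P 0 := by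
      refine (l2Norm_sub_le h2 hyc).trans ?_
      rw [l2Norm_const_mul]
      have := l2Norm_nonneg (fun y => y * wd 0 1 (u τ) y)
      gcongr
      exact (l2Norm_id_mul_le p2).trans p3'
    have := l2Norm_nonneg (fun y => timeDeriv T u τ y
        - d.speed u h τ / h τ * (y * wd 0 1 (u τ) y))
    gcongr
  refine e2.trans ?_
  have n2 : 0 ≤ G * H₂ * max P 0 := by positivity
  have n3 : H₁ ^ 2 * (l2Norm (timeDeriv T u τ) + G * H₂ * max P 0)
      ≤ H₁ ^ 2 * (1 + G * H₂ * max P 0) * (1 + l2Norm (timeDeriv T u τ)) := by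
    have : H₁ ^ 2 * (1 + G * H₂ * max P 0) * (1 + l2Norm (timeDeriv T u τ))
        - H₁ ^ 2 * (l2Norm (timeDeriv T u τ) + G * H₂ * max P 0)
        = H₁ ^ 2 * (1 + G * H₂ * max P 0 * l2Norm (timeDeriv T u τ)) := by ring
    have h5 : 0 ≤ H₁ ^ 2 * (1 + G * H₂ * max P 0 * l2Norm (timeDeriv T u τ)) := by positivity
    linarith
  refine n3.trans (mul_le_mul_of_nonneg_right ?_ (by linarith))
  linarith

end IsWeakSolution

/-! ### The error inequality at a fixed time -/

/-- The constant of the error inequality, in terms of a common bound `K` for all data. -/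
def errConst (K : ℝ) : ℝ := 4 * (6 * (2 * K ^ 4) + 81 * (2 * K ^ 4) ^ 2 * K ^ 2)

/-- The algebra behind the error inequality. Here `X = (∂e/∂τ, e)` and `Y = (∂e/∂τ, u - I_k u)`,
`i` and `j` are the inverses of the front positions, `p` and `q` the speeds of the fronts, `ε` the
error of the front position, `B₁` and `B₂` the two convection terms, and `P₁ = (∂u/∂y, ∂θ/∂y)`. The
norms of `θ = I_k u - u_k` and of its derivative are `th` and `s`, and that of `∂(u - I_k u)/∂y` is
`π`. The boundary values of `u` are `u₀` and `u₁`, those of the error `e₀` and `e₁`. -/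
theorem error_algebra {K i j p q ε X Y B₁ B₂ P₁ s th π u₀ u₁ e₀ e₁ β₀ Bi H : ℝ}
    (hK : 1 ≤ K) (hi : 0 < i) (hj : 0 < j) (hiK : i ≤ K) (hjK : j ≤ K) (hjK' : K⁻¹ ≤ j)
    (hp : |p| ≤ K) (hij : i - j = -(ε * i * j)) (hpq : |p - q| ≤ K * (|e₁| + |ε|))
    (hq : |q| ≤ K) (hP₁ : |P₁| ≤ K * s) (hB₂ : |B₂| ≤ K * th) (hB : |B₁ - B₂| ≤ (π + s) * th)
    (hs : 0 ≤ s) (hth : 0 ≤ th) (hπ : 0 ≤ π) (hu₁ : |u₁| ≤ K) (hBi : 0 ≤ Bi) (hH : 0 ≤ H)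
    (hβ : |Bi * (β₀ - H * u₀)| ≤ K) (he₀ : e₀ ^ 2 ≤ th ^ 2 + 2 * (th * s))
    (he₁ : e₁ ^ 2 ≤ th ^ 2 + 2 * (th * s))
    (heq : (X - Y) - (p * i * B₁ - q * j * B₂) + ((i ^ 2 - j ^ 2) * P₁ + j ^ 2 * s ^ 2)
      - Bi * (i * (β₀ - H * u₀) - j * (β₀ - H * (u₀ - e₀))) * e₀
      + (p * i * u₁ - q * j * (u₁ - e₁)) * e₁ = 0) :
    2 * X + 2 * (ε * (p - q)) + s ^ 2 / K ^ 2
      ≤ 2 * Y + 2 * K ^ 4 * π ^ 2 + errConst K / 2 * (th ^ 2 + ε ^ 2) := by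
  have hK0 : 0 < K := by linarith
  set x := |e₁| with hx
  set z := |e₀| with hz
  set δ := |ε| with hδ
  have nx : 0 ≤ x := abs_nonneg _
  have nz : 0 ≤ z := abs_nonneg _
  have nδ : 0 ≤ δ := abs_nonneg _
  have ex : x ^ 2 = e₁ ^ 2 := sq_abs _
  have ez : z ^ 2 = e₀ ^ 2 := sq_abs _
  have eδ : δ ^ 2 = ε ^ 2 := sq_abs _
  set κ := 2 * K ^ 4 with hκ
  have k24 : K ^ 2 ≤ K ^ 4 := pow_le_pow_right₀ hK (by norm_num)
  have k34 : K ^ 3 ≤ K ^ 4 := pow_le_pow_right₀ hK (by norm_num)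
  have k14 : K ≤ K ^ 4 := le_self_pow₀ hK (by norm_num)
  have k40 : 0 < K ^ 4 := by positivity
  -- differences of the coefficients
  have d1 : |i - j| ≤ K ^ 2 * δ := by
    rw [hij, abs_neg, abs_mul, abs_mul, abs_of_pos hi, abs_of_pos hj]
    have : δ * i * j ≤ δ * K * K := by gcongr
    linarith
  have d2 : |p * i - q * j| ≤ 2 * K ^ 3 * (x + δ) := by
    have e : p * i - q * j = (p - q) * i + q * (i - j) := by ring
    have a1 : |(p - q) * i| ≤ K * (x + δ) * K := by
      rw [abs_mul, abs_of_pos hi]; gcongr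
    have a2 : |q * (i - j)| ≤ K * (K ^ 2 * δ) := by
      rw [abs_mul]; gcongr
    have a3 : K ^ 2 * (x + δ) ≤ K ^ 3 * (x + δ) :=
      mul_le_mul_of_nonneg_right (pow_le_pow_right₀ hK (by norm_num)) (by positivity)
    have a4 : 0 ≤ K ^ 3 * x := by positivity
    rw [e]
    refine (abs_add_le _ _).trans ?_
    nlinarith only [a1, a2, a3, a4]
  -- the four groups of terms
  have t1 : p * i * B₁ - q * j * B₂ ≤ κ * ((π + s) * th + (x + δ) * th) := by
    have e : p * i * B₁ - q * j * B₂ = p * i * (B₁ - B₂) + (p * i - q * j) * B₂ := by ring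
    have a1 : p * i * (B₁ - B₂) ≤ K * K * ((π + s) * th) := by
      refine (le_abs_self _).trans ?_
      rw [abs_mul, abs_mul, abs_of_pos hi]; gcongr
    have a2 : (p * i - q * j) * B₂ ≤ 2 * K ^ 3 * (x + δ) * (K * th) := by
      refine (le_abs_self _).trans ?_
      rw [abs_mul]; gcongr
    have a3 : K * K * ((π + s) * th) ≤ κ * ((π + s) * th) :=
      mul_le_mul_of_nonneg_right (by linarith only [k24, k40, hκ, sq K]) (by positivity)
    rw [e, hκ]
    rw [hκ] at a3
    linarith only [a1, a2, a3]
  have t2 : -((i ^ 2 - j ^ 2) * P₁) ≤ κ * (δ * s) := by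
    have e : (i ^ 2 - j ^ 2) * P₁ = (i - j) * (i + j) * P₁ := by ring
    refine (neg_le_abs _).trans ?_
    rw [e, abs_mul, abs_mul, abs_of_pos (add_pos hi hj)]
    have : |i - j| * (i + j) * |P₁| ≤ K ^ 2 * δ * (K + K) * (K * s) := by gcongr
    rw [hκ]
    linarith only [this]
  have t3 : Bi * (i * (β₀ - H * u₀) - j * (β₀ - H * (u₀ - e₀))) * e₀ ≤ κ * (δ * z) := by
    have e : Bi * (i * (β₀ - H * u₀) - j * (β₀ - H * (u₀ - e₀))) * e₀
        = (i - j) * (Bi * (β₀ - H * u₀)) * e₀ - Bi * H * j * e₀ ^ 2 := by ring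
    have a1 : (i - j) * (Bi * (β₀ - H * u₀)) * e₀ ≤ K ^ 2 * δ * K * z := by
      refine (le_abs_self _).trans ?_
      rw [abs_mul, abs_mul]; gcongr
    have a2 : 0 ≤ Bi * H * j * e₀ ^ 2 := by positivity
    have a3 : K ^ 3 * (δ * z) ≤ κ * (δ * z) :=
      mul_le_mul_of_nonneg_right (by linarith only [k34, k40, hκ]) (by positivity)
    rw [e]
    linarith only [a1, a2, a3]
  have t4 : -((p * i * u₁ - q * j * (u₁ - e₁)) * e₁) ≤ κ * ((x + δ) * x + x ^ 2) := by
    have e : (p * i * u₁ - q * j * (u₁ - e₁)) * e₁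
        = (p * i - q * j) * u₁ * e₁ + q * j * e₁ ^ 2 := by ring
    have a1 : -((p * i - q * j) * u₁ * e₁) ≤ 2 * K ^ 3 * (x + δ) * K * x := by
      refine (neg_le_abs _).trans ?_
      rw [abs_mul, abs_mul]; gcongr
    have a2 : -(q * j * e₁ ^ 2) ≤ K * K * x ^ 2 := by
      refine (neg_le_abs _).trans ?_
      rw [abs_mul, abs_mul, abs_of_pos hj, abs_pow]; gcongr
    have a3 : K * K * x ^ 2 ≤ κ * x ^ 2 :=
      mul_le_mul_of_nonneg_right (by linarith only [k24, k40, hκ, sq K]) (by positivity)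
    rw [e]
    rw [hκ] at a3 ⊢
    linarith only [a1, a2, a3]
  have t5 : ε * (p - q) ≤ κ * (δ * (x + δ)) := by
    refine (le_abs_self _).trans ?_
    rw [abs_mul]
    have a1 : δ * |p - q| ≤ δ * (K * (x + δ)) := by gcongr
    have a2 : K * (δ * (x + δ)) ≤ κ * (δ * (x + δ)) :=
      mul_le_mul_of_nonneg_right (by linarith only [k14, k40, hκ]) (by positivity)
    linarith only [a1, a2]
  have t6 : s ^ 2 / K ^ 2 ≤ j ^ 2 * s ^ 2 := by
    rw [div_eq_inv_mul, ← inv_pow]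
    have : 0 ≤ K⁻¹ := by positivity
    gcongr
  have hκ0 : 0 < κ := by positivity
  have bracket : (π + s) * th + (x + δ) * th + δ * s + δ * z + ((x + δ) * x + x ^ 2)
      + δ * (x + δ) ≤ π ^ 2 / 2 + 6 * th ^ 2 + 9 * (s * th) + 3 * δ ^ 2 + δ * s := by
    nlinarith only [sq_nonneg (π - th), sq_nonneg (x - th), sq_nonneg (δ - th),
      sq_nonneg (δ - z), sq_nonneg (δ - x), he₀, he₁, ex, ez, mul_nonneg hs hth]
  have t7 := mul_le_mul_of_nonneg_left bracket hκ0.le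
  have y1 : κ * (9 * (s * th)) ≤ s ^ 2 / K ^ 2 / 4 + 81 * κ ^ 2 * K ^ 2 * th ^ 2 := by
    have e : s ^ 2 / K ^ 2 / 4 + 81 * κ ^ 2 * K ^ 2 * th ^ 2 - κ * (9 * (s * th))
        = (s / (2 * K) - 9 * κ * K * th) ^ 2 := by field_simp; ring
    linarith only [e, sq_nonneg (s / (2 * K) - 9 * κ * K * th)]
  have y2 : κ * (δ * s) ≤ s ^ 2 / K ^ 2 / 4 + κ ^ 2 * K ^ 2 * δ ^ 2 := by
    have e : s ^ 2 / K ^ 2 / 4 + κ ^ 2 * K ^ 2 * δ ^ 2 - κ * (δ * s)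
        = (s / (2 * K) - κ * K * δ) ^ 2 := by field_simp; ring
    linarith only [e, sq_nonneg (s / (2 * K) - κ * K * δ)]
  have y3 : 0 ≤ κ * δ ^ 2 := by positivity
  have y4 : 0 ≤ κ ^ 2 * K ^ 2 * δ ^ 2 := by positivity
  have eC : errConst K = 4 * (6 * κ + 81 * κ ^ 2 * K ^ 2) := rfl
  rw [eC, ← eδ]
  have hκe : 2 * K ^ 4 * π ^ 2 = κ * π ^ 2 := rfl
  rw [hκe]
  linarith only [t1, t2, t3, t4, t5, t6, t7, y1, y2, y3, y4, heq]

/-- The error inequality at a time at which both weak formulations hold. The time derivative of the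
semi-discrete solution is `w'`. -/
theorem error_inequality {d : Data} {T₀ T : ℝ} (hd : d.Admissible T₀) {M : Mesh}
    {u v : ℝ → ℝ → ℝ} {h g : ℝ → ℝ} {w' : ℝ → ℝ} {K τ : ℝ} (hK : 1 ≤ K)
    (hu : SolutionBounds d T u h K τ) (hw' : IsL2 w') (hv : v τ ∈ M.V)
    (hdir : l2Norm (M.slope (v τ)) ≤ K) (hg : 0 < g τ) (hgK : g τ ≤ K) (hgi : (g τ)⁻¹ ≤ K)
    (hgs : |d.speed v g τ| ≤ K) (hβ : |d.Bi * (d.b τ / d.m₀ - d.H * u τ 0)| ≤ K)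
    (hσ : |d.speed u h τ - d.speed v g τ| ≤ K * (|u τ 1 - v τ 1| + |h τ - g τ|))
    (h1 : ∀ φ ∈ M.V, (∫ y in Ioo (0 : ℝ) 1, timeDeriv T u τ y * φ y)
        - d.speed u h τ / h τ * (∫ y in Ioo (0 : ℝ) 1, y * wd 0 1 (u τ) y * φ y)
        + 1 / h τ ^ 2 * M.dirichlet (u τ) φ
        - 1 / h τ * d.Bi * (d.b τ / d.m₀ - d.H * u τ 0) * φ 0
        + d.speed u h τ / h τ * u τ 1 * φ 1 = 0)
    (h2 : ∀ φ ∈ M.V, (∫ y in Ioo (0 : ℝ) 1, w' y * φ y)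
        - d.speed v g τ / g τ * (∫ y in Ioo (0 : ℝ) 1, y * M.slope (v τ) y * φ y)
        + 1 / g τ ^ 2 * M.dirichlet (v τ) φ
        - 1 / g τ * d.Bi * (d.b τ / d.m₀ - d.H * v τ 0) * φ 0
        + d.speed v g τ / g τ * v τ 1 * φ 1 = 0) :
    2 * (∫ y in Ioo (0 : ℝ) 1, (timeDeriv T u τ y - w' y) * (u τ y - v τ y))
        + 2 * ((h τ - g τ) * (d.speed u h τ - d.speed v g τ))
        + M.dirichlet (fun y => u τ y - v τ y) (fun y => u τ y - v τ y) / K ^ 2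
      ≤ errConst K * (l2Norm (fun y => u τ y - v τ y) ^ 2 + (h τ - g τ) ^ 2)
        + errConst K * (6 * K ^ 2 * M.size ^ 2
          * (1 + l2Norm (timeDeriv T u τ) ^ 2 + l2Norm w' ^ 2)) := by
  have hw := hu.isL2_timeDeriv
  set w := timeDeriv T u τ with hwdef
  have hK0 : 0 < K := by linarith
  have c0 : (0 : ℝ) ∈ Icc (0 : ℝ) 1 := left_mem_Icc.mpr zero_le_one
  have c1 : (1 : ℝ) ∈ Icc (0 : ℝ) 1 := right_mem_Icc.mpr zero_le_one
  -- `θ = I_k u - u_k` is the test function, `ρ = u - I_k u` the interpolation error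
  set θ : ℝ → ℝ := fun y => M.interp (u τ) y - v τ y with hθdef
  set ρ : ℝ → ℝ := fun y => u τ y - M.interp (u τ) y with hρdef
  set e : ℝ → ℝ := fun y => u τ y - v τ y with hedef
  have hθV : θ ∈ M.V := Mesh.sub_mem_V (Mesh.interp_mem_V _) hv
  have hθp := Mesh.isPrimitiveOn_of_mem_V hθV
  have huc := hu.isPrimitiveOn.continuousOn zero_le_one
  have hθ2 : IsL2 θ := isL2_of_continuousOn hθV.1
  have hρ2 : IsL2 ρ := isL2_of_continuousOn (huc.sub (Mesh.continuous_interp _).continuousOn)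
  have he2 : IsL2 e := isL2_of_continuousOn (huc.sub hv.1)
  have hθe : ∀ j, θ (M.node j) = e (M.node j) := fun j => by
    simp only [hθdef, hedef, Mesh.interp_node]
  have hθ0 : θ 0 = u τ 0 - v τ 0 := by simp only [hθdef, Mesh.interp_zero]
  have hθ1 : θ 1 = u τ 1 - v τ 1 := by simp only [hθdef, Mesh.interp_one]
  have hslope : M.slope θ = fun y => M.slope (u τ) y - M.slope (v τ) y := by
    rw [Mesh.slope_congr hθe, hedef, Mesh.slope_sub]
  have hse : M.dirichlet e e = l2Norm (M.slope θ) ^ 2 := by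
    rw [Mesh.l2Norm_slope_sq]; exact (Mesh.dirichlet_congr hθe hθe).symm
  have hPP : M.dirichlet (u τ) θ - M.dirichlet (v τ) θ = l2Norm (M.slope θ) ^ 2 := by
    rw [Mesh.l2Norm_slope_sq, Mesh.dirichlet_congr hθe (fun j => rfl)]
    simp only [Mesh.dirichlet, ← Finset.sum_sub_distrib, hedef]
    exact Finset.sum_congr rfl fun i _ => by ring
  have hsl2 := Mesh.isL2_slope (M := M) θ
  have hsv2 := Mesh.isL2_slope (M := M) (v τ)
  have hsu2 := Mesh.isL2_slope (M := M) (u τ)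
  have hup := hu.isL2_wd
  have hπ2 : IsL2 fun y => wd 0 1 (u τ) y - M.slope (u τ) y := hup.sub hsu2
  have hP₁ : |M.dirichlet (u τ) θ| ≤ K * l2Norm (M.slope θ) := by
    rw [← Mesh.integral_mul_slope hu.isPrimitiveOn]
    exact (abs_integral_mul_le hup hsl2).trans
      (mul_le_mul_of_nonneg_right hu.l2Norm_wd_le (l2Norm_nonneg _))
  have hB₂ : |∫ y in Ioo (0 : ℝ) 1, y * M.slope (v τ) y * θ y| ≤ K * l2Norm θ :=
    (abs_integral_mul_le (isL2_id_mul hsv2) hθ2).trans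
      (mul_le_mul_of_nonneg_right ((l2Norm_id_mul_le hsv2).trans hdir) (l2Norm_nonneg _))
  have hB : |(∫ y in Ioo (0 : ℝ) 1, y * wd 0 1 (u τ) y * θ y)
      - ∫ y in Ioo (0 : ℝ) 1, y * M.slope (v τ) y * θ y|
      ≤ (l2Norm (fun y => wd 0 1 (u τ) y - M.slope (u τ) y) + l2Norm (M.slope θ))
        * l2Norm θ := by
    have j1 : Integrable (fun y => y * wd 0 1 (u τ) y * θ y) (volume.restrict (Ioo (0 : ℝ) 1)) :=
      (isL2_id_mul hup).integrable_mul hθ2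
    have j2 : Integrable (fun y => y * M.slope (v τ) y * θ y)
        (volume.restrict (Ioo (0 : ℝ) 1)) := (isL2_id_mul hsv2).integrable_mul hθ2
    have hsum : IsL2 fun y => (wd 0 1 (u τ) y - M.slope (u τ) y) + M.slope θ y := hπ2.add hsl2
    rw [← integral_sub j1 j2]
    have e1 : ∀ y, y * wd 0 1 (u τ) y * θ y - y * M.slope (v τ) y * θ y
        = y * ((wd 0 1 (u τ) y - M.slope (u τ) y) + M.slope θ y) * θ y := fun y => by
      rw [hslope]; ring
    simp only [e1]
    refine (abs_integral_mul_le (isL2_id_mul hsum) hθ2).trans ?_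
    exact mul_le_mul_of_nonneg_right ((l2Norm_id_mul_le hsum).trans (l2Norm_add_le hπ2 hsl2))
      (l2Norm_nonneg _)
  have he0 := hθp.sq_le hsl2 c0
  have he1 := hθp.sq_le hsl2 c1
  rw [hθ0] at he0
  rw [hθ1] at he1
  have hww : IsL2 fun y => w y - w' y := hw.sub hw'
  have hXY : (∫ y in Ioo (0 : ℝ) 1, w y * θ y) - ∫ y in Ioo (0 : ℝ) 1, w' y * θ y
      = (∫ y in Ioo (0 : ℝ) 1, (w y - w' y) * e y)
        - ∫ y in Ioo (0 : ℝ) 1, (w y - w' y) * ρ y := by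
    have j1 : Integrable (fun y => w y * θ y) (volume.restrict (Ioo (0 : ℝ) 1)) :=
      hw.integrable_mul hθ2
    have j2 : Integrable (fun y => w' y * θ y) (volume.restrict (Ioo (0 : ℝ) 1)) :=
      hw'.integrable_mul hθ2
    have j3 : Integrable (fun y => (w y - w' y) * e y) (volume.restrict (Ioo (0 : ℝ) 1)) :=
      hww.integrable_mul he2
    have j4 : Integrable (fun y => (w y - w' y) * ρ y) (volume.restrict (Ioo (0 : ℝ) 1)) :=
      hww.integrable_mul hρ2
    rw [← integral_sub j1 j2, ← integral_sub j3 j4]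
    congr 1; funext y
    simp only [hθdef, hρdef, hedef]; ring
  have hhp := hu.front_pos
  have alg := error_algebra (X := ∫ y in Ioo (0 : ℝ) 1, (w y - w' y) * e y)
    (Y := ∫ y in Ioo (0 : ℝ) 1, (w y - w' y) * ρ y) (ε := h τ - g τ) (e₀ := u τ 0 - v τ 0)
    hK (inv_pos.mpr hhp) (inv_pos.mpr hg) hu.inv_front_le hgi
    (inv_anti₀ hg hgK) hu.speed_le (by field_simp; ring) hσ hgs hP₁ hB₂ hB (l2Norm_nonneg _)
    (l2Norm_nonneg _) (l2Norm_nonneg _) hu.abs_one_le hd.Bi_pos.le hd.H_pos.le hβ he0 he1 (by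
      have q1 := h1 θ hθV
      have q2 := h2 θ hθV
      rw [hθ0, hθ1] at q1 q2
      have hP2 : M.dirichlet (v τ) θ = M.dirichlet (u τ) θ - l2Norm (M.slope θ) ^ 2 := by
        linarith only [hPP]
      rw [hP2] at q2
      rw [← hXY]
      simp only [div_eq_mul_inv] at q1 q2 ⊢
      linear_combination q1 - q2)
  -- interpolation errors
  have hr := Mesh.l2Norm_sub_interp_le (M := M) hu.isPrimitiveOn hup
  have hπ := hu.interp_le M
  have hk0 := M.size_pos
  have hk1 := M.size_le_one
  have hY : ∫ y in Ioo (0 : ℝ) 1, (w y - w' y) * ρ y ≤ (l2Norm w + l2Norm w') * l2Norm ρ :=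
    (le_abs_self _).trans ((abs_integral_mul_le hww hρ2).trans
      (mul_le_mul_of_nonneg_right (l2Norm_sub_le hw hw') (l2Norm_nonneg _)))
  have hth : l2Norm θ ≤ l2Norm e + l2Norm ρ := by
    have e1 : θ = fun y => e y - ρ y := by
      funext y; simp only [hθdef, hρdef, hedef]; ring
    rw [e1]
    exact l2Norm_sub_le he2 hρ2
  rw [hse]
  have n1 := l2Norm_nonneg θ
  have n2 := l2Norm_nonneg e
  have n3 := l2Norm_nonneg ρ
  have n4 := l2Norm_nonneg w
  have n5 := l2Norm_nonneg w'
  have n6 := l2Norm_nonneg (fun y => wd 0 1 (u τ) y - M.slope (u τ) y)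
  generalize l2Norm (fun y => wd 0 1 (u τ) y - M.slope (u τ) y) = π at *
  generalize l2Norm θ = th at *
  generalize l2Norm e = E at *
  generalize l2Norm ρ = r at *
  generalize l2Norm w = a at *
  generalize l2Norm w' = b at *
  generalize M.size = k at *
  generalize l2Norm (M.slope θ) = s at *
  have hC1 : 48 * K ^ 4 ≤ errConst K := by
    have : 0 ≤ 81 * (2 * K ^ 4) ^ 2 * K ^ 2 := by positivity
    rw [errConst]; linarith only [this]
  have hK4 : 1 ≤ K ^ 4 := one_le_pow₀ hK
  generalize errConst K = C at *
  have hC0 : 0 < C := by linarith only [hC1, hK4]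
  have r1 : r ≤ k * (k * (K * (1 + a))) := hr.trans (mul_le_mul_of_nonneg_left hπ hk0.le)
  have hk2 : k ^ 2 ≤ 1 := pow_le_one₀ hk0.le hk1
  have z1 : th ^ 2 ≤ 2 * E ^ 2 + 2 * r ^ 2 := by
    have : th ^ 2 ≤ (E + r) ^ 2 := pow_le_pow_left₀ n1 hth 2
    nlinarith only [this, sq_nonneg (E - r)]
  have z2 : r ^ 2 ≤ k ^ 2 * K ^ 2 * (1 + a) ^ 2 := by
    have i1 : r ^ 2 ≤ (k * (k * (K * (1 + a)))) ^ 2 := pow_le_pow_left₀ n3 r1 2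
    have i2 : (k * (k * (K * (1 + a)))) ^ 2 = k ^ 2 * (k ^ 2 * K ^ 2 * (1 + a) ^ 2) := by ring
    have i3 : k ^ 2 * (k ^ 2 * K ^ 2 * (1 + a) ^ 2) ≤ 1 * (k ^ 2 * K ^ 2 * (1 + a) ^ 2) := by
      gcongr
    linarith only [i1, i2, i3]
  have z3 : π ^ 2 ≤ k ^ 2 * K ^ 2 * (1 + a) ^ 2 := by
    have i1 : π ^ 2 ≤ (k * (K * (1 + a))) ^ 2 := pow_le_pow_left₀ n6 hπ 2
    linarith only [i1]
  have z4 : (a + b) * r ≤ k ^ 2 * K ^ 2 * ((a + b) * (1 + a)) := by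
    have i1 : (a + b) * r ≤ (a + b) * (k * (k * (K ^ 2 * (1 + a)))) := by
      refine mul_le_mul_of_nonneg_left (r1.trans ?_) (add_nonneg n4 n5)
      have : K ≤ K ^ 2 := le_self_pow₀ hK (by norm_num)
      gcongr
    linarith only [i1]
  have z5 : r ^ 2 + π ^ 2 + (a + b) * r ≤ 6 * K ^ 2 * k ^ 2 * (1 + a ^ 2 + b ^ 2) := by
    have i1 : (1 + a) ^ 2 + (1 + a) ^ 2 + (a + b) * (1 + a) ≤ 6 * (1 + a ^ 2 + b ^ 2) := by
      nlinarith only [sq_nonneg (a - 1), sq_nonneg (b - 1), sq_nonneg (a - b), sq_nonneg b]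
    have i2 : 0 ≤ k ^ 2 * K ^ 2 := by positivity
    have i3 := mul_le_mul_of_nonneg_left i1 i2
    linarith only [z2, z3, z4, i3]
  have z6 := mul_le_mul_of_nonneg_left z5 hC0.le
  have z7 := mul_le_mul_of_nonneg_left z1 hC0.le
  have z8 : 2 * K ^ 4 * π ^ 2 ≤ C * π ^ 2 :=
    mul_le_mul_of_nonneg_right (by linarith only [hC1, hK4]) (sq_nonneg _)
  have z9 : 2 * ((a + b) * r) ≤ C * ((a + b) * r) :=
    mul_le_mul_of_nonneg_right (by linarith only [hC1, hK4]) (by positivity)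
  have z10 : 0 ≤ C * (h τ - g τ) ^ 2 := by positivity
  linarith only [alg, hY, z6, z7, z8, z9, z10]

/-! ### Integration of the error inequality -/

/-- Gronwall's inequality in the form used for energy estimates: `φ` controls the energy and `S`
the dissipation. -/
theorem IsPrimitiveOn.gronwall {φ φ' S ψ : ℝ → ℝ} {C t : ℝ} (ht : 0 ≤ t) (hC : 0 ≤ C)
    (h : IsPrimitiveOn 0 t φ φ') (hS : ContinuousOn S (Icc 0 t)) (hS0 : ∀ τ ∈ Icc 0 t, 0 ≤ S τ)
    (hψ : IntegrableOn ψ (Ioo 0 t)) (hψ0 : ∀ τ ∈ Ioo 0 t, 0 ≤ ψ τ)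
    (hle : ∀ᵐ τ ∂(volume.restrict (Ioo 0 t)), φ' τ + S τ ≤ C * φ τ + ψ τ) :
    φ t + ∫ τ in Ioo 0 t, S τ ≤ Real.exp (C * t) * (φ 0 + ∫ τ in Ioo 0 t, ψ τ) := by
  -- `E` is an integrating factor with values at least `1`, so that it does not weaken `S`
  set E : ℝ → ℝ := fun τ => Real.exp (C * (t - τ)) with hE
  have hEd : ∀ τ, HasDerivAt E (-C * E τ) τ := fun τ => by
    have h1 : HasDerivAt (fun τ => C * (t - τ)) (C * (-1)) τ :=
      ((hasDerivAt_id τ).const_sub t).const_mul C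
    have h2 := h1.exp
    convert h2 using 1
    simp only [hE]; ring
  have hEc : Continuous E := by fun_prop
  have hEp : IsPrimitiveOn 0 t E (fun τ => -C * E τ) :=
    IsPrimitiveOn.of_hasDerivAt hEc.continuousOn countable_empty (fun τ _ => hEd τ)
      ((hEc.const_mul _).intervalIntegrable _ _)
  have hm := hEp.mul ht h
  have e1 := hm.integral_eq ht
  rw [intervalIntegral.integral_of_le ht, integral_Ioc_eq_integral_Ioo] at e1
  have hE0 : E 0 = Real.exp (C * t) := by simp [hE]
  have hEt : E t = 1 := by simp [hE]
  rw [hE0, hEt, one_mul] at e1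
  have hSi : IntegrableOn S (Ioo 0 t) :=
    (hS.integrableOn_compact isCompact_Icc).mono_set Ioo_subset_Icc_self
  have key : (∫ τ in Ioo 0 t, ((-C * E τ * φ τ + E τ * φ' τ) + S τ))
      ≤ ∫ τ in Ioo 0 t, Real.exp (C * t) * ψ τ := by
    refine integral_mono_ae ((hm.integrableOn ht).add hSi) (hψ.const_mul _) ?_
    filter_upwards [hle, ae_restrict_mem measurableSet_Ioo] with τ h1 hτ
    have hE1 : 1 ≤ E τ := Real.one_le_exp (mul_nonneg hC (sub_nonneg.mpr hτ.2.le))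
    have hE2 : E τ ≤ Real.exp (C * t) :=
      Real.exp_le_exp.mpr (mul_le_mul_of_nonneg_left (by linarith [hτ.1]) hC)
    have i1 := mul_le_mul_of_nonneg_left h1 (zero_le_one.trans hE1)
    have i2 := mul_le_mul_of_nonneg_right hE1 (hS0 τ (Ioo_subset_Icc_self hτ))
    have i3 := mul_le_mul_of_nonneg_right hE2 (hψ0 τ hτ)
    change -C * E τ * φ τ + E τ * φ' τ + S τ ≤ Real.exp (C * t) * ψ τ
    nlinarith only [i1, i2, i3]
  rw [integral_add (hm.integrableOn ht) hSi, integral_const_mul, e1] at key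
  linarith only [key]

theorem exists_lipschitz_of_contDiff {σ : ℝ → ℝ} (hσ : ContDiff ℝ 1 σ) (B : ℝ) :
    ∃ l, 0 ≤ l ∧ ∀ x y, |x| ≤ B → |y| ≤ B → |σ x - σ y| ≤ l * |x - y| := by
  obtain ⟨l, hl⟩ := (isCompact_Icc (a := -B) (b := B)).exists_bound_of_continuousOn
    (hσ.continuous_deriv le_rfl).continuousOn
  refine ⟨max l 0, le_max_right _ _, fun x y hx hy => ?_⟩
  have := (convex_Icc (-B) B).norm_image_sub_le_of_norm_deriv_le (f := σ) (C := max l 0)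
    (fun z _ => hσ.differentiable one_ne_zero z) (fun z hz => (hl z hz).trans (le_max_left _ _))
    (abs_le.mp hy) (abs_le.mp hx)
  simpa only [Real.norm_eq_abs] using this

/-- The front speeds of the two problems differ at most by a multiple of the errors at the front. -/
theorem IsWeakSolution.exists_speed_sub_le {d : Data} {L T : ℝ} {u : ℝ → ℝ → ℝ} {h : ℝ → ℝ}
    (hs : IsWeakSolution d L T u h) (hσ : ContDiff ℝ 1 d.σ) (B : ℝ) :
    ∃ l, ∀ (v : ℝ → ℝ → ℝ) (g : ℝ → ℝ), ∀ τ ∈ Icc 0 T, |g τ| ≤ B →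
      |d.speed u h τ - d.speed v g τ| ≤ l * (|u τ 1 - v τ 1| + |h τ - g τ|) := by
  obtain ⟨H₁, hH₁⟩ := isCompact_Icc.exists_bound_of_continuousOn hs.h_cont
  obtain ⟨l, hl0, hl⟩ := exists_lipschitz_of_contDiff hσ (max H₁ B)
  refine ⟨|d.A₀| + |d.A₀ / d.m₀| * l, fun v g τ hτ hg => ?_⟩
  have h1 := hl (h τ) (g τ) ((hH₁ τ hτ).trans (le_max_left _ _)) (hg.trans (le_max_right _ _))
  have e : d.speed u h τ - d.speed v g τ
      = d.A₀ * (u τ 1 - v τ 1) + -(d.A₀ / d.m₀ * (d.σ (h τ) - d.σ (g τ))) := by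
    rw [Data.speed, Data.speed]; ring
  rw [e]
  refine (abs_add_le _ _).trans ?_
  rw [abs_neg, abs_mul, abs_mul]
  have n1 : 0 ≤ |d.A₀| * |h τ - g τ| := by positivity
  have n2 : 0 ≤ |d.A₀ / d.m₀| * l * |u τ 1 - v τ 1| := by positivity
  have n3 := mul_le_mul_of_nonneg_left h1 (abs_nonneg (d.A₀ / d.m₀))
  linarith only [n1, n2, n3]

theorem IsWeakSolution.exists_boundary_bound {d : Data} {L T : ℝ} {u : ℝ → ℝ → ℝ} {h : ℝ → ℝ}
    (hs : IsWeakSolution d L T u h) (hd : d.Admissible T) :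
    ∃ β, ∀ᵐ τ ∂(volume.restrict (Ioo 0 T)), |d.Bi * (d.b τ / d.m₀ - d.H * u τ 0)| ≤ β := by
  obtain ⟨U, hU⟩ := ContinuousOn.bound_cyl hs.u_cont
  refine ⟨d.Bi * (d.bHigh / d.m₀ + d.H * U), ?_⟩
  have hBi := hd.Bi_pos
  have hm := hd.m₀_pos
  have hH := hd.H_pos
  filter_upwards [hd.b_bounds, ae_restrict_mem measurableSet_Ioo] with τ h1 hτ
  rw [abs_mul, abs_of_pos hBi]
  refine mul_le_mul_of_nonneg_left ((abs_sub _ _).trans ?_) hBi.le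
  have hb : 0 < d.b τ := hd.bLow_pos.trans_le h1.1
  rw [abs_div, abs_of_pos hm, abs_of_pos hb, abs_mul, abs_of_pos hH]
  have := hU τ (Ioo_subset_Icc_self hτ) 0 (left_mem_Icc.mpr zero_le_one)
  have := h1.2
  gcongr

theorem l2Norm_initial_error_le {d : Data} {L T T' T₀ : ℝ} {M : Mesh} {u v : ℝ → ℝ → ℝ}
    {h g : ℝ → ℝ} (hd : d.Admissible T₀) (hs : IsWeakSolution d L T u h)
    (hvs : IsDiscreteSolution d M L T' v g) :
    l2Norm (fun y => u 0 y - v 0 y) ≤ M.size * (2 * l2Norm (wd 0 1 d.u₀)) := by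
  have hp := hd.u₀_mem.1.isPrimitiveOn zero_lt_one (by norm_num) hd.u₀_cont
  have hp2 : IsL2 (wd 0 1 d.u₀) := hd.u₀_mem.1.memLp_weakDeriv isOpen_Ioo 1
  have e : l2Norm (fun y => u 0 y - v 0 y) = l2Norm (fun y => d.u₀ y - M.interp d.u₀ y) := by
    refine l2Norm_congr (ae_restrict_of_forall_mem measurableSet_Ioo fun y hy => ?_)
    have hy' := Ioo_subset_Icc_self hy
    change u 0 y - v 0 y = d.u₀ y - M.interp d.u₀ y
    rw [hs.u_init y hy', ← Mesh.interp_eq_of_mem_V hvs.u_init.1 hy',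
      Mesh.interp_congr hvs.u_init.2]
  rw [e]
  refine (Mesh.l2Norm_sub_interp_le hp hp2).trans
    (mul_le_mul_of_nonneg_left ?_ M.size_pos.le)
  have h1 := l2Norm_sub_le hp2 (Mesh.isL2_slope (M := M) d.u₀)
  have h2 := Mesh.l2Norm_slope_le (M := M) hp hp2
  linarith only [h1, h2]

/-- The error in the energy norm at time `t`, in terms of a common bound `K` for both solutions. -/
theorem energy_error_le {d : Data} {L T T' : ℝ} {M : Mesh} {u v : ℝ → ℝ → ℝ}
    {h g : ℝ → ℝ} {K R G D t : ℝ} (hd : d.Admissible T) (hs : IsWeakSolution d L T u h)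
    (hT' : 0 < T') (hTT' : T' ≤ T) (hvs : IsDiscreteSolution d M L T' v g) (hK : 1 ≤ K)
    (hu : ∀ᵐ τ ∂(volume.restrict (Ioo 0 T)), SolutionBounds d T u h K τ)
    (hβ : ∀ᵐ τ ∂(volume.restrict (Ioo 0 T)), |d.Bi * (d.b τ / d.m₀ - d.H * u τ 0)| ≤ K)
    (ht : t ∈ Icc 0 T') (hb : ∀ τ ∈ Icc 0 t, DiscreteBounds d M T' v g R G D τ)
    (hRK : R ≤ K ^ 2) (hGK : G ≤ K) (hhK : 2 * d.h₀ ≤ K) (hhK' : (d.h₀ / 2)⁻¹ ≤ K)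
    (hσ : ∀ τ ∈ Icc 0 t,
      |d.speed u h τ - d.speed v g τ| ≤ K * (|u τ 1 - v τ 1| + |h τ - g τ|)) :
    l2Norm (fun y => u t y - v t y) ^ 2 + (h t - g t) ^ 2
        + (∫ τ in Ioo 0 t, M.dirichlet (fun y => u τ y - v τ y) (fun y => u τ y - v τ y)) / K ^ 2
      ≤ Real.exp (errConst K * T) * (4 * l2Norm (wd 0 1 d.u₀) ^ 2
        + errConst K * (6 * K ^ 2
          * (T + (∫ τ in Ioo 0 T, l2Norm (timeDeriv T u τ) ^ 2) + D))) * M.size ^ 2 := by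
  have hT := hd.T_pos
  have htT : t ≤ T := ht.2.trans hTT'
  have hh := hd.h₀_pos
  have hC0 : 0 ≤ errConst K := by rw [errConst]; positivity
  have hsub : Ioo 0 t ⊆ Ioo 0 T := Ioo_subset_Ioo_right htT
  have hsub' : Ioo 0 t ⊆ Ioo 0 T' := Ioo_subset_Ioo_right ht.2
  have hcsub : Icc 0 t ×ˢ Icc (0 : ℝ) 1 ⊆ Icc 0 T ×ˢ Icc 0 1 :=
    prod_mono (Icc_subset_Icc_right htT) Subset.rfl
  have hcsub' : Icc 0 t ×ˢ Icc (0 : ℝ) 1 ⊆ Icc 0 T' ×ˢ Icc 0 1 :=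
    prod_mono (Icc_subset_Icc_right ht.2) Subset.rfl
  have hec : ContinuousOn (Function.uncurry fun τ y => u τ y - v τ y) (Icc 0 t ×ˢ Icc 0 1) :=
    (hs.u_cont.mono hcsub).sub (hvs.continuousOn_uncurry.mono hcsub')
  have hep : IsPrimitiveOn 0 t (fun τ => l2Norm (fun y => u τ y - v τ y) ^ 2)
      (fun τ => 2 * ∫ y in Ioo (0 : ℝ) 1,
        (timeDeriv T u τ y - discreteDeriv M T' v τ y) * (u τ y - v τ y)) := by
    refine isPrimitiveOn_l2Norm_sq (e := fun τ y => u τ y - v τ y)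
      (w := fun τ y => timeDeriv T u τ y - discreteDeriv M T' v τ y) ht.1 ?_ hec ?_
    · filter_upwards [hs.ae_isPrimitiveOn_timeDeriv hT, ae_restrict_mem measurableSet_Ioo]
        with y hy hy1
      exact (hy.mono le_rfl ht.1 htT).sub
        ((hvs.isPrimitiveOn_discreteDeriv hT' (Ioo_subset_Icc_self hy1)).mono le_rfl ht.1 ht.2)
    · exact (hs.integrableOn_timeDeriv.mono_set (cyl_mono htT)).sub
        (hvs.integrableOn_discreteDeriv.mono_set (cyl_mono ht.2))
  have hεp : IsPrimitiveOn 0 t (fun τ => h τ - g τ)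
      (fun τ => d.speed u h τ - d.speed v g τ) :=
    ((hs.isPrimitiveOn_front hT).mono le_rfl ht.1 htT).sub
      ((hvs.isPrimitiveOn_front hT').mono le_rfl ht.1 ht.2)
  have hΦ := hep.add (hεp.mul ht.1 hεp)
  have ha : IntegrableOn (fun τ => l2Norm (timeDeriv T u τ) ^ 2) (Ioo 0 T) :=
    hs.integrableOn_l2Norm_sq
  have hb2 : IntegrableOn (fun τ => l2Norm (discreteDeriv M T' v τ) ^ 2) (Ioo 0 t) :=
    hvs.integrableOn_l2Norm_sq.mono_set hsub'
  have hone : IntegrableOn (fun _ => (1 : ℝ)) (Ioo 0 t) := integrableOn_const (by simp)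
  have hψ0 : IntegrableOn (fun τ => 1 + l2Norm (timeDeriv T u τ) ^ 2) (Ioo 0 t) :=
    hone.add (ha.mono_set hsub)
  have hψ1 : IntegrableOn (fun τ => 1 + l2Norm (timeDeriv T u τ) ^ 2
      + l2Norm (discreteDeriv M T' v τ) ^ 2) (Ioo 0 t) :=
    hψ0.add hb2
  have hψ : IntegrableOn (fun τ => errConst K * (6 * K ^ 2 * M.size ^ 2
      * (1 + l2Norm (timeDeriv T u τ) ^ 2 + l2Norm (discreteDeriv M T' v τ) ^ 2))) (Ioo 0 t) :=
    (hψ1.const_mul _).const_mul _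
  have hdirc : ContinuousOn (fun τ => M.dirichlet (fun y => u τ y - v τ y)
      (fun y => u τ y - v τ y)) (Icc 0 t) :=
    Mesh.continuousOn_dirichlet (e := fun τ y => u τ y - v τ y)
      fun y hy => ContinuousOn.slice_time hec hy
  have gr := hΦ.gronwall (C := errConst K) (S := fun τ => M.dirichlet (fun y => u τ y - v τ y)
      (fun y => u τ y - v τ y) / K ^ 2) ht.1 hC0 (hdirc.div_const _)
    (fun τ _ => div_nonneg (Mesh.dirichlet_self_nonneg _) (sq_nonneg _)) hψ
    (fun τ _ => by positivity) (by
      filter_upwards [ae_restrict_of_ae_restrict_of_subset hsub hu,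
        ae_restrict_of_ae_restrict_of_subset hsub hβ,
        ae_restrict_of_ae_restrict_of_subset hsub (hs.weak_form M),
        ae_restrict_of_ae_restrict_of_subset hsub' (hvs.weak_form hT'),
        ae_restrict_mem measurableSet_Ioo] with τ a1 a2 a3 a4 hτ
      have hτI := Ioo_subset_Icc_self hτ
      have hB := hb τ hτI
      have hgpos : 0 < g τ := lt_of_lt_of_le (by positivity) hB.front_ge
      have hw' : IsL2 (discreteDeriv M T' v τ) :=
        isL2_of_continuousOn (Mesh.continuous_interp _).continuousOn
      have hdir : l2Norm (M.slope (v τ)) ≤ K := by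
        refine le_of_sq_le_sq ?_ (by linarith)
        rw [Mesh.l2Norm_slope_sq]
        exact hB.dirichlet_le.trans hRK
      have := error_inequality hd hK a1 hw'
        (hvs.uk_V τ ⟨hτ.1.le, hτ.2.le.trans ht.2⟩) hdir hgpos (hB.front_le.trans hhK)
        ((inv_anti₀ (by positivity) hB.front_ge).trans hhK') (hB.speed_le.trans hGK) a2
        (hσ τ hτI) a3 a4
      linarith only [this])
  rw [integral_div, integral_const_mul, integral_const_mul,
    integral_add hψ0 hb2, integral_add hone (ha.mono_set hsub)] at gr
  have i0 : (∫ _ in Ioo 0 t, (1 : ℝ)) = t := by simp [ht.1]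
  have i1 : (∫ τ in Ioo 0 t, l2Norm (timeDeriv T u τ) ^ 2)
      ≤ ∫ τ in Ioo 0 T, l2Norm (timeDeriv T u τ) ^ 2 :=
    setIntegral_mono_set ha (Filter.Eventually.of_forall fun τ => sq_nonneg _)
      hsub.eventuallyLE
  have i2 := (hb t (right_mem_Icc.mpr ht.1)).dissipation_le
  have i3 := l2Norm_initial_error_le hd hs hvs
  have i4 : l2Norm (fun y => u 0 y - v 0 y) ^ 2
      ≤ 4 * l2Norm (wd 0 1 d.u₀) ^ 2 * M.size ^ 2 := by
    have := pow_le_pow_left₀ (l2Norm_nonneg _) i3 2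
    linarith only [this]
  rw [i0, hs.h_init, hvs.h_init] at gr
  have gr2 : l2Norm (fun y => u t y - v t y) ^ 2 + (h t - g t) ^ 2
      + (∫ τ in Ioo 0 t, M.dirichlet (fun y => u τ y - v τ y) (fun y => u τ y - v τ y)) / K ^ 2
      ≤ Real.exp (errConst K * t) * (l2Norm (fun y => u 0 y - v 0 y) ^ 2
        + errConst K * (6 * K ^ 2 * M.size ^ 2 * (t
          + (∫ τ in Ioo 0 t, l2Norm (timeDeriv T u τ) ^ 2)
          + ∫ τ in Ioo 0 t, l2Norm (discreteDeriv M T' v τ) ^ 2))) := by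
    linarith only [gr]
  refine gr2.trans ((?_ : _ ≤ _).trans_eq (mul_assoc _ _ _).symm)
  have j0 : 0 ≤ ∫ τ in Ioo 0 t, l2Norm (timeDeriv T u τ) ^ 2 :=
    integral_nonneg fun τ => sq_nonneg _
  have j1 : 0 ≤ ∫ τ in Ioo 0 t, l2Norm (discreteDeriv M T' v τ) ^ 2 :=
    integral_nonneg fun τ => sq_nonneg _
  have j2 := ht.1
  have j3 : l2Norm (fun y => u 0 y - v 0 y) ^ 2
        + errConst K * (6 * K ^ 2 * M.size ^ 2 * (t
          + (∫ τ in Ioo 0 t, l2Norm (timeDeriv T u τ) ^ 2)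
          + ∫ τ in Ioo 0 t, l2Norm (discreteDeriv M T' v τ) ^ 2))
      ≤ (4 * l2Norm (wd 0 1 d.u₀) ^ 2 + errConst K * (6 * K ^ 2
          * (T + (∫ τ in Ioo 0 T, l2Norm (timeDeriv T u τ) ^ 2) + D))) * M.size ^ 2 := by
    have : errConst K * (6 * K ^ 2 * M.size ^ 2 * (t
          + (∫ τ in Ioo 0 t, l2Norm (timeDeriv T u τ) ^ 2)
          + ∫ τ in Ioo 0 t, l2Norm (discreteDeriv M T' v τ) ^ 2))
      ≤ errConst K * (6 * K ^ 2 * M.size ^ 2 * (T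
          + (∫ τ in Ioo 0 T, l2Norm (timeDeriv T u τ) ^ 2) + D)) := by gcongr
    linarith only [this, i4]
  have j4 : 0 ≤ l2Norm (fun y => u 0 y - v 0 y) ^ 2
        + errConst K * (6 * K ^ 2 * M.size ^ 2 * (t
          + (∫ τ in Ioo 0 t, l2Norm (timeDeriv T u τ) ^ 2)
          + ∫ τ in Ioo 0 t, l2Norm (discreteDeriv M T' v τ) ^ 2)) := by positivity
  exact mul_le_mul (Real.exp_le_exp.mpr (mul_le_mul_of_nonneg_left htT hC0)) j3 j4
    (Real.exp_pos _).le

/-! ### The error in the norms of the theorem -/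

theorem IsPrimitiveOn.h1NormSq_eq {a b : ℝ} (hab : a ≤ b) {f p : ℝ → ℝ}
    (hf : IsPrimitiveOn a b f p) (hp : MemLp p 2 (volume.restrict (Ioo a b))) :
    h1NormSq a b f
      = ENNReal.ofReal ((∫ y in Ioo a b, f y ^ 2) + ∫ y in Ioo a b, p y ^ 2) := by
  have e : l2NormSq a b (wd a b f) = l2NormSq a b p := by
    rw [l2NormSq, l2NormSq, eLpNorm_congr_ae (hf.wd_ae_eq hab)]
  rw [h1NormSq, if_pos (hf.memW1 hab hp), e,
    l2NormSq_eq (memLp_of_continuousOn_Icc (hf.continuousOn hab)), l2NormSq_eq hp,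
    ENNReal.ofReal_add (integral_nonneg fun _ => sq_nonneg _)
      (integral_nonneg fun _ => sq_nonneg _)]

/-- The derivative of the error is the sum of the derivative of the interpolation error and the
derivative of the interpolated error, the latter being measured by the dissipation. -/
theorem SolutionBounds.error_primitive {d : Data} {T : ℝ} {M : Mesh} {u v : ℝ → ℝ → ℝ}
    {h : ℝ → ℝ} {K τ : ℝ} (hu : SolutionBounds d T u h K τ) (hv : v τ ∈ M.V) :
    ∃ p, IsPrimitiveOn 0 1 (fun y => u τ y - v τ y) p ∧ IsL2 p ∧
      l2Norm p ^ 2 ≤ 4 * K ^ 2 * M.size ^ 2 * (1 + l2Norm (timeDeriv T u τ) ^ 2)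
        + 2 * M.dirichlet (fun y => u τ y - v τ y) (fun y => u τ y - v τ y) := by
  have h1 : IsL2 fun y => wd 0 1 (u τ) y - M.slope (u τ) y := hu.isL2_wd.sub (Mesh.isL2_slope _)
  have h2 := Mesh.isL2_slope (M := M) (fun y => u τ y - v τ y)
  have e : (fun y => wd 0 1 (u τ) y - M.slope (v τ) y)
      = fun y => (wd 0 1 (u τ) y - M.slope (u τ) y) + M.slope (fun y => u τ y - v τ y) y := by
    funext y
    rw [Mesh.slope_sub]; ring
  refine ⟨fun y => wd 0 1 (u τ) y - M.slope (v τ) y,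
    hu.isPrimitiveOn.sub (Mesh.isPrimitiveOn_of_mem_V hv),
    hu.isL2_wd.sub (Mesh.isL2_slope _), ?_⟩
  rw [e, ← Mesh.l2Norm_slope_sq]
  have h3 := l2Norm_add_le h1 h2
  have h4 := hu.interp_le M
  have n0 := l2Norm_nonneg
    (fun y => (wd 0 1 (u τ) y - M.slope (u τ) y) + M.slope (fun y => u τ y - v τ y) y)
  have n1 := l2Norm_nonneg (fun y => wd 0 1 (u τ) y - M.slope (u τ) y)
  have i1 := pow_le_pow_left₀ n0 h3 2
  have i2 := pow_le_pow_left₀ n1 h4 2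
  generalize l2Norm (timeDeriv T u τ) = a at *
  generalize l2Norm (fun y => wd 0 1 (u τ) y - M.slope (u τ) y) = π at *
  generalize l2Norm (M.slope fun y => u τ y - v τ y) = s at *
  have i3 : 0 ≤ K ^ 2 * M.size ^ 2 * (a - 1) ^ 2 := by positivity
  nlinarith only [i1, i2, i3, sq_nonneg (π - s)]

/-- The passage from the energy estimate to the norms of the error. -/
theorem errorNorm_le {d : Data} {L T T' : ℝ} {M : Mesh} {u v : ℝ → ℝ → ℝ}
    {h g : ℝ → ℝ} {K F t : ℝ} (hs : IsWeakSolution d L T u h) (hσ : ContDiff ℝ 1 d.σ)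
    (hT' : 0 < T') (hTT' : T' ≤ T) (hvs : IsDiscreteSolution d M L T' v g)
    (hu : ∀ᵐ τ ∂(volume.restrict (Ioo 0 T)), SolutionBounds d T u h K τ)
    (ht : t ∈ Icc 0 T') (hF : ∀ τ ∈ Icc 0 t, l2Norm (fun y => u τ y - v τ y) ^ 2 ≤ F)
    (hF' : ∀ τ ∈ Icc 0 t, (h τ - g τ) ^ 2 ≤ F)
    (hFd : ∫ τ in Ioo 0 t, M.dirichlet (fun y => u τ y - v τ y) (fun y => u τ y - v τ y)
      ≤ K ^ 2 * F)
    (hsp : ∀ τ ∈ Icc 0 t,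
      |d.speed u h τ - d.speed v g τ| ≤ K * (|u τ 1 - v τ 1| + |h τ - g τ|)) :
    energyNormSq t (fun τ y => u τ y - v τ y) + h1NormSq 0 t (fun τ => h τ - g τ)
      ≤ ENNReal.ofReal (F + T * F + (1 + 6 * K ^ 2) * (T * F + 4 * K ^ 2 * M.size ^ 2
        * (T + ∫ τ in Ioo 0 T, l2Norm (timeDeriv T u τ) ^ 2) + 2 * (K ^ 2 * F))) := by
  have hT : 0 < T := hT'.trans_le hTT'
  have htT : t ≤ T := ht.2.trans hTT'
  have h0t : (0 : ℝ) ∈ Icc 0 t := left_mem_Icc.mpr ht.1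
  have c1 : (1 : ℝ) ∈ Icc (0 : ℝ) 1 := right_mem_Icc.mpr zero_le_one
  have hF0 : 0 ≤ F := (sq_nonneg _).trans (hF 0 h0t)
  have hsub : Ioo 0 t ⊆ Ioo 0 T := Ioo_subset_Ioo_right htT
  have hcT : Icc 0 t ⊆ Icc 0 T := Icc_subset_Icc_right htT
  have hcT' : Icc 0 t ⊆ Icc 0 T' := Icc_subset_Icc_right ht.2
  have hec : ContinuousOn (Function.uncurry fun τ y => u τ y - v τ y) (Icc 0 t ×ˢ Icc 0 1) :=
    (hs.u_cont.mono (prod_mono hcT Subset.rfl)).sub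
      (hvs.continuousOn_uncurry.mono (prod_mono hcT' Subset.rfl))
  have hut := ae_restrict_of_ae_restrict_of_subset hsub hu
  -- a majorant of the squared `H¹` norm of the error in the concentration
  set J : ℝ → ℝ := fun τ => F + 4 * K ^ 2 * M.size ^ 2 * (1 + l2Norm (timeDeriv T u τ) ^ 2)
    + 2 * M.dirichlet (fun y => u τ y - v τ y) (fun y => u τ y - v τ y) with hJ
  have hJ0 : ∀ τ, 0 ≤ J τ := fun τ => by
    have := Mesh.dirichlet_self_nonneg (M := M) (fun y => u τ y - v τ y)
    simp only [hJ]; positivity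
  have ha : IntegrableOn (fun τ => l2Norm (timeDeriv T u τ) ^ 2) (Ioo 0 T) :=
    hs.integrableOn_l2Norm_sq
  have hone : ∀ c : ℝ, IntegrableOn (fun _ => c) (Ioo 0 t) := fun c => integrableOn_const (by simp)
  have hconst : ∀ c : ℝ, (∫ _ in Ioo 0 t, c) = t * c := fun c => by simp [ht.1]
  have ha1 : IntegrableOn (fun τ => 1 + l2Norm (timeDeriv T u τ) ^ 2) (Ioo 0 t) :=
    (hone 1).add (ha.mono_set hsub)
  have hS : IntegrableOn (fun τ => M.dirichlet (fun y => u τ y - v τ y)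
      (fun y => u τ y - v τ y)) (Ioo 0 t) :=
    ((Mesh.continuousOn_dirichlet (e := fun τ y => u τ y - v τ y)
      fun y hy => ContinuousOn.slice_time hec hy).integrableOn_compact isCompact_Icc).mono_set
      Ioo_subset_Icc_self
  have hJ1 : IntegrableOn (fun τ => F + 4 * K ^ 2 * M.size ^ 2
      * (1 + l2Norm (timeDeriv T u τ) ^ 2)) (Ioo 0 t) := (hone F).add (ha1.const_mul _)
  have hJi : IntegrableOn J (Ioo 0 t) := hJ1.add (hS.const_mul 2)
  have hJint : ∫ τ in Ioo 0 t, J τ ≤ T * F + 4 * K ^ 2 * M.size ^ 2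
        * (T + ∫ τ in Ioo 0 T, l2Norm (timeDeriv T u τ) ^ 2) + 2 * (K ^ 2 * F) := by
    rw [hJ, integral_add hJ1 (hS.const_mul 2), integral_add (hone F) (ha1.const_mul _),
      integral_const_mul, integral_const_mul, integral_add (hone 1) (ha.mono_set hsub),
      hconst, hconst, mul_one]
    have i1 : (∫ τ in Ioo 0 t, l2Norm (timeDeriv T u τ) ^ 2)
        ≤ ∫ τ in Ioo 0 T, l2Norm (timeDeriv T u τ) ^ 2 :=
      setIntegral_mono_set ha (Filter.Eventually.of_forall fun τ => sq_nonneg _)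
        hsub.eventuallyLE
    gcongr
  have hH1 : ∀ᵐ τ ∂(volume.restrict (Ioo 0 t)),
      h1NormSq 0 1 (fun y => u τ y - v τ y) ≤ ENNReal.ofReal (J τ) ∧
        (u τ 1 - v τ 1) ^ 2 ≤ 2 * J τ := by
    filter_upwards [hut, ae_restrict_mem measurableSet_Ioo] with τ h1 hτ
    have hτI := Ioo_subset_Icc_self hτ
    obtain ⟨p, hp, hp2, hpn⟩ := h1.error_primitive (M := M) (hvs.uk_V τ (hcT' hτI))
    have h3 := hF τ hτI
    refine ⟨?_, ?_⟩
    · rw [hp.h1NormSq_eq zero_le_one hp2, ← l2Norm_sq, ← l2Norm_sq]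
      refine ENNReal.ofReal_le_ofReal ?_
      simp only [hJ]
      linarith only [h3, hpn]
    · have h4 := hp.sq_le hp2 c1
      simp only [hJ]
      nlinarith only [h4, h3, hpn, sq_nonneg (l2Norm (fun y => u τ y - v τ y) - l2Norm p), hF0,
        sq_nonneg (l2Norm p)]
  have b1 : (⨆ τ ∈ Icc 0 t, l2NormSq 0 1 (fun y => u τ y - v τ y)) ≤ ENNReal.ofReal F := by
    refine iSup₂_le fun τ hτ => ?_
    rw [l2NormSq_eq (isL2_of_continuousOn (ContinuousOn.slice hec hτ)), ← l2Norm_sq]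
    exact ENNReal.ofReal_le_ofReal (hF τ hτ)
  have b2 : ∫⁻ τ in Ioo 0 t, h1NormSq 0 1 (fun y => u τ y - v τ y)
      ≤ ENNReal.ofReal (∫ τ in Ioo 0 t, J τ) := by
    rw [ofReal_integral_eq_lintegral_ofReal hJi (Filter.Eventually.of_forall hJ0)]
    exact lintegral_mono_ae (hH1.mono fun τ hτ => hτ.1)
  have hεp : IsPrimitiveOn 0 t (fun τ => h τ - g τ)
      (fun τ => d.speed u h τ - d.speed v g τ) :=
    ((hs.isPrimitiveOn_front hT).mono le_rfl ht.1 htT).sub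
      ((hvs.isPrimitiveOn_front hT').mono le_rfl ht.1 ht.2)
  have hε2 : MemLp (fun τ => d.speed u h τ - d.speed v g τ) 2 (volume.restrict (Ioo 0 t)) :=
    memLp_of_continuousOn_Icc
      (((continuousOn_speed hσ (ContinuousOn.slice_time hs.u_cont c1) hs.h_cont).mono hcT).sub
        ((continuousOn_speed hσ (hvs.uk_cont 1 c1) hvs.h_cont).mono hcT'))
  have b3 : ∫ τ in Ioo 0 t, (h τ - g τ) ^ 2 ≤ T * F := by
    have i1 : ∫ τ in Ioo 0 t, (h τ - g τ) ^ 2 ≤ ∫ _ in Ioo 0 t, F :=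
      setIntegral_mono_on
        (memLp_of_continuousOn_Icc (hεp.continuousOn ht.1)).integrable_sq (hone F)
        measurableSet_Ioo fun τ hτ => hF' τ (Ioo_subset_Icc_self hτ)
    rw [hconst] at i1
    exact i1.trans (mul_le_mul_of_nonneg_right htT hF0)
  have b4 : ∫ τ in Ioo 0 t, (d.speed u h τ - d.speed v g τ) ^ 2
      ≤ 6 * K ^ 2 * ∫ τ in Ioo 0 t, J τ := by
    rw [← integral_const_mul]
    refine integral_mono_ae hε2.integrable_sq (hJi.const_mul _) ?_
    filter_upwards [hH1, ae_restrict_mem measurableSet_Ioo] with τ h1 hτ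
    have hτI := Ioo_subset_Icc_self hτ
    have h2 := pow_le_pow_left₀ (abs_nonneg _) (hsp τ hτI) 2
    rw [sq_abs] at h2
    have h3 := hF' τ hτI
    have h4 : F ≤ J τ := by
      have := Mesh.dirichlet_self_nonneg (M := M) (fun y => u τ y - v τ y)
      have h5 : 0 ≤ 4 * K ^ 2 * M.size ^ 2 * (1 + l2Norm (timeDeriv T u τ) ^ 2) := by positivity
      simp only [hJ]
      linarith only [this, h5]
    have h6 : (|u τ 1 - v τ 1| + |h τ - g τ|) ^ 2 ≤ 6 * J τ := by
      have h7 := h1.2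
      rw [← sq_abs] at h7 h3
      nlinarith only [h7, h3, h4, sq_nonneg (|u τ 1 - v τ 1| - |h τ - g τ|)]
    have h8 := mul_le_mul_of_nonneg_left h6 (sq_nonneg K)
    change (d.speed u h τ - d.speed v g τ) ^ 2 ≤ 6 * K ^ 2 * J τ
    linarith only [h2, h8]
  rw [energyNormSq, hεp.h1NormSq_eq ht.1 hε2]
  have n1 : 0 ≤ ∫ τ in Ioo 0 t, J τ := integral_nonneg hJ0
  have n2 : 0 ≤ ∫ τ in Ioo 0 t, (h τ - g τ) ^ 2 := integral_nonneg fun _ => sq_nonneg _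
  have n3 : 0 ≤ ∫ τ in Ioo 0 t, (d.speed u h τ - d.speed v g τ) ^ 2 :=
    integral_nonneg fun _ => sq_nonneg _
  refine (add_le_add_left (add_le_add b1 b2) _).trans ?_
  rw [← ENNReal.ofReal_add hF0 n1, ← ENNReal.ofReal_add (by linarith) (by linarith)]
  refine ENNReal.ofReal_le_ofReal ?_
  have := mul_le_mul_of_nonneg_left hJint (by positivity : 0 ≤ 6 * K ^ 2)
  linarith only [this, b3, b4, hJint]

end RubberFEM

theorem theorem5p1 (d : Data) (L T : ℝ) (hd : d.Admissible T) :
    ∃ That : ℝ, 0 < That ∧ That ≤ T ∧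
      ∀ (u : ℝ → ℝ → ℝ) (h : ℝ → ℝ), IsWeakSolution d L T u h →
        ∃ c : ℝ, 0 < c ∧
          ∀ (M : Mesh) (T' : ℝ), 0 < T' → T' ≤ T →
            ∀ (uk : ℝ → ℝ → ℝ) (hk : ℝ → ℝ), IsDiscreteSolution d M L T' uk hk →
              energyNormSq (min That T') (fun τ y => u τ y - uk τ y)
                + h1NormSq 0 (min That T') (fun τ => h τ - hk τ)
                ≤ ENNReal.ofReal (c * M.size ^ 2) := by
  obtain ⟨That, R, G, D, hTh, hThT, hbd⟩ := exists_discreteBounds hd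
  refine ⟨That, hTh, hThT, fun u h hs => ?_⟩
  have hT := hd.T_pos
  have hh := hd.h₀_pos
  obtain ⟨K₁, hK₁⟩ := hs.exists_solutionBounds hT hd.σ_contDiff
  obtain ⟨K₂, hK₂⟩ := hs.exists_boundary_bound hd
  obtain ⟨l, hl⟩ := hs.exists_speed_sub_le hd.σ_contDiff (2 * d.h₀)
  -- a common bound for both solutions, independent of the mesh
  obtain ⟨K, hK⟩ : ∃ K, ∀ x ∈ ({1, K₁, K₂, l, R, G, 2 * d.h₀, (d.h₀ / 2)⁻¹} : Finset ℝ), x ≤ K :=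
    Finset.exists_le _
  simp only [Finset.mem_insert, Finset.mem_singleton, forall_eq_or_imp, forall_eq] at hK
  obtain ⟨k1, k2, k3, k4, k5, k6, k7, k8⟩ := hK
  set N := ∫ τ in Ioo 0 T, l2Norm (timeDeriv T u τ) ^ 2 with hN
  have hN0 : 0 ≤ N := integral_nonneg fun τ => sq_nonneg _
  set Ξ := Real.exp (errConst K * T) * (4 * l2Norm (wd 0 1 d.u₀) ^ 2
        + errConst K * (6 * K ^ 2 * (T + N + max D 0))) with hΞ
  have hC0 : 0 ≤ errConst K := by rw [errConst]; positivity
  have hΞ0 : 0 ≤ Ξ := by positivity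
  refine ⟨Ξ + T * Ξ + (1 + 6 * K ^ 2) * (T * Ξ + 4 * K ^ 2 * (T + N) + 2 * (K ^ 2 * Ξ)),
    by positivity, fun M T' hT' hTT' v g hvs => ?_⟩
  have ht : min That T' ∈ Icc 0 T' := ⟨(lt_min hTh hT').le, min_le_right _ _⟩
  have hb := hbd M L T' hT' hTT' v g hvs
  have hu : ∀ᵐ τ ∂(volume.restrict (Ioo 0 T)), SolutionBounds d T u h K τ :=
    hK₁.mono fun τ hτ => hτ.mono k2
  have hsp : ∀ τ ∈ Icc 0 (min That T'),
      |d.speed u h τ - d.speed v g τ| ≤ K * (|u τ 1 - v τ 1| + |h τ - g τ|) := fun τ hτ => by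
    have hB := hb τ hτ
    refine (hl v g τ ⟨hτ.1, (hτ.2.trans ht.2).trans hTT'⟩ ?_).trans (by gcongr)
    rw [abs_of_nonneg ((by positivity : 0 ≤ d.h₀ / 2).trans hB.front_ge)]
    exact hB.front_le
  have hRK : R ≤ K ^ 2 := k5.trans (le_self_pow₀ k1 two_ne_zero)
  have hE : ∀ τ ∈ Icc 0 (min That T'), l2Norm (fun y => u τ y - v τ y) ^ 2 + (h τ - g τ) ^ 2
        + (∫ s in Ioo 0 τ, M.dirichlet (fun y => u s y - v s y) (fun y => u s y - v s y)) / K ^ 2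
      ≤ Ξ * M.size ^ 2 := fun τ hτ => by
    refine (energy_error_le hd hs hT' hTT' hvs k1 hu (hK₂.mono fun τ hτ => hτ.trans k3)
      ⟨hτ.1, hτ.2.trans ht.2⟩ (fun s hs' => hb s ⟨hs'.1, hs'.2.trans hτ.2⟩) hRK k6 k7 k8
      fun s hs' => hsp s ⟨hs'.1, hs'.2.trans hτ.2⟩).trans ?_
    rw [hΞ]
    gcongr
    exact le_max_left _ _
  have hI0 : ∀ τ, 0 ≤ (∫ s in Ioo 0 τ,
      M.dirichlet (fun y => u s y - v s y) (fun y => u s y - v s y)) / K ^ 2 := fun τ =>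
    div_nonneg (integral_nonneg fun s => Mesh.dirichlet_self_nonneg _) (sq_nonneg _)
  have hKpos : 0 < K ^ 2 := by positivity
  refine (errorNorm_le (K := K) (F := Ξ * M.size ^ 2) hs hd.σ_contDiff hT' hTT' hvs hu ht
    (fun τ hτ => ?_) (fun τ hτ => ?_) ?_ hsp).trans (le_of_eq ?_)
  · linarith only [hE τ hτ, hI0 τ, sq_nonneg (h τ - g τ)]
  · linarith only [hE τ hτ, hI0 τ, sq_nonneg (l2Norm fun y => u τ y - v τ y)]
  · have h1 := hE _ (right_mem_Icc.mpr ht.1)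
    rw [mul_comm, ← div_le_iff₀ hKpos]
    linarith only [h1, sq_nonneg (h (min That T') - g (min That T')),
      sq_nonneg (l2Norm fun y => u (min That T') y - v (min That T') y)]
  · congr 1
    rw [← hN]; ring
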